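/- **Setting.** For a unit let $Y_0(c),Y_2(c)$ be potential outcomes under the treatment paths $c=(c_1,c_2)\in\{0,1\}^2$, $D=(D_1,D_2)$ the realised path, $X\in\mathbb R^k$ covariates, $Y_t=Y_t(D)$, $\Delta Y=Y_2-Y_0$, and $S\in\{0,1\}$ the indicator that $D_1$ is observed. Fix $d=(d_1,d_2)\ne d'=(d_1',d_2')=(0,0)$. The target is $\tau=\mathbb E[Y_2(d)-Y_2(d')\mid D=d]$. Put $m_c(X)=\mathbb E[\Delta Y\mid D=c,X]$, $p_c(X)=\mathbb P(D=c\mid X)$, $p_{c_1|c_2}(X)=\mathbb P(D_1=c_1\mid D_2=c_2,X)$, $q_{e}(X)=\mathbb P(S=1\mid D_2=e,X)$. One observes $W_i=(Y_{i0},Y_{i2},S_i,S_iD_{i1},D_{i2},X_i)$, $i\ge 1$, i.i.d. copies of $W=(Y_0,Y_2,S,SD_1,D_2,X)$. **Identification assumptions.** The potential outcomes are integrable and for every path $c$: $\mathbb E[Y_0(c)\mid D=c,X]=\mathbb E[Y_0(0,0)\mid D=c,X]$; $\mathbb E[Y_2(0,0)-Y_0(0,0)\mid D=c,X]=\mathbb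 E[Y_2(0,0)-Y_0(0,0)\mid X]$; $p_c(X)$ is bounded away from one; moreover $p_{d'}(X)>0$ a.s. Missingness: $S\perp(D_1,\Delta Y)\mid (D_2,X)$, and $q_e(X)>0$ for $e=0,1$ (almost surely given $D_2=e$). **Working models.** $\mu_c(X;\beta_c)$, $\pi_{c_1|c_2}(X;\gamma_{c_1|c_2})$, $\pi_{c_2}(X;\gamma_{c_2})$, $\phi_{c_2}(X;\delta_{c_2})$ are parametric models of $m_c$, $p_{c_1|c_2}$, $\mathbb P(D_2=c_2\mid X)$, $q_{c_2}$, with pseudo-true parameters marked $*$, and $\pi_c=\pi_{c_1|c_2}\pi_{c_2}$. Write $\theta=(\beta,\gamma,\delta)$ and $$f_1=\tfrac{S}{\phi_{d_2}}1[D=d],\quad f_2=\tfrac{S}{\phi_{d_2'}}\tfrac{\pi_d}{\pi_{d'}}1[D=d'],\quad f_3=\pi_{d_1|d_2}1[D_2=d_2],\quad f_4=\tfrac{S}{\phi_{d_2}}\pi_{d_1|d_2}1[D_2=d_2],$$ $$Z_1=Z_2=\Delta Y-\mu_{d'},\qquad Z_3=Z_4=\mu_d-\mu_{d'},\qquad w_j=f_j/\mathbb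 E[f_j].$$ The estimand is $\tau^R=\mathbb E[(w_1-w_2)(\Delta Y-\mu_{d'})]+\mathbb E[(w_3-w_4)(\mu_d-\mu_{d'})]$ at $\theta^*$. The estimator $\hat\tau^R$ is the same expression with $\mathbb E$ (also inside the weights) replaced by the sample mean over $W_1,\dots,W_n$ and $\theta^*$ by first-step estimators $\hat\theta$. **Regularity.** Each working model entering $\hat\tau^R$ is jointly measurable in covariates and parameter; for a.e. $x$ it is continuous in its parameter on a compact parameter space and twice continuously differentiable on the interior; the pseudo-true value is an interior point; the supremum over the parameter space of its absolute value is integrable. For a.e. $x$ and all parameters in the parameter spaces, the models appearing in denominators, $\phi_{d_2},\phi_{d_2'},\pi_{d_1'|d_2'},\pi_{d_2'}$, are positive. For $j=1,\dots,4$, at $\theta^*$: $\mathbb E[f_j]\neq0$, $\mathbb E[f_j^2]<\infty$, $\mathbb E[(f_jZ_j)^2]<\infty$; and the derivatives in $\theta$ of $f_j$ and $f_jZ_j$ have an integrable envelope on a neighbourhood of $\theta^*$. **First step.** For each parameter $\eta$ among $\beta_d,\beta_{d'},\gamma_{d_1|d_2},\gamma_{d_2},\gamma_{d_1'|d_2'},\gamma_{d_2'},\delta_{d_2},\delta_{d_2'}$: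 $\sqrt n(\hat\eta-\eta^*)=n^{-1/2}\sum_{i\le n}b_\eta(W_i)+o_p(1)$ with $\mathbb E[b_\eta(W)]=0$ and $\mathbb E\|b_\eta(W)\|^2<\infty$. **Correct specification.** At least one of the following holds at $\theta^*$ (outcome and propensity score equalities for both $c=d$ and $c=d'$, missingness equalities for both $e=d_2$ and $e=d_2'$; almost surely, for conditional quantities given the conditioning event): (i) $\mu_c=m_c$, $\pi_c=p_c$, and the factor $\pi_{d_1|d_2}=p_{d_1|d_2}$; (ii) $\phi_e=q_e$ and $\pi_c=p_c$; (iii) $\phi_e=q_e$ and $\mu_c=m_c$. **Conclusion.** Then $\tau^R=\tau$; as $n\to\infty$, $\hat\tau^R\to\tau$ in probability and $\sqrt n(\hat\tau^R-\tau)=O_p(1)$; and $$\sqrt n(\hat\tau^R-\tau^R)=\frac1{\sqrt n}\sum_{i=1}^n\xi(W_i)+o_p(1)\rightsquigarrow N(0,\Omega),\qquad \Omega=\mathbb E[\xi(W)^2]<\infty,\quad \mathbb E[\xi(W)]=0.$$ Here, with everything evaluated at $\theta^*$, $\bar Z_j=Z_j-\mathbb E[w_jZ_j]$, and $\dot w_{j,\eta}=(\partial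 f_j/\partial\eta)/\mathbb E[f_j]$ (derivative in the argument $\eta$ of $f_j$, the denominator held fixed at $\theta^*$, and $\gamma_{d_2}$, $\gamma_{d_2'}$ treated as separate arguments of $f_2$), $$\xi=\psi+b_{\beta_d}'\mathbb E\Psi_{\beta_d}-b_{\beta_{d'}}'\mathbb E\Psi_{\beta_{d'}}-b_{\gamma_{d_1|d_2}}'\mathbb E\Psi_{\gamma_{d_1|d_2}}-b_{\gamma_{d_2}}'\mathbb E\Psi_{\gamma_{d_2}}-b_{\gamma_{d'}}'\mathbb E\Psi_{\gamma_{d'}}+b_{\delta_{d_2}}'\mathbb E\Psi_{\delta_{d_2}}-b_{\delta_{d_2'}}'\mathbb E\Psi_{\delta_{d_2'}},$$ where $\gamma_{d'}=(\gamma_{d_1'|d_2'},\gamma_{d_2'})$ and $\psi=w_1\bar Z_1-w_2\bar Z_2+w_3\bar Z_3-w_4\bar Z_4$, $\Psi_{\beta_d}=(w_3-w_4)\,\partial\mu_d/\partial\beta_d$, $\Psi_{\beta_{d'}}=(w_1-w_2+w_3-w_4)\,\partial\mu_{d'}/\partial\beta_{d'}$, $\Psi_{\gamma_{d_1|d_2}}=\dot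 w_{2,\gamma_{d_1|d_2}}\bar Z_2-\dot w_{3,\gamma_{d_1|d_2}}\bar Z_3+\dot w_{4,\gamma_{d_1|d_2}}\bar Z_4$, $\Psi_{\gamma_{d_2}}=\dot w_{2,\gamma_{d_2}}\bar Z_2$, $\Psi_{\gamma_{d'}}=\dot w_{2,\gamma_{d'}}\bar Z_2$, $\Psi_{\delta_{d_2}}=\dot w_{1,\delta_{d_2}}\bar Z_1-\dot w_{4,\delta_{d_2}}\bar Z_4$, $\Psi_{\delta_{d_2'}}=\dot w_{2,\delta_{d_2'}}\bar Z_2$. -/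

import Mathlib

open MeasureTheory ProbabilityTheory Filter Topology
open scoped ENNReal InnerProductSpace

noncomputable section

namespace MissingDID

/-! ### Population -/

/-- A treatment path `(d₁, d₂)`; `true` means treated. -/
abbrev Path : Type := Bool × Bool

/-- The comparison path `(0, 0)`. -/
abbrev baseline : Path := (false, false)

/-- `p`-dimensional Euclidean space (covariates, parameters). -/
abbrev Vec (p : ℕ) : Type := EuclideanSpace ℝ (Fin p)

/-- Indicator of a binary variable. -/
def ind (a : Bool) : ℝ := if a then 1 else 0

/-- The random variables describing one unit: potential outcomes `Y₀(c)`, `Y₂(c)` for every path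
`c`, treatments `D₁`, `D₂`, the indicator `S` of `D₁` being observed, and covariates `X`. -/
structure Population (Ω₀ : Type*) [MeasurableSpace Ω₀] (k : ℕ) where
  Y0 : Path → Ω₀ → ℝ
  Y2 : Path → Ω₀ → ℝ
  D1 : Ω₀ → Bool
  D2 : Ω₀ → Bool
  S : Ω₀ → Bool
  X : Ω₀ → Vec k
  measurable_Y0 : ∀ c, Measurable (Y0 c)
  measurable_Y2 : ∀ c, Measurable (Y2 c)
  measurable_D1 : Measurable D1
  measurable_D2 : Measurable D2
  measurable_S : Measurable S
  measurable_X : Measurable X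

/-- The observed record of one unit, `W = (Y₀, Y₂, S, S D₁, D₂, X)`. -/
abbrev Obs (k : ℕ) : Type := ℝ × ℝ × Bool × Bool × Bool × Vec k

namespace Obs

variable {k : ℕ}

/-- `ΔY = Y₂ - Y₀`. -/
def dY (w : Obs k) : ℝ := w.2.1 - w.1

/-- The observation indicator `S`. -/
def s (w : Obs k) : Bool := w.2.2.1

/-- The recorded path `(S D₁, D₂)`; it is the true path when `S = 1`. -/
def path (w : Obs k) : Path := (w.2.2.2.1, w.2.2.2.2.1)

/-- The treatment `D₂`. -/
def d2 (w : Obs k) : Bool := w.2.2.2.2.1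

/-- The covariates `X`. -/
def x (w : Obs k) : Vec k := w.2.2.2.2.2

end Obs

namespace Population

variable {Ω₀ : Type*} [MeasurableSpace Ω₀] {k : ℕ}

/-- The treatment path `D = (D₁, D₂)`. -/
def D (pop : Population Ω₀ k) (ω : Ω₀) : Path := (pop.D1 ω, pop.D2 ω)

/-- `ΔY = Y₂(D) - Y₀(D)`. -/
def dY (pop : Population Ω₀ k) (ω : Ω₀) : ℝ := pop.Y2 (pop.D ω) ω - pop.Y0 (pop.D ω) ω

/-- The observed record as a random element. -/
def obs (pop : Population Ω₀ k) (ω : Ω₀) : Obs k :=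
  (pop.Y0 (pop.D ω) ω, pop.Y2 (pop.D ω) ω, pop.S ω, pop.S ω && pop.D1 ω, pop.D2 ω, pop.X ω)

/-- The σ-algebra generated by `X`. -/
abbrev sigX (pop : Population Ω₀ k) : MeasurableSpace Ω₀ := MeasurableSpace.comap pop.X inferInstance

/-- The σ-algebra generated by `(D₂, X)`. -/
abbrev sigD2X (pop : Population Ω₀ k) : MeasurableSpace Ω₀ :=
  MeasurableSpace.comap (fun ω => (pop.D2 ω, pop.X ω)) inferInstance

theorem sigD2X_le (pop : Population Ω₀ k) : pop.sigD2X ≤ ‹MeasurableSpace Ω₀› :=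
  (pop.measurable_D2.prodMk pop.measurable_X).comap_le

/-- `ℙ(· | D = c)`. -/
def givenD (pop : Population Ω₀ k) (P : Measure Ω₀) (c : Path) : Measure Ω₀ :=
  cond P {ω | pop.D ω = c}

/-- `ℙ(· | D₂ = e)`. -/
def givenD2 (pop : Population Ω₀ k) (P : Measure Ω₀) (e : Bool) : Measure Ω₀ :=
  cond P {ω | pop.D2 ω = e}

/-- The law of the observed record. -/
def law (pop : Population Ω₀ k) (P : Measure Ω₀) : Measure (Obs k) := P.map pop.obs

/-- The law of the covariates. -/
def lawX (pop : Population Ω₀ k) (P : Measure Ω₀) : Measure (Vec k) := P.map pop.X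

/-- Outcome mean `m_c(X) = 𝔼[ΔY | D = c, X]`. -/
def m (pop : Population Ω₀ k) (P : Measure Ω₀) (c : Path) : Ω₀ → ℝ :=
  condExp pop.sigX (pop.givenD P c) pop.dY

/-- Propensity score `p_c(X) = ℙ(D = c | X)`. -/
def p (pop : Population Ω₀ k) (P : Measure Ω₀) (c : Path) : Ω₀ → ℝ :=
  condExp pop.sigX P (fun ω => ind (decide (pop.D ω = c)))

/-- Conditional propensity score `p_{c₁|c₂}(X) = ℙ(D₁ = c₁ | D₂ = c₂, X)`. -/
def pC (pop : Population Ω₀ k) (P : Measure Ω₀) (c : Path) : Ω₀ → ℝ :=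
  condExp pop.sigX (pop.givenD2 P c.2) (fun ω => ind (decide (pop.D1 ω = c.1)))

/-- Probability of an observed treatment, `q_e(X) = ℙ(S = 1 | D₂ = e, X)`. -/
def q (pop : Population Ω₀ k) (P : Measure Ω₀) (e : Bool) : Ω₀ → ℝ :=
  condExp pop.sigX (pop.givenD2 P e) (fun ω => ind (pop.S ω))

/-- The path-dependent average treatment effect on the treated,
`τ = 𝔼[Y₂(d) - Y₂(0,0) | D = d]`. -/
def patt (pop : Population Ω₀ k) (P : Measure Ω₀) (d : Path) : ℝ :=
  ∫ ω, (pop.Y2 d ω - pop.Y2 baseline ω) ∂(pop.givenD P d)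

end Population

/-- Difference-in-differences assumptions. -/
structure DIDAssumptions {Ω₀ : Type*} [MeasurableSpace Ω₀] {k : ℕ} (pop : Population Ω₀ k)
    (P : Measure Ω₀) : Prop where
  integrable_Y0 : ∀ c, Integrable (pop.Y0 c) P
  integrable_Y2 : ∀ c, Integrable (pop.Y2 c) P
  no_anticipation : ∀ c,
    condExp pop.sigX (pop.givenD P c) (pop.Y0 c) =ᵐ[pop.givenD P c]
      condExp pop.sigX (pop.givenD P c) (pop.Y0 baseline)
  parallel_trends : ∀ c,
    condExp pop.sigX (pop.givenD P c) (fun ω => pop.Y2 baseline ω - pop.Y0 baseline ω)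
      =ᵐ[pop.givenD P c]
      condExp pop.sigX P (fun ω => pop.Y2 baseline ω - pop.Y0 baseline ω)
  overlap : ∀ c, ∃ ε : ℝ, 0 < ε ∧ ∀ᵐ ω ∂P, pop.p P c ω ≤ 1 - ε
  /-- Conditioning on `D = (0,0)` and `X` makes sense for almost every value of `X`. -/
  overlap_baseline : ∀ᵐ ω ∂P, 0 < pop.p P baseline ω

/-- Missing at random, `S ⟂ (D₁, ΔY) | (D₂, X)`, and partial observability. -/
structure MissingAssumptions {Ω₀ : Type*} [MeasurableSpace Ω₀] [StandardBorelSpace Ω₀] {k : ℕ}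
    (pop : Population Ω₀ k) (P : Measure Ω₀) [IsFiniteMeasure P] : Prop where
  missing_at_random :
    CondIndepFun pop.sigD2X pop.sigD2X_le pop.S (fun ω => (pop.D1 ω, pop.dY ω)) P
  partial_observability : ∀ e, ∀ᵐ ω ∂(pop.givenD2 P e), 0 < pop.q P e ω

/-! ### Working models -/

/-- Parametric working models: `mu c x β` for the outcome mean `m_c`, `piC c x γ` for the
conditional propensity score `p_{c₁|c₂}`, `piM e x γ` for `ℙ(D₂ = e | X)`, and `phi e x δ` for
`q_e`. -/
structure Models (k nb nc nm nd : ℕ) where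
  mu : Path → Vec k → Vec nb → ℝ
  piC : Path → Vec k → Vec nc → ℝ
  piM : Bool → Vec k → Vec nm → ℝ
  phi : Bool → Vec k → Vec nd → ℝ

/-- Parameters of all working models: `(β_c)_c`, `(γ_{c₁|c₂})_c`, `(γ_e)_e`, `(δ_e)_e`. -/
abbrev Params (nb nc nm nd : ℕ) : Type :=
  (Path → Vec nb) × (Path → Vec nc) × (Bool → Vec nm) × (Bool → Vec nd)

namespace Params

variable {nb nc nm nd : ℕ}

/-- `β_c`. -/
def be (θ : Params nb nc nm nd) (c : Path) : Vec nb := θ.1 c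
/-- `γ_{c₁|c₂}`. -/
def gc (θ : Params nb nc nm nd) (c : Path) : Vec nc := θ.2.1 c
/-- `γ_e`. -/
def gm (θ : Params nb nc nm nd) (e : Bool) : Vec nm := θ.2.2.1 e
/-- `δ_e`. -/
def de (θ : Params nb nc nm nd) (e : Bool) : Vec nd := θ.2.2.2 e

end Params

/-- Regularity of one parametric model `f(x; θ)` with parameter space `K` and pseudo-true value
`θs`, for covariates with law `PX`. -/
structure RegularModel {k r : ℕ} (PX : Measure (Vec k)) (f : Vec k → Vec r → ℝ) (K : Set (Vec r))
    (θs : Vec r) : Prop where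
  measurable : Measurable (fun z : Vec k × Vec r => f z.1 z.2)
  continuousOn : ∀ᵐ x ∂PX, ContinuousOn (f x) K
  isCompact : IsCompact K
  mem_interior : θs ∈ interior K
  envelope : ∫⁻ x, ⨆ θ ∈ K, ‖f x θ‖ₑ ∂PX < ∞
  contDiffOn : ∀ᵐ x ∂PX, ContDiffOn ℝ 2 (f x) (interior K)

/-- The estimator sequence `est` of `θs` is asymptotically linear in the sample `W` with influence
function `b`:
`√n (est n - θs) = n^{-1/2} ∑_{i<n} b(W_i) + o_p(1)`, where `b` has mean zero and finite variance
under the law `Q` of one observation. -/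
structure AsymptoticallyLinear {k r : ℕ} {Ω : Type*} [MeasurableSpace Ω] (P : Measure Ω)
    (W : ℕ → Ω → Obs k) (Q : Measure (Obs k)) (est : ℕ → Ω → Vec r) (θs : Vec r)
    (b : Obs k → Vec r) : Prop where
  measurable_est : ∀ n, Measurable (est n)
  measurable_b : Measurable b
  memLp_b : MemLp b 2 Q
  integral_b : ∫ w, b w ∂Q = 0
  expansion : TendstoInMeasure P
    (fun (n : ℕ) ω => Real.sqrt n • (est n ω - θs)
      - (Real.sqrt n)⁻¹ • ∑ i ∈ Finset.range n, b (W i ω)) atTop (fun _ => 0)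

section Weights

variable {k nb nc nm nd : ℕ}

/-! The unnormalised weights, with their parameters as separate arguments. -/

/-- `(S / φ_{d₂}(X; δ)) 1[D = d]`. -/
def num1 (M : Models k nb nc nm nd) (d : Path) (δ : Vec nd) (w : Obs k) : ℝ :=
  ind w.s / M.phi d.2 w.x δ * ind (decide (w.path = d))

/-- `(S / φ_{d₂'}(X; δ')) (π_d(X; γ) / π_{d'}(X; γ')) 1[D = d']`, where `d' = (0,0)` and
`π_c = π_{c₁|c₂} π_{c₂}`; the arguments are `γ_{d₁|d₂}, γ_{d₂}, γ_{d₁'|d₂'}, γ_{d₂'}, δ_{d₂'}`. -/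
def num2 (M : Models k nb nc nm nd) (d : Path) (gc : Vec nc) (gm : Vec nm) (gc0 : Vec nc)
    (gm0 : Vec nm) (δ0 : Vec nd) (w : Obs k) : ℝ :=
  ind w.s / M.phi baseline.2 w.x δ0
    * ((M.piC d w.x gc * M.piM d.2 w.x gm)
        / (M.piC baseline w.x gc0 * M.piM baseline.2 w.x gm0))
    * ind (decide (w.path = baseline))

/-- `π_{d₁|d₂}(X; γ) 1[D₂ = d₂]`. -/
def num3 (M : Models k nb nc nm nd) (d : Path) (gc : Vec nc) (w : Obs k) : ℝ :=
  M.piC d w.x gc * ind (decide (w.d2 = d.2))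

/-- `(S / φ_{d₂}(X; δ)) π_{d₁|d₂}(X; γ) 1[D₂ = d₂]`. -/
def num4 (M : Models k nb nc nm nd) (d : Path) (gc : Vec nc) (δ : Vec nd) (w : Obs k) : ℝ :=
  ind w.s / M.phi d.2 w.x δ * M.piC d w.x gc * ind (decide (w.d2 = d.2))

/-- The four unnormalised weights at the full parameter `θ`. -/
def num (M : Models k nb nc nm nd) (d : Path) (j : Fin 4) (θ : Params nb nc nm nd) (w : Obs k) :
    ℝ :=
  ![num1 M d (θ.de d.2) w,
    num2 M d (θ.gc d) (θ.gm d.2) (θ.gc baseline) (θ.gm baseline.2) (θ.de baseline.2) w,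
    num3 M d (θ.gc d) w,
    num4 M d (θ.gc d) (θ.de d.2) w] j

/-- The variable each of the four weights is applied to: `ΔY - μ_{d'}` for the first two,
`μ_d - μ_{d'}` for the last two. -/
def resid (M : Models k nb nc nm nd) (d : Path) (j : Fin 4) (θ : Params nb nc nm nd) (w : Obs k) :
    ℝ :=
  ![w.dY - M.mu baseline w.x (θ.be baseline),
    w.dY - M.mu baseline w.x (θ.be baseline),
    M.mu d w.x (θ.be d) - M.mu baseline w.x (θ.be baseline),
    M.mu d w.x (θ.be d) - M.mu baseline w.x (θ.be baseline)] j

/-- The normalised weight `w_j`, where `E` is an averaging operation (population expectation or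
sample mean). -/
def wt (M : Models k nb nc nm nd) (d : Path) (E : (Obs k → ℝ) → ℝ) (j : Fin 4)
    (θ : Params nb nc nm nd) (w : Obs k) : ℝ :=
  num M d j θ w / E (num M d j θ)

/-- `E[(w₁ - w₂)(ΔY - μ_{d'})] + E[(w₃ - w₄)(μ_d - μ_{d'})]` for an averaging operation `E`. -/
def robust (M : Models k nb nc nm nd) (d : Path) (E : (Obs k → ℝ) → ℝ) (θ : Params nb nc nm nd) :
    ℝ :=
  E (fun w => (wt M d E 0 θ w - wt M d E 1 θ w)
      * (w.dY - M.mu baseline w.x (θ.be baseline)))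
    + E (fun w => (wt M d E 2 θ w - wt M d E 3 θ w)
      * (M.mu d w.x (θ.be d) - M.mu baseline w.x (θ.be baseline)))

/-- Expectation under `Q`. -/
def popMean (Q : Measure (Obs k)) (h : Obs k → ℝ) : ℝ := ∫ w, h w ∂Q

/-- Sample mean `n⁻¹ ∑_{i<n} h(W_i)`. -/
def sampleMean {Ω : Type*} (W : ℕ → Ω → Obs k) (n : ℕ) (ω : Ω) (h : Obs k → ℝ) : ℝ :=
  (n : ℝ)⁻¹ * ∑ i ∈ Finset.range n, h (W i ω)

/-- The robust estimand at the parameter `θ`. -/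
def estimand (M : Models k nb nc nm nd) (d : Path) (Q : Measure (Obs k))
    (θ : Params nb nc nm nd) : ℝ :=
  robust M d (popMean Q) θ

/-- The two-step robust estimator from `n` observations, with first-step estimates `est n`. -/
def estimator {Ω : Type*} (M : Models k nb nc nm nd) (d : Path) (W : ℕ → Ω → Obs k)
    (est : ℕ → Ω → Params nb nc nm nd) (n : ℕ) (ω : Ω) : ℝ :=
  robust M d (sampleMean W n ω) (est n ω)

/-! ### The influence function -/

/-- `resid_j - 𝔼[w_j resid_j]`. -/
def cresid (M : Models k nb nc nm nd) (d : Path) (Q : Measure (Obs k)) (θ : Params nb nc nm nd)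
    (j : Fin 4) (w : Obs k) : ℝ :=
  resid M d j θ w - ∫ v, wt M d (popMean Q) j θ v * resid M d j θ v ∂Q

/-- `ψ`, the influence function for known working-model parameters. -/
def psi (M : Models k nb nc nm nd) (d : Path) (Q : Measure (Obs k)) (θ : Params nb nc nm nd)
    (w : Obs k) : ℝ :=
  wt M d (popMean Q) 0 θ w * cresid M d Q θ 0 w - wt M d (popMean Q) 1 θ w * cresid M d Q θ 1 w
    + wt M d (popMean Q) 2 θ w * cresid M d Q θ 2 w
    - wt M d (popMean Q) 3 θ w * cresid M d Q θ 3 w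

/-! Derivatives `ẇ` of the weights: gradients in one parameter of the unnormalised weight, divided
by the fixed normalising expectation. -/

/-- `ẇ₁`, in `δ_{d₂}`. -/
def dw1 (M : Models k nb nc nm nd) (d : Path) (Q : Measure (Obs k)) (θ : Params nb nc nm nd)
    (w : Obs k) : Vec nd :=
  (∫ v, num M d 0 θ v ∂Q)⁻¹ • gradient (fun a => num1 M d a w) (θ.de d.2)

/-- `ẇ₂`, in `γ_{d₁|d₂}`. -/
def dw2gc (M : Models k nb nc nm nd) (d : Path) (Q : Measure (Obs k)) (θ : Params nb nc nm nd)
    (w : Obs k) : Vec nc :=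
  (∫ v, num M d 1 θ v ∂Q)⁻¹ • gradient (fun a => num2 M d a (θ.gm d.2) (θ.gc baseline)
    (θ.gm baseline.2) (θ.de baseline.2) w) (θ.gc d)

/-- `ẇ₂`, in `γ_{d₂}`. -/
def dw2gm (M : Models k nb nc nm nd) (d : Path) (Q : Measure (Obs k)) (θ : Params nb nc nm nd)
    (w : Obs k) : Vec nm :=
  (∫ v, num M d 1 θ v ∂Q)⁻¹ • gradient (fun a => num2 M d (θ.gc d) a (θ.gc baseline)
    (θ.gm baseline.2) (θ.de baseline.2) w) (θ.gm d.2)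

/-- `ẇ₂`, in the component `γ_{d₁'|d₂'}` of `γ_{d'}`. -/
def dw2gc0 (M : Models k nb nc nm nd) (d : Path) (Q : Measure (Obs k)) (θ : Params nb nc nm nd)
    (w : Obs k) : Vec nc :=
  (∫ v, num M d 1 θ v ∂Q)⁻¹ • gradient (fun a => num2 M d (θ.gc d) (θ.gm d.2) a
    (θ.gm baseline.2) (θ.de baseline.2) w) (θ.gc baseline)

/-- `ẇ₂`, in the component `γ_{d₂'}` of `γ_{d'}`. -/
def dw2gm0 (M : Models k nb nc nm nd) (d : Path) (Q : Measure (Obs k)) (θ : Params nb nc nm nd)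
    (w : Obs k) : Vec nm :=
  (∫ v, num M d 1 θ v ∂Q)⁻¹ • gradient (fun a => num2 M d (θ.gc d) (θ.gm d.2) (θ.gc baseline)
    a (θ.de baseline.2) w) (θ.gm baseline.2)

/-- `ẇ₂`, in `δ_{d₂'}`. -/
def dw2de0 (M : Models k nb nc nm nd) (d : Path) (Q : Measure (Obs k)) (θ : Params nb nc nm nd)
    (w : Obs k) : Vec nd :=
  (∫ v, num M d 1 θ v ∂Q)⁻¹ • gradient (fun a => num2 M d (θ.gc d) (θ.gm d.2) (θ.gc baseline)
    (θ.gm baseline.2) a w) (θ.de baseline.2)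

/-- `ẇ₃`, in `γ_{d₁|d₂}`. -/
def dw3 (M : Models k nb nc nm nd) (d : Path) (Q : Measure (Obs k)) (θ : Params nb nc nm nd)
    (w : Obs k) : Vec nc :=
  (∫ v, num M d 2 θ v ∂Q)⁻¹ • gradient (fun a => num3 M d a w) (θ.gc d)

/-- `ẇ₄`, in `γ_{d₁|d₂}`. -/
def dw4gc (M : Models k nb nc nm nd) (d : Path) (Q : Measure (Obs k)) (θ : Params nb nc nm nd)
    (w : Obs k) : Vec nc :=
  (∫ v, num M d 3 θ v ∂Q)⁻¹ • gradient (fun a => num4 M d a (θ.de d.2) w) (θ.gc d)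

/-- `ẇ₄`, in `δ_{d₂}`. -/
def dw4de (M : Models k nb nc nm nd) (d : Path) (Q : Measure (Obs k)) (θ : Params nb nc nm nd)
    (w : Obs k) : Vec nd :=
  (∫ v, num M d 3 θ v ∂Q)⁻¹ • gradient (fun a => num4 M d (θ.gc d) a w) (θ.de d.2)

/-- `Ψ_{β_d}`. -/
def PsiBe (M : Models k nb nc nm nd) (d : Path) (Q : Measure (Obs k)) (θ : Params nb nc nm nd)
    (w : Obs k) : Vec nb :=
  (wt M d (popMean Q) 2 θ w - wt M d (popMean Q) 3 θ w) • gradient (M.mu d w.x) (θ.be d)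

/-- `Ψ_{β_{d'}}`. -/
def PsiBe0 (M : Models k nb nc nm nd) (d : Path) (Q : Measure (Obs k)) (θ : Params nb nc nm nd)
    (w : Obs k) : Vec nb :=
  (wt M d (popMean Q) 0 θ w - wt M d (popMean Q) 1 θ w + wt M d (popMean Q) 2 θ w
    - wt M d (popMean Q) 3 θ w) • gradient (M.mu baseline w.x) (θ.be baseline)

/-- `Ψ_{γ_{d₁|d₂}}`. -/
def PsiGc (M : Models k nb nc nm nd) (d : Path) (Q : Measure (Obs k)) (θ : Params nb nc nm nd)
    (w : Obs k) : Vec nc :=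
  cresid M d Q θ 1 w • dw2gc M d Q θ w - cresid M d Q θ 2 w • dw3 M d Q θ w
    + cresid M d Q θ 3 w • dw4gc M d Q θ w

/-- `Ψ_{γ_{d₂}}`. -/
def PsiGm (M : Models k nb nc nm nd) (d : Path) (Q : Measure (Obs k)) (θ : Params nb nc nm nd)
    (w : Obs k) : Vec nm :=
  cresid M d Q θ 1 w • dw2gm M d Q θ w

/-- First component of `Ψ_{γ_{d'}}`. -/
def PsiGc0 (M : Models k nb nc nm nd) (d : Path) (Q : Measure (Obs k)) (θ : Params nb nc nm nd)
    (w : Obs k) : Vec nc :=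
  cresid M d Q θ 1 w • dw2gc0 M d Q θ w

/-- Second component of `Ψ_{γ_{d'}}`. -/
def PsiGm0 (M : Models k nb nc nm nd) (d : Path) (Q : Measure (Obs k)) (θ : Params nb nc nm nd)
    (w : Obs k) : Vec nm :=
  cresid M d Q θ 1 w • dw2gm0 M d Q θ w

/-- `Ψ_{δ_{d₂}}`. -/
def PsiDe (M : Models k nb nc nm nd) (d : Path) (Q : Measure (Obs k)) (θ : Params nb nc nm nd)
    (w : Obs k) : Vec nd :=
  cresid M d Q θ 0 w • dw1 M d Q θ w - cresid M d Q θ 3 w • dw4de M d Q θ w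

/-- `Ψ_{δ_{d₂'}}`. -/
def PsiDe0 (M : Models k nb nc nm nd) (d : Path) (Q : Measure (Obs k)) (θ : Params nb nc nm nd)
    (w : Obs k) : Vec nd :=
  cresid M d Q θ 1 w • dw2de0 M d Q θ w

/-- The influence function `ξ` of the robust estimator, where `b w` collects the influence functions
of the first-step estimators. -/
def xi (M : Models k nb nc nm nd) (d : Path) (Q : Measure (Obs k)) (θ : Params nb nc nm nd)
    (b : Obs k → Params nb nc nm nd) (w : Obs k) : ℝ :=
  psi M d Q θ w
    + ⟪(b w).be d, ∫ v, PsiBe M d Q θ v ∂Q⟫_ℝ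
    - ⟪(b w).be baseline, ∫ v, PsiBe0 M d Q θ v ∂Q⟫_ℝ
    - ⟪(b w).gc d, ∫ v, PsiGc M d Q θ v ∂Q⟫_ℝ
    - ⟪(b w).gm d.2, ∫ v, PsiGm M d Q θ v ∂Q⟫_ℝ
    - (⟪(b w).gc baseline, ∫ v, PsiGc0 M d Q θ v ∂Q⟫_ℝ
        + ⟪(b w).gm baseline.2, ∫ v, PsiGm0 M d Q θ v ∂Q⟫_ℝ)
    + ⟪(b w).de d.2, ∫ v, PsiDe M d Q θ v ∂Q⟫_ℝ
    - ⟪(b w).de baseline.2, ∫ v, PsiDe0 M d Q θ v ∂Q⟫_ℝ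

/-! ### Regularity and correct specification -/

/-- Regularity of the working models that enter the estimator for the path `d`, at the pseudo-true
parameter `θ`, where `Q` and `PX` are the laws of the observed record and of the covariates. -/
structure Regularity (M : Models k nb nc nm nd) (d : Path) (Q : Measure (Obs k))
    (PX : Measure (Vec k)) (KB : Path → Set (Vec nb)) (KC : Path → Set (Vec nc))
    (KM : Bool → Set (Vec nm)) (KD : Bool → Set (Vec nd)) (θ : Params nb nc nm nd) : Prop where
  mu : ∀ c ∈ ({d, baseline} : Set Path), RegularModel PX (M.mu c) (KB c) (θ.be c)
  piC : ∀ c ∈ ({d, baseline} : Set Path), RegularModel PX (M.piC c) (KC c) (θ.gc c)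
  piM : ∀ e ∈ ({d.2, baseline.2} : Set Bool), RegularModel PX (M.piM e) (KM e) (θ.gm e)
  phi : ∀ e ∈ ({d.2, baseline.2} : Set Bool), RegularModel PX (M.phi e) (KD e) (θ.de e)
  /-- The working probabilities the weights divide by are positive. -/
  phi_pos : ∀ e ∈ ({d.2, baseline.2} : Set Bool), ∀ᵐ x ∂PX, ∀ a ∈ KD e, 0 < M.phi e x a
  piC_pos : ∀ᵐ x ∂PX, ∀ a ∈ KC baseline, 0 < M.piC baseline x a
  piM_pos : ∀ᵐ x ∂PX, ∀ a ∈ KM baseline.2, 0 < M.piM baseline.2 x a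
  /-- The normalised weights are well defined. -/
  num_ne_zero : ∀ j, ∫ w, num M d j θ w ∂Q ≠ 0
  /-- Finite second moments at the pseudo-true value. -/
  memLp_num : ∀ j, MemLp (num M d j θ) 2 Q
  memLp_num_resid : ∀ j, MemLp (fun w => num M d j θ w * resid M d j θ w) 2 Q
  /-- Derivatives in the parameters have an integrable envelope near the pseudo-true value. -/
  deriv_num : ∀ j, ∃ N ∈ 𝓝 θ,
    ∫⁻ w, ⨆ t ∈ N, ‖fderiv ℝ (fun t' => num M d j t' w) t‖ₑ ∂Q < ∞
  deriv_num_resid : ∀ j, ∃ N ∈ 𝓝 θ,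
    ∫⁻ w, ⨆ t ∈ N, ‖fderiv ℝ (fun t' => num M d j t' w * resid M d j t' w) t‖ₑ ∂Q < ∞

variable {Ω₀ : Type*} [MeasurableSpace Ω₀]

/-- The outcome models are correct at `θ`: `μ(β_c) = m_c(X)` for `c = d, d'`. -/
def OutcomeCorrect (pop : Population Ω₀ k) (P : Measure Ω₀) (M : Models k nb nc nm nd) (d : Path)
    (θ : Params nb nc nm nd) : Prop :=
  ∀ c ∈ ({d, baseline} : Set Path),
    (fun ω => M.mu c (pop.X ω) (θ.be c)) =ᵐ[pop.givenD P c] pop.m P c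

/-- The propensity score models are correct at `θ`: `π_{c₁|c₂} π_{c₂} = p_c(X)` for
`c = d, d'`. -/
def PropensityCorrect (pop : Population Ω₀ k) (P : Measure Ω₀) (M : Models k nb nc nm nd)
    (d : Path) (θ : Params nb nc nm nd) : Prop :=
  ∀ c ∈ ({d, baseline} : Set Path),
    (fun ω => M.piC c (pop.X ω) (θ.gc c) * M.piM c.2 (pop.X ω) (θ.gm c.2)) =ᵐ[P] pop.p P c

/-- The factor `π_{d₁|d₂}` of the propensity score model is correct at `θ`. -/
def CondPropensityCorrect (pop : Population Ω₀ k) (P : Measure Ω₀) (M : Models k nb nc nm nd)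
    (d : Path) (θ : Params nb nc nm nd) : Prop :=
  (fun ω => M.piC d (pop.X ω) (θ.gc d)) =ᵐ[pop.givenD2 P d.2] pop.pC P d

/-- The missing treatment models are correct at `θ`: `φ(δ_e) = q_e(X)` for `e = d₂, d₂'`. -/
def MissingCorrect (pop : Population Ω₀ k) (P : Measure Ω₀) (M : Models k nb nc nm nd) (d : Path)
    (θ : Params nb nc nm nd) : Prop :=
  ∀ e ∈ ({d.2, baseline.2} : Set Bool),
    (fun ω => M.phi e (pop.X ω) (θ.de e)) =ᵐ[pop.givenD2 P e] pop.q P e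

end Weights

end MissingDID

end

/-! Estimand and estimator are the same signed sum, with signs +, -, +, -, of four ratios E[f_j Z_j]
/ E[f_j], once with expectations and once with sample means (`estimand_eq_sum`, `estimator_eq_sum`).
Identification and asymptotics then separate.

Identification. By missingness at random, the probability of S = 1 given (D₁, ΔY, D₂, X) is q
(`setIntegral_observed`), so S/φ acts inside the moments as κ = q/φ, a function of X, and they
become integrals over {D = d}, {D = d'} and {D₂ = d₂}. If φ is correct, κ = 1: the third and fourth
ratios cancel and the first two form a doubly robust difference-in-differences. Either the odds
π_d/π_{d'} transport {D = d'} to {D = d}, where the error of μ_{d'} drops out, or the residual ΔY -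
μ_{d'} has mean zero under D = d' and μ_{d'} is the untreated trend (`estimand_eq_patt_of_missing`).
If φ is wrong but the outcome models and π_{d₁|d₂} are right, the second ratio vanishes. For
functions of X, weighting {D₂ = d₂} by π_{d₁|d₂} amounts to integrating over {D = d}, so the fourth
ratio cancels the first and the third one is τ (`estimand_eq_patt_of_outcome`).

Asymptotics. Each numerator and denominator is a sample mean of a smooth function at an
asymptotically linear parameter estimate. Its Taylor remainder is controlled without second
derivatives: the supremum of the difference-quotient error over a ball tends to zero as the ball
shrinks and is dominated by twice the derivative envelope, so its expectation tends to zero and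
Markov's inequality applies (`smallInProb_remainder`). The law of large numbers for the derivative,
the delta method for a ratio (`SmallInProb.ratio`) and summation over j give the expansion; the
central limit theorem and Slutsky's lemma give normality.

The influence function obtained this way contains total derivatives in θ. The chain rule splits them
into the gradients Ψ, and the centred residuals arise from differentiating the normalising
denominators (`slope_eq`, `xi_eq_sum_ratioInfluence`). The delicate case is d₂ = d₂', where γ_{d₂}
and γ_{d₂'} are one parameter that cancels from f₂ (`integrable_PsiGm_pairing`). -/

/-! ### Stochastic order calculus -/

section StochasticOrder

variable {Ω : Type*} [MeasurableSpace Ω] {P : Measure Ω} [IsProbabilityMeasure P]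
  {E F G : Type*} [NormedAddCommGroup E] [NormedAddCommGroup F] [NormedAddCommGroup G]

/-- `X n = o_p(1)`. -/
def SmallInProb (P : Measure Ω) (X : ℕ → Ω → E) : Prop :=
  ∀ ε : ℝ, 0 < ε → ∀ η : ℝ, 0 < η → ∀ᶠ n in atTop, P.real {ω | ε ≤ ‖X n ω‖} ≤ η

/-- `X n = O_p(1)`. -/
def BddInProb (P : Measure Ω) (X : ℕ → Ω → E) : Prop :=
  ∀ ε : ℝ, 0 < ε → ∃ C : ℝ, ∀ᶠ n : ℕ in atTop, P.real {ω | C < ‖X n ω‖} ≤ ε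

theorem tendstoInMeasure_iff_smallInProb {X : ℕ → Ω → E} {Y : Ω → E} :
    TendstoInMeasure P X atTop Y ↔ SmallInProb P (fun n ω => X n ω - Y ω) := by
  rw [tendstoInMeasure_iff_measureReal_norm]
  refine forall₂_congr fun ε hε => ⟨fun h η hη => ?_, fun h => ?_⟩
  · exact (h.eventually (ge_mem_nhds hη))
  · refine tendsto_order.2 ⟨fun a ha => Eventually.of_forall fun n =>
      ha.trans_le measureReal_nonneg, fun a ha => ?_⟩
    filter_upwards [h (a / 2) (by positivity)] with n hn
    linarith

theorem tendstoInMeasure_zero_iff_smallInProb {X : ℕ → Ω → E} :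
    TendstoInMeasure P X atTop (fun _ => 0) ↔ SmallInProb P X := by
  simp [tendstoInMeasure_iff_smallInProb]

theorem SmallInProb.add {X Y : ℕ → Ω → E} (hX : SmallInProb P X) (hY : SmallInProb P Y) :
    SmallInProb P (fun n ω => X n ω + Y n ω) := by
  intro ε hε η hη
  filter_upwards [hX (ε / 2) (by positivity) (η / 2) (by positivity),
    hY (ε / 2) (by positivity) (η / 2) (by positivity)] with n h1 h2
  calc P.real {ω | ε ≤ ‖X n ω + Y n ω‖}
      ≤ P.real ({ω | ε / 2 ≤ ‖X n ω‖} ∪ {ω | ε / 2 ≤ ‖Y n ω‖}) := by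
        refine measureReal_mono fun ω hω => ?_
        by_contra hcon
        simp only [Set.mem_union, Set.mem_ofPred_eq, not_or, not_le] at hcon hω
        linarith [norm_add_le (X n ω) (Y n ω)]
    _ ≤ _ := measureReal_union_le _ _
    _ ≤ η := by linarith

theorem SmallInProb.of_norm_le_eventually {X : ℕ → Ω → E} {Y : ℕ → Ω → F} (hX : SmallInProb P X)
    (h : ∀ᶠ n in atTop, ∀ ω, ‖Y n ω‖ ≤ ‖X n ω‖) : SmallInProb P Y := by
  intro ε hε η hη
  filter_upwards [hX ε hε η hη, h] with n h1 h2
  exact (measureReal_mono fun ω hω => le_trans hω (h2 ω)).trans h1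

theorem SmallInProb.of_norm_le {X : ℕ → Ω → E} {Y : ℕ → Ω → F} (hX : SmallInProb P X)
    (h : ∀ n ω, ‖Y n ω‖ ≤ ‖X n ω‖) : SmallInProb P Y :=
  hX.of_norm_le_eventually (Eventually.of_forall h)

omit [IsProbabilityMeasure P] in
theorem smallInProb_zero : SmallInProb P (fun _ _ => (0 : E)) := by
  intro ε hε η hη
  refine Eventually.of_forall fun n => ?_
  simp [not_le.2 hε, hη.le]

theorem SmallInProb.finset_sum {ι : Type*} (s : Finset ι) {X : ι → ℕ → Ω → E}
    (h : ∀ i ∈ s, SmallInProb P (X i)) : SmallInProb P (fun n ω => ∑ i ∈ s, X i n ω) := by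
  classical
  induction s using Finset.induction_on with
  | empty => simpa using smallInProb_zero
  | insert a s ha ih =>
    simp only [Finset.sum_insert ha]
    exact (h a (by simp)).add (ih fun i hi => h i (by simp [hi]))

theorem SmallInProb.bdd {X : ℕ → Ω → E} (hX : SmallInProb P X) : BddInProb P X := by
  intro ε hε
  refine ⟨1, ?_⟩
  filter_upwards [hX 1 one_pos ε hε] with n hn
  refine (measureReal_mono (fun ω hω => ?_) (measure_ne_top _ _)).trans hn
  exact le_of_lt (Set.mem_ofPred_eq ▸ hω)

omit [IsProbabilityMeasure P] in
theorem bddInProb_const (c : E) : BddInProb P (fun _ _ => c) := by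
  intro ε hε
  exact ⟨‖c‖, by simp [hε.le]⟩

theorem BddInProb.of_norm_le {X : ℕ → Ω → E} {Y : ℕ → Ω → F} (hX : BddInProb P X)
    (h : ∀ n ω, ‖Y n ω‖ ≤ ‖X n ω‖) : BddInProb P Y := by
  intro ε hε
  obtain ⟨C, hC⟩ := hX ε hε
  refine ⟨C, ?_⟩
  filter_upwards [hC] with n h1
  exact (measureReal_mono fun ω hω => lt_of_lt_of_le hω (h n ω)).trans h1

theorem BddInProb.add {X Y : ℕ → Ω → E} (hX : BddInProb P X) (hY : BddInProb P Y) :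
    BddInProb P (fun n ω => X n ω + Y n ω) := by
  intro ε hε
  obtain ⟨C, hC⟩ := hX (ε / 2) (by positivity)
  obtain ⟨C', hC'⟩ := hY (ε / 2) (by positivity)
  refine ⟨C + C', ?_⟩
  filter_upwards [hC, hC'] with n h1 h2
  calc P.real {ω | C + C' < ‖X n ω + Y n ω‖}
      ≤ P.real ({ω | C < ‖X n ω‖} ∪ {ω | C' < ‖Y n ω‖}) := by
        refine measureReal_mono fun ω hω => ?_
        by_contra hcon
        simp only [Set.mem_union, Set.mem_ofPred_eq, not_or, not_lt] at hcon hω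
        linarith [norm_add_le (X n ω) (Y n ω)]
    _ ≤ _ := measureReal_union_le _ _
    _ ≤ ε := by linarith

theorem BddInProb.finset_sum {ι : Type*} (s : Finset ι) {X : ι → ℕ → Ω → E}
    (h : ∀ i ∈ s, BddInProb P (X i)) : BddInProb P (fun n ω => ∑ i ∈ s, X i n ω) := by
  classical
  induction s using Finset.induction_on with
  | empty => simpa using bddInProb_const (0 : E)
  | insert a s ha ih =>
    simp only [Finset.sum_insert ha]
    exact (h a (by simp)).add (ih fun i hi => h i (by simp [hi]))

/-- The product enters only through a norm bound, so the same rule serves scalar multiplication and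
the application of a random linear map to a random vector. -/
theorem SmallInProb.mul_bdd {X : ℕ → Ω → E} {Y : ℕ → Ω → F} {Z : ℕ → Ω → G}
    (hX : SmallInProb P X) (hY : BddInProb P Y) (h : ∀ n ω, ‖Z n ω‖ ≤ ‖X n ω‖ * ‖Y n ω‖) :
    SmallInProb P Z := by
  intro ε hε η hη
  obtain ⟨C, hC⟩ := hY (η / 2) (by positivity)
  -- The bound C may be nonpositive, whereas the threshold for X needs a positive divisor.
  have hC' : 0 < max C 1 := by positivity
  filter_upwards [hC, hX (ε / max C 1) (by positivity) (η / 2) (by positivity)] with n h1 h2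
  calc P.real {ω | ε ≤ ‖Z n ω‖}
      ≤ P.real ({ω | C < ‖Y n ω‖} ∪ {ω | ε / max C 1 ≤ ‖X n ω‖}) := by
        refine measureReal_mono fun ω hω => ?_
        by_contra hcon
        simp only [Set.mem_union, Set.mem_ofPred_eq, not_or, not_lt, not_le] at hcon hω
        have h3 : ‖X n ω‖ * ‖Y n ω‖ ≤ ‖X n ω‖ * max C 1 := by
          gcongr
          exact hcon.1.trans (le_max_left _ _)
        have h4 := (lt_div_iff₀ hC').1 hcon.2
        linarith [h n ω]
    _ ≤ _ := measureReal_union_le _ _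
    _ ≤ η := by linarith

theorem SmallInProb.const_mul {X : ℕ → Ω → ℝ} (hX : SmallInProb P X) (c : ℝ) :
    SmallInProb P (fun n ω => c * X n ω) :=
  hX.mul_bdd (bddInProb_const c) fun n ω => by rw [norm_mul, mul_comm]

theorem BddInProb.const_mul {X : ℕ → Ω → ℝ} (hX : BddInProb P X) (c : ℝ) :
    BddInProb P (fun n ω => c * X n ω) := by
  intro ε hε
  obtain ⟨C, hC⟩ := hX ε hε
  refine ⟨|c| * C, ?_⟩
  filter_upwards [hC] with n h1
  refine (measureReal_mono fun ω hω => ?_).trans h1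
  simp only [Set.mem_ofPred_eq, norm_mul, Real.norm_eq_abs] at hω ⊢
  exact lt_of_mul_lt_mul_left hω (abs_nonneg c)

/-- A sequence that is bounded in probability after scaling by `√n` is small. -/
theorem BddInProb.small_of_sqrt [NormedSpace ℝ E] {X : ℕ → Ω → E}
    (hX : BddInProb P (fun n ω => Real.sqrt n • X n ω)) : SmallInProb P X := by
  intro ε hε η hη
  obtain ⟨C, hC⟩ := hX η hη
  have hlim : Tendsto (fun n : ℕ => Real.sqrt n * ε) atTop atTop :=
    (Real.tendsto_sqrt_atTop.comp tendsto_natCast_atTop_atTop).atTop_mul_const hε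
  filter_upwards [hC, hlim.eventually_gt_atTop C] with n h1 h2
  refine (measureReal_mono fun ω hω => ?_).trans h1
  simp only [Set.mem_ofPred_eq, norm_smul, Real.norm_eq_abs, abs_of_nonneg (Real.sqrt_nonneg _)]
    at hω ⊢
  exact h2.trans_le (by gcongr)

/-- Where |X - c| < |c|/2 one has |X| > |c|/2, hence |X⁻¹ - c⁻¹| ≤ |X - c| / (|c|·|c|/2). The
convention 0⁻¹ = 0 plays no role on that event. -/
theorem SmallInProb.inv_sub_inv {X : ℕ → Ω → ℝ} {c : ℝ} (hc : c ≠ 0)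
    (hX : SmallInProb P (fun n ω => X n ω - c)) :
    SmallInProb P (fun n ω => (X n ω)⁻¹ - c⁻¹) := by
  have hcpos : 0 < |c| := abs_pos.2 hc
  intro ε hε η hη
  filter_upwards [hX (|c| / 2) (by positivity) (η / 2) (by positivity),
    hX (ε * (|c| * (|c| / 2))) (by positivity) (η / 2) (by positivity)] with n h1 h2
  calc P.real {ω | ε ≤ ‖(X n ω)⁻¹ - c⁻¹‖}
      ≤ P.real ({ω | |c| / 2 ≤ ‖X n ω - c‖} ∪ {ω | ε * (|c| * (|c| / 2)) ≤ ‖X n ω - c‖}) := by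
        refine measureReal_mono fun ω hω => ?_
        by_contra hcon
        simp only [Set.mem_union, Set.mem_ofPred_eq, not_or, not_le, Real.norm_eq_abs]
          at hcon hω
        have hX2 : |c| / 2 < |X n ω| := by
          have := abs_sub_abs_le_abs_sub c (X n ω)
          rw [abs_sub_comm] at this
          linarith [hcon.1]
        have hX0 : X n ω ≠ 0 := by
          intro h0
          rw [h0, abs_zero] at hX2
          linarith
        have : (X n ω)⁻¹ - c⁻¹ = -(X n ω - c) / (c * X n ω) := by
          field_simp
          ring
        rw [this, abs_div, abs_neg, abs_mul, le_div_iff₀ (by positivity)] at hω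
        have : ε * (|c| * (|c| / 2)) ≤ ε * (|c| * |X n ω|) := by gcongr
        linarith [hcon.2]
    _ ≤ _ := measureReal_union_le _ _
    _ ≤ η := by linarith

/-- The delta method for a ratio. -/
theorem SmallInProb.ratio {A B U V : ℕ → Ω → ℝ} {a c : ℝ} (hc : c ≠ 0)
    (hA : SmallInProb P (fun n ω => Real.sqrt n * (A n ω - a) - U n ω))
    (hB : SmallInProb P (fun n ω => Real.sqrt n * (B n ω - c) - V n ω))
    (hU : BddInProb P U) (hV : BddInProb P V) :
    SmallInProb P (fun n ω => Real.sqrt n * (A n ω / B n ω - a / c)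
      - (c⁻¹ * U n ω - a / c * (c⁻¹ * V n ω))) := by
  have hA' : BddInProb P (fun n ω => Real.sqrt n * (A n ω - a)) := by
    simpa using hA.bdd.add hU
  have hB' : BddInProb P (fun n ω => Real.sqrt n * (B n ω - c)) := by
    simpa using hB.bdd.add hV
  have hBs : SmallInProb P (fun n ω => B n ω - c) := BddInProb.small_of_sqrt hB'
  have hinv := hBs.inv_sub_inv hc
  -- For B ≠ 0, A/B - a/c = B⁻¹((A - a) - (a/c)(B - c)) exactly. Replacing B⁻¹ by c⁻¹ costs a small
  -- factor times this bounded term.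
  have hnum : BddInProb P (fun n ω => Real.sqrt n * (A n ω - a)
      + -(a / c) * (Real.sqrt n * (B n ω - c))) := hA'.add (hB'.const_mul _)
  have h1 : SmallInProb P (fun n ω => ((B n ω)⁻¹ - c⁻¹) * (Real.sqrt n * (A n ω - a)
      + -(a / c) * (Real.sqrt n * (B n ω - c)))) :=
    hinv.mul_bdd hnum fun n ω => (norm_mul _ _).le
  have h2 := (h1.add (hA.const_mul c⁻¹)).add (hB.const_mul (-(a / c) * c⁻¹))
  -- the two sides agree unless the sample denominator vanishes
  intro ε hε η hη
  filter_upwards [h2 ε hε (η / 2) (by positivity),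
    hBs |c| (abs_pos.2 hc) (η / 2) (by positivity)] with n hn1 hn2
  refine (le_trans (measureReal_mono fun ω hω => ?_) (measureReal_union_le _ _)).trans
    ((add_le_add hn1 hn2).trans (by linarith))
  by_cases h0 : B n ω = 0
  · right
    simp [h0]
  · left
    simp only [Set.mem_ofPred_eq] at hω ⊢
    convert! hω using 2
    field_simp
    ring

end StochasticOrder

/-! ### Sample means -/

section IID

variable {Ω 𝒲 : Type*} [MeasurableSpace Ω] [MeasurableSpace 𝒲] {P : Measure Ω}
  [IsProbabilityMeasure P] {Q : Measure 𝒲} {W : ℕ → Ω → 𝒲}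
  {E : Type*} [NormedAddCommGroup E] [NormedSpace ℝ E]

/-- `n^{-1/2}` times a sum of i.i.d. centred square integrable variables is bounded in
probability. -/
theorem bddInProb_sum_real (hW : ∀ i, Measurable (W i)) (hind : iIndepFun W P)
    (hlaw : ∀ i, P.map (W i) = Q) {f : 𝒲 → ℝ} (hfm : Measurable f) (hf : MemLp f 2 Q)
    (hf0 : ∫ w, f w ∂Q = 0) :
    BddInProb P (fun (n : ℕ) ω => (Real.sqrt n)⁻¹ * ∑ i ∈ Finset.range n, f (W i ω)) := by
  have hLp : ∀ i, MemLp (fun ω => f (W i ω)) 2 P := fun i => by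
    have := hf
    rw [← hlaw i] at this
    exact this.comp_measurePreserving ⟨hW i, rfl⟩
  have hmean : ∀ i, ∫ ω, f (W i ω) ∂P = 0 := fun i => by
    rw [← hf0, ← hlaw i, integral_map (hW i).aemeasurable]
    exact hfm.aestronglyMeasurable
  have hvar : ∀ i, Var[fun ω => f (W i ω); P] = ∫ w, f w ^ 2 ∂Q := fun i => by
    rw [variance_of_integral_eq_zero (X := fun ω => f (W i ω)) (hfm.comp (hW i)).aemeasurable
      (hmean i), ← hlaw i,
      integral_map (hW i).aemeasurable]
    exact (hfm.pow_const 2).aestronglyMeasurable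
  set v := ∫ w, f w ^ 2 ∂Q with hv
  have hv0 : 0 ≤ v := integral_nonneg fun _ => sq_nonneg _
  have hsum : ∀ n : ℕ, Var[∑ i ∈ Finset.range n, fun ω => f (W i ω); P] = n * v := fun n => by
    rw [IndepFun.variance_sum (fun i _ => hLp i)]
    · simp [hvar]
    · intro i _ j _ hij
      exact (hind.indepFun hij).comp hfm hfm
  have hsm : ∀ n : ℕ, ∫ ω, (∑ i ∈ Finset.range n, fun ω => f (W i ω)) ω ∂P = 0 := fun n => by
    simp only [Finset.sum_apply]
    rw [integral_finsetSum _ fun i _ => (hLp i).integrable (by norm_num)]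
    simp [hmean]
  intro ε hε
  -- Chebyshev's inequality bounds the tail by v/C², and this C makes it at most ε. The 1 keeps C
  -- positive when the variance v is zero.
  refine ⟨Real.sqrt ((v + 1) / ε), ?_⟩
  filter_upwards [eventually_gt_atTop 0] with n hn
  have hn' : (0 : ℝ) < n := by exact_mod_cast hn
  set S := ∑ i ∈ Finset.range n, fun ω => f (W i ω) with hS
  have hSLp : MemLp S 2 P := memLp_finsetSum' _ fun i _ => hLp i
  have hc : 0 < Real.sqrt n * Real.sqrt ((v + 1) / ε) := by positivity
  have hch := meas_ge_le_variance_div_sq hSLp hc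
  rw [hsum n, hsm n, mul_pow, Real.sq_sqrt hn'.le, Real.sq_sqrt (by positivity)] at hch
  have hle : (n * v) / (n * ((v + 1) / ε)) ≤ ε := by
    rw [mul_div_mul_left _ _ hn'.ne', div_le_iff₀ (by positivity)]
    field_simp
    linarith
  calc P.real {ω | Real.sqrt ((v + 1) / ε) < ‖(Real.sqrt n)⁻¹ * ∑ i ∈ Finset.range n, f (W i ω)‖}
      ≤ P.real {ω | Real.sqrt n * Real.sqrt ((v + 1) / ε) ≤ |S ω - 0|} := by
        refine measureReal_mono fun ω hω => ?_
        simp only [Set.mem_ofPred_eq, norm_mul, norm_inv, Real.norm_eq_abs,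
          abs_of_nonneg (Real.sqrt_nonneg _), sub_zero, hS, Finset.sum_apply] at hω ⊢
        rw [inv_mul_eq_div, lt_div_iff₀ (by positivity)] at hω
        linarith
    _ ≤ ε := by
        rw [measureReal_def]
        exact (ENNReal.toReal_mono ENNReal.ofReal_ne_top
          (hch.trans (ENNReal.ofReal_le_ofReal hle))).trans (ENNReal.toReal_ofReal hε.le).le

/-- Coordinates in a basis reduce the vector case to the real one, since the norm is at most the sum
of the coordinates weighted by the norms of the basis vectors. -/
theorem bddInProb_sum [FiniteDimensional ℝ E] [MeasurableSpace E] [BorelSpace E]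
    (hW : ∀ i, Measurable (W i)) (hind : iIndepFun W P)
    (hlaw : ∀ i, P.map (W i) = Q) {f : 𝒲 → E} (hfm : Measurable f) (hf : MemLp f 2 Q)
    (hf0 : ∫ w, f w ∂Q = 0) :
    BddInProb P (fun (n : ℕ) ω => (Real.sqrt n)⁻¹ • ∑ i ∈ Finset.range n, f (W i ω)) := by
  have : IsProbabilityMeasure Q := hlaw 0 ▸ Measure.isProbabilityMeasure_map (hW 0).aemeasurable
  have : CompleteSpace E := FiniteDimensional.complete ℝ E
  let b := Module.finBasis ℝ E
  let φ : Fin (Module.finrank ℝ E) → E →L[ℝ] ℝ := fun j => LinearMap.toContinuousLinearMap (b.coord j)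
  have hφ : ∀ j, BddInProb P (fun (n : ℕ) ω =>
      (Real.sqrt n)⁻¹ * ∑ i ∈ Finset.range n, φ j (f (W i ω))) := fun j =>
    bddInProb_sum_real hW hind hlaw (f := fun w => φ j (f w)) ((φ j).continuous.measurable.comp hfm)
      ((φ j).comp_memLp' hf) (by
        rw [(φ j).integral_comp_comm (hf.integrable (by norm_num)), hf0, map_zero])
  have hsm : BddInProb P (fun (n : ℕ) ω => ∑ j, ‖b j‖ *
      |(Real.sqrt n)⁻¹ * ∑ i ∈ Finset.range n, φ j (f (W i ω))|) :=
    BddInProb.finset_sum _ fun j _ => BddInProb.const_mul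
      ((hφ j).of_norm_le fun n ω => by simp) _
  refine hsm.of_norm_le fun n ω => ?_
  set x := (Real.sqrt n)⁻¹ • ∑ i ∈ Finset.range n, f (W i ω) with hx
  have hcoord : ∀ j, (Real.sqrt n)⁻¹ * ∑ i ∈ Finset.range n, φ j (f (W i ω)) = b.repr x j := by
    intro j
    change _ = φ j x
    rw [hx, map_smul, map_sum, smul_eq_mul]
  simp only [hcoord]
  calc ‖x‖ = ‖∑ j, b.repr x j • b j‖ := by rw [b.sum_repr]
    _ ≤ ∑ j, ‖b.repr x j • b j‖ := norm_sum_le _ _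
    _ = ∑ j, ‖b j‖ * |b.repr x j| := by simp [norm_smul, mul_comm]
    _ ≤ _ := le_abs_self _

/-- Weak law of large numbers for the sample. -/
theorem smallInProb_sampleMean [CompleteSpace E] [MeasurableSpace E] [BorelSpace E]
    (hW : ∀ i, Measurable (W i)) (hind : iIndepFun W P) (hlaw : ∀ i, P.map (W i) = Q)
    {f : 𝒲 → E} (hf : Integrable f Q) :
    SmallInProb P (fun (n : ℕ) ω => (n : ℝ)⁻¹ • ∑ i ∈ Finset.range n, f (W i ω) - ∫ w, f w ∂Q) := by
  -- An integrable f is only a.e. measurable, while independence of the summands needs a measurable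
  -- version. Each W_i preserves measure, so a.s. the two versions agree along the whole sample.
  set g := hf.1.mk f
  have hfg : f =ᵐ[Q] g := hf.1.ae_eq_mk
  have hg : Measurable g := hf.1.stronglyMeasurable_mk.measurable
  have hgs : StronglyMeasurable g := hf.1.stronglyMeasurable_mk
  have hmp : ∀ i, MeasurePreserving (W i) P Q := fun i => ⟨hW i, hlaw i⟩
  have hgi : Integrable g Q := hf.congr hfg
  have hsl := strong_law_ae (μ := P) (fun i ω => g (W i ω)) ((hmp 0).integrable_comp_of_integrable hgi)
    (fun i j hij => (hind.indepFun hij).comp hg hg)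
    (fun i => ⟨(hg.comp (hW i)).aemeasurable, (hg.comp (hW 0)).aemeasurable, by
      change P.map (g ∘ W i) = P.map (g ∘ W 0)
      rw [← Measure.map_map hg (hW i), ← Measure.map_map hg (hW 0), hlaw, hlaw]⟩)
  have hae : ∀ᵐ ω ∂P, ∀ i, f (W i ω) = g (W i ω) :=
    ae_all_iff.2 fun i => (hmp i).quasiMeasurePreserving.ae hfg
  have hint : ∫ ω, g (W 0 ω) ∂P = ∫ w, f w ∂Q := by
    rw [integral_congr_ae hfg, ← hlaw 0, integral_map (hW 0).aemeasurable hgs.aestronglyMeasurable]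
  rw [hint] at hsl
  refine (tendstoInMeasure_iff_smallInProb (Y := fun _ => ∫ w, f w ∂Q)).1 ?_
  refine tendstoInMeasure_of_tendsto_ae (fun n => ?_) ?_
  · refine AEStronglyMeasurable.const_smul ?_ _
    refine AEStronglyMeasurable.congr (f := fun ω => ∑ i ∈ Finset.range n, g (W i ω)) ?_ ?_
    · exact (Finset.stronglyMeasurable_fun_sum _ fun i _ =>
        hgs.comp_measurable (hW i)).aestronglyMeasurable
    · filter_upwards [hae] with ω hω
      simp [hω]
  · filter_upwards [hsl, hae] with ω h1 h2
    simpa [h2] using h1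

end IID

/-! ### Linearisation of a sample mean at an estimated parameter -/

section Linearisation

variable {E : Type*} [NormedAddCommGroup E] [NormedSpace ℝ E] [SecondCountableTopology E]

/-- The modulus of differentiability of `f` at `t₀` with candidate derivative `L` at scale `δ`. -/
noncomputable def diffModulus (f : E → ℝ) (L : E →L[ℝ] ℝ) (t₀ : E) (δ : ℝ) : ℝ≥0∞ :=
  ⨆ j : ℕ, ⨆ _ : dist (TopologicalSpace.denseSeq E j) t₀ < δ,
    ‖f (TopologicalSpace.denseSeq E j) - f t₀ - L (TopologicalSpace.denseSeq E j - t₀)‖ₑ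
      / ‖TopologicalSpace.denseSeq E j - t₀‖ₑ

/-- The modulus is a supremum over a countable dense set, which keeps it measurable in the data.
Continuity of f on the ball carries the bound from that set to every point, in particular to a
random one. -/
theorem enorm_sub_le_diffModulus_mul {f : E → ℝ} {L : E →L[ℝ] ℝ} {t₀ : E} {δ : ℝ}
    (hf : ContinuousOn f (Metric.ball t₀ δ)) {t : E} (ht : t ∈ Metric.ball t₀ δ) :
    ‖f t - f t₀ - L (t - t₀)‖ₑ ≤ diffModulus f L t₀ δ * ‖t - t₀‖ₑ := by
  rcases eq_or_ne t t₀ with rfl | hne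
  · simp
  rcases eq_or_ne (diffModulus f L t₀ δ) ∞ with htop | htop
  · rw [htop, ENNReal.top_mul]
    · exact le_top
    · simpa [sub_eq_zero] using hne
  set c := (diffModulus f L t₀ δ).toReal with hc
  have hdense : ∀ s ∈ Metric.ball t₀ δ ∩ Set.range (TopologicalSpace.denseSeq E),
      ‖f s - f t₀ - L (s - t₀)‖ ≤ c * ‖s - t₀‖ := by
    rintro _ ⟨hs, j, rfl⟩
    set s := TopologicalSpace.denseSeq E j with hsdef
    rcases eq_or_ne s t₀ with h0 | h0
    · simp [h0]
    have h1 : ‖f s - f t₀ - L (s - t₀)‖ₑ / ‖s - t₀‖ₑ ≤ diffModulus f L t₀ δ :=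
      le_iSup₂_of_le (f := fun j (_ : dist (TopologicalSpace.denseSeq E j) t₀ < δ) =>
        ‖f (TopologicalSpace.denseSeq E j) - f t₀ - L (TopologicalSpace.denseSeq E j - t₀)‖ₑ
        / ‖TopologicalSpace.denseSeq E j - t₀‖ₑ) j hs le_rfl
    rw [ENNReal.div_le_iff (by simpa [sub_eq_zero] using h0) (by simp)] at h1
    have h2 := ENNReal.toReal_mono (ENNReal.mul_ne_top htop (by simp)) h1
    simpa [ENNReal.toReal_mul] using h2
  have hcl : t ∈ closure (Metric.ball t₀ δ ∩ Set.range (TopologicalSpace.denseSeq E)) :=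
    (TopologicalSpace.denseRange_denseSeq E).open_subset_closure_inter Metric.isOpen_ball ht
  have : (𝓝[Metric.ball t₀ δ ∩ Set.range (TopologicalSpace.denseSeq E)] t).NeBot :=
    mem_closure_iff_nhdsWithin_neBot.1 hcl
  have hft : Tendsto f (𝓝[Metric.ball t₀ δ ∩ Set.range (TopologicalSpace.denseSeq E)] t)
      (𝓝 (f t)) := (hf t ht).mono_left (nhdsWithin_mono _ Set.inter_subset_left)
  have hid : Tendsto (fun s : E => s - t₀)
      (𝓝[Metric.ball t₀ δ ∩ Set.range (TopologicalSpace.denseSeq E)] t) (𝓝 (t - t₀)) :=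
    (tendsto_id.mono_left nhdsWithin_le_nhds).sub_const _
  have hle : ‖f t - f t₀ - L (t - t₀)‖ ≤ c * ‖t - t₀‖ :=
    le_of_tendsto_of_tendsto
      (((hft.sub_const _).sub ((L.continuous.tendsto _).comp hid)).norm)
      (hid.norm.const_mul c) (by
        filter_upwards [self_mem_nhdsWithin] with s hs using hdense s hs)
  rw [← ENNReal.ofReal_toReal htop, ← ofReal_norm, ← ofReal_norm,
    ← ENNReal.ofReal_mul ENNReal.toReal_nonneg]
  exact ENNReal.ofReal_le_ofReal hle

/-- The little-o in the definition of the derivative is already uniform over directions, so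
differentiability at the single point t₀ suffices. -/
theorem tendsto_diffModulus {f : E → ℝ} {L : E →L[ℝ] ℝ} {t₀ : E} (hf : HasFDerivAt f L t₀)
    {δ : ℕ → ℝ} (hδ : Tendsto δ atTop (𝓝 0)) :
    Tendsto (fun k => diffModulus f L t₀ (δ k)) atTop (𝓝 0) := by
  refine ENNReal.tendsto_nhds_zero.2 fun ε hε => ?_
  rcases eq_or_ne ε ∞ with rfl | hε'
  · simp
  have hpos : 0 < ε.toReal := ENNReal.toReal_pos hε.ne' hε'
  have h := (hasFDerivAt_iff_isLittleO.1 hf).def hpos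
  obtain ⟨r, hr, hball⟩ := Metric.eventually_nhds_iff.1 h
  filter_upwards [hδ.eventually_lt_const hr] with k hk
  refine iSup₂_le fun j hj => ?_
  set s := TopologicalSpace.denseSeq E j
  rcases eq_or_ne s t₀ with h0 | h0
  · simp [h0]
  rw [ENNReal.div_le_iff (by simpa [sub_eq_zero] using h0) (by simp), ← ENNReal.ofReal_toReal hε',
    ← ofReal_norm, ← ofReal_norm, ← ENNReal.ofReal_mul ENNReal.toReal_nonneg]
  exact ENNReal.ofReal_le_ofReal (hball (hj.trans hk))

/-- The mean value inequality bounds the increment of f, and the operator norm bounds the linear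
term, both by the envelope times the distance: hence the factor 2. This is the dominating function
for the limit of shrinking balls. -/
theorem diffModulus_le {f : E → ℝ} {t₀ : E} {δ : ℝ} {N : Set E}
    (hδ : 0 < δ) (hN : Metric.ball t₀ δ ⊆ N) (hf : ∀ t ∈ Metric.ball t₀ δ, DifferentiableAt ℝ f t) :
    diffModulus f (fderiv ℝ f t₀) t₀ δ ≤ 2 * ⨆ t ∈ N, ‖fderiv ℝ f t‖ₑ := by
  refine iSup₂_le fun j hj => ?_
  set s := TopologicalSpace.denseSeq E j
  set e := ⨆ t ∈ N, ‖fderiv ℝ f t‖ₑ with he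
  have hle : ∀ t ∈ N, ‖fderiv ℝ f t‖ₑ ≤ e := fun t ht =>
    le_iSup₂ (f := fun t (_ : t ∈ N) => ‖fderiv ℝ f t‖ₑ) t ht
  rcases eq_or_ne s t₀ with h0 | h0
  · simp [h0]
  rcases eq_or_ne e ∞ with htop | htop
  · simp [htop]
  have hR : ∀ t ∈ Metric.ball t₀ δ, ‖fderiv ℝ f t‖ ≤ e.toReal := fun t ht => by
    have := ENNReal.toReal_mono htop (hle t (hN ht))
    simpa using this
  have ht₀ : t₀ ∈ Metric.ball t₀ δ := Metric.mem_ball_self hδ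
  have h1 : ‖f s - f t₀‖ ≤ e.toReal * ‖s - t₀‖ :=
    (convex_ball t₀ δ).norm_image_sub_le_of_norm_fderiv_le (𝕜 := ℝ) hf hR ht₀ hj
  have h2 : ‖fderiv ℝ f t₀ (s - t₀)‖ ≤ e.toReal * ‖s - t₀‖ :=
    (ContinuousLinearMap.le_opNorm _ _).trans (by gcongr; exact hR _ ht₀)
  have h3 : ‖f s - f t₀ - fderiv ℝ f t₀ (s - t₀)‖ ≤ 2 * e.toReal * ‖s - t₀‖ :=
    (norm_sub_le _ _).trans (by linarith)
  rw [ENNReal.div_le_iff (by simpa [sub_eq_zero] using h0) (by simp), ← ENNReal.ofReal_toReal htop,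
    ← ofReal_norm, ← ofReal_norm,
    show (2 : ℝ≥0∞) = ENNReal.ofReal 2 by simp, ← ENNReal.ofReal_mul (by norm_num),
    ← ENNReal.ofReal_mul (by positivity)]
  exact ENNReal.ofReal_le_ofReal h3

variable {Ω 𝒲 : Type*} [MeasurableSpace Ω] [MeasurableSpace 𝒲] {P : Measure Ω}
  [IsProbabilityMeasure P] {Q : Measure 𝒲} {W : ℕ → Ω → 𝒲} [FiniteDimensional ℝ E]

omit [SecondCountableTopology E] in
-- Directional derivatives are a.e. limits of measurable difference quotients, and in finite
-- dimension the derivative is a finite combination of them.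
theorem aestronglyMeasurable_fderiv {h : E → 𝒲 → ℝ} {t₀ : E} (hmeas : ∀ t, Measurable (h t))
    (hdiff : ∀ᵐ w ∂Q, DifferentiableAt ℝ (fun t => h t w) t₀) :
    AEStronglyMeasurable (fun w => fderiv ℝ (fun t => h t w) t₀) Q := by
  have hv : ∀ v : E, AEMeasurable (fun w => fderiv ℝ (fun t => h t w) t₀ v) Q := by
    intro v
    refine aemeasurable_of_tendsto_metrizable_ae (f := fun (n : ℕ) w =>
      ((n : ℝ) + 1) • (h (t₀ + ((n : ℝ) + 1)⁻¹ • v) w - h t₀ w)) atTop (fun n => ?_) ?_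
    · exact (((hmeas _).sub (hmeas _)).const_smul ((n : ℝ) + 1)).aemeasurable
    · filter_upwards [hdiff] with w hw
      refine hw.hasFDerivAt.lim v ?_
      refine tendsto_norm_atTop_atTop.comp ?_
      exact tendsto_atTop_add_const_right _ _ tendsto_natCast_atTop_atTop
  let b := Module.finBasis ℝ E
  have hrep : (fun w => fderiv ℝ (fun t => h t w) t₀) = fun w =>
      ∑ j, (fderiv ℝ (fun t => h t w) t₀ (b j)) • LinearMap.toContinuousLinearMap (b.coord j) := by
    funext w
    ext v
    conv_lhs => rw [← b.sum_repr v, map_sum]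
    simp [mul_comm]
  rw [hrep]
  exact Finset.aestronglyMeasurable_fun_sum _ fun j _ =>
    (hv (b j)).aestronglyMeasurable.smul_const _

omit [SecondCountableTopology E] in
theorem integrable_fderiv_of_envelope {h : E → 𝒲 → ℝ} {t₀ : E} (hmeas : ∀ t, Measurable (h t))
    (hdiff : ∀ᵐ w ∂Q, DifferentiableAt ℝ (fun t => h t w) t₀) {N : Set E} (hN : N ∈ 𝓝 t₀)
    (henv : ∫⁻ w, ⨆ t ∈ N, ‖fderiv ℝ (fun t' => h t' w) t‖ₑ ∂Q < ∞) :
    Integrable (fun w => fderiv ℝ (fun t => h t w) t₀) Q :=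
  ⟨aestronglyMeasurable_fderiv hmeas hdiff, (lintegral_mono fun w =>
    le_iSup₂ (f := fun t (_ : t ∈ N) => ‖fderiv ℝ (fun t' => h t' w) t‖ₑ) t₀
      (mem_of_mem_nhds hN)).trans_lt henv⟩

variable [MeasurableSpace E] [BorelSpace E]

omit [FiniteDimensional ℝ E] [MeasurableSpace E] [BorelSpace E] in
/-- The remainder of the linearisation is negligible at root-`n` rate. -/
theorem smallInProb_remainder (hW : ∀ i, Measurable (W i))
    (hlaw : ∀ i, P.map (W i) = Q) {T : ℕ → Ω → E} {t₀ : E}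
    (hT : BddInProb P (fun n ω => Real.sqrt n • (T n ω - t₀)))
    {h : E → 𝒲 → ℝ} (hmeas : ∀ t, Measurable (h t)) {N U : Set E} (hN : N ∈ 𝓝 t₀) (hU : U ∈ 𝓝 t₀)
    (hdiff : ∀ᵐ w ∂Q, ∀ t ∈ U, DifferentiableAt ℝ (fun t' => h t' w) t)
    (hD : AEStronglyMeasurable (fun w => fderiv ℝ (fun t => h t w) t₀) Q)
    (henv : ∫⁻ w, ⨆ t ∈ N, ‖fderiv ℝ (fun t' => h t' w) t‖ₑ ∂Q < ∞) :
    SmallInProb P (fun (n : ℕ) ω => Real.sqrt n * ((n : ℝ)⁻¹ * ∑ i ∈ Finset.range n,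
      (h (T n ω) (W i ω) - h t₀ (W i ω)
        - fderiv ℝ (fun t => h t (W i ω)) t₀ (T n ω - t₀)))) := by
  have hmp : ∀ i, MeasurePreserving (W i) P Q := fun i => ⟨hW i, hlaw i⟩
  obtain ⟨r, hr, hball⟩ := Metric.mem_nhds_iff.1 (inter_mem hN hU)
  set ρ : ℝ → 𝒲 → ℝ≥0∞ := fun δ w =>
    diffModulus (fun t => h t w) (fderiv ℝ (fun t => h t w) t₀) t₀ δ with hρ
  have hρm : ∀ δ, AEMeasurable (ρ δ) Q := by
    intro δ
    refine AEMeasurable.iSup fun j => AEMeasurable.iSup fun _ => ?_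
    refine AEMeasurable.div_const ?_ _
    have h1 : AEMeasurable (fun w => fderiv ℝ (fun t => h t w) t₀
        (TopologicalSpace.denseSeq E j - t₀)) Q :=
      (hD.apply_continuousLinearMap _).aemeasurable
    exact ((((hmeas _).sub (hmeas _)).aemeasurable).sub h1).enorm
  set δ : ℕ → ℝ := fun k => r / ((k : ℝ) + 1) with hδ
  have hδ0 : Tendsto δ atTop (𝓝 0) :=
    tendsto_const_nhds.div_atTop (tendsto_atTop_add_const_right _ _ tendsto_natCast_atTop_atTop)
  have hδpos : ∀ k, 0 < δ k := fun k => by positivity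
  have hδr : ∀ k, δ k ≤ r := fun k => div_le_self hr.le (by linarith [Nat.cast_nonneg (α := ℝ) k])
  have hsub : ∀ k, Metric.ball t₀ (δ k) ⊆ N ∩ U := fun k =>
    (Metric.ball_subset_ball (hδr k)).trans hball
  -- Dominated convergence: the modulus tends to zero at almost every observation and lies below
  -- twice the integrable envelope.
  have hlim : Tendsto (fun k => ∫⁻ w, ρ (δ k) w ∂Q) atTop (𝓝 (∫⁻ _, 0 ∂Q)) := by
    refine tendsto_lintegral_of_dominated_convergence'
      (fun w => 2 * ⨆ t ∈ N, ‖fderiv ℝ (fun t' => h t' w) t‖ₑ) (fun k => hρm _) (fun k => ?_) ?_ ?_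
    · filter_upwards [hdiff] with w hw
      exact diffModulus_le (hδpos k) (fun t ht => (hsub k ht).1) fun t ht => hw t (hsub k ht).2
    · rw [lintegral_const_mul' _ _ (by norm_num)]
      exact ENNReal.mul_ne_top (by norm_num) henv.ne
    · filter_upwards [hdiff] with w hw
      exact tendsto_diffModulus (hw t₀ (mem_of_mem_nhds hU)).hasFDerivAt hδ0
  rw [lintegral_zero] at hlim
  have hgood : ∀ᵐ ω ∂P, ∀ i, ∀ t ∈ U, DifferentiableAt ℝ (fun t' => h t' (W i ω)) t :=
    ae_all_iff.2 fun i => (hmp i).quasiMeasurePreserving.ae hdiff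
  intro ε hε η hη
  obtain ⟨C, hC⟩ := hT (η / 3) (by positivity)
  set C₁ := max C 1
  have hC₁ : 0 < C₁ := by positivity
  -- The level is chosen for Markov's inequality: the sample mean of the modulus then exceeds ε/C₁
  -- with probability at most η/3.
  obtain ⟨k, hk⟩ := (hlim.eventually_le_const (u := ENNReal.ofReal (ε / C₁ * (η / 3)))
    (ENNReal.ofReal_pos.2 (by positivity))).exists
  filter_upwards [hC, hT.small_of_sqrt (δ k) (hδpos k) (η / 3) (by positivity),
    eventually_gt_atTop 0] with n h1 h2 hn
  set mρ : Ω → ℝ≥0∞ := fun ω => (n : ℝ≥0∞)⁻¹ * ∑ i ∈ Finset.range n, ρ (δ k) (W i ω) with hmρ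
  have hn0 : (n : ℝ≥0∞) ≠ 0 := by exact_mod_cast hn.ne'
  have hρW : ∀ i, AEMeasurable (fun ω => ρ (δ k) (W i ω)) P := fun i =>
    (hρm _).comp_quasiMeasurePreserving (hmp i).quasiMeasurePreserving
  have hmρm : AEMeasurable mρ P :=
    (Finset.aemeasurable_fun_sum _ fun i _ => hρW i).const_mul _
  have hmρi : ∫⁻ ω, mρ ω ∂P = ∫⁻ w, ρ (δ k) w ∂Q := by
    rw [hmρ, lintegral_const_mul'' _ (Finset.aemeasurable_fun_sum _ fun i _ => hρW i),
      lintegral_finsetSum' _ fun i _ => hρW i]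
    have : ∀ i, ∫⁻ ω, ρ (δ k) (W i ω) ∂P = ∫⁻ w, ρ (δ k) w ∂Q := fun i => by
      rw [← hlaw i, lintegral_map' (by rw [hlaw i]; exact hρm _) (hW i).aemeasurable]
    simp only [this, Finset.sum_const, Finset.card_range, nsmul_eq_mul]
    rw [← mul_assoc, ENNReal.inv_mul_cancel hn0 (by simp), one_mul]
  have h3 : P.real {ω | ENNReal.ofReal (ε / C₁) ≤ mρ ω} ≤ η / 3 := by
    have hm := mul_meas_ge_le_lintegral₀ hmρm (ENNReal.ofReal (ε / C₁))
    rw [hmρi] at hm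
    have hm2 := hm.trans hk
    rw [ENNReal.ofReal_mul (by positivity)] at hm2
    have hm3 := (ENNReal.mul_le_mul_iff_right (by simpa using by positivity)
      ENNReal.ofReal_ne_top).1 hm2
    exact ENNReal.toReal_le_of_le_ofReal (by positivity) hm3
  have hnull : P.real {ω | ¬ ∀ i, ∀ t ∈ U, DifferentiableAt ℝ (fun t' => h t' (W i ω)) t} = 0 := by
    rw [measureReal_def, ae_iff.1 hgood, ENNReal.toReal_zero]
  -- Outside these sets √n‖T - t₀‖ ≤ C₁, T lies in the ball of radius δ k, the mean modulus is below
  -- ε/C₁, and differentiability holds along the sample, so the remainder stays below ε. The first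
  -- three sets cost η/3 each and the last is null.
  refine (measureReal_mono (s₂ := (({ω | C < ‖Real.sqrt n • (T n ω - t₀)‖} ∪
    {ω | δ k ≤ ‖T n ω - t₀‖}) ∪ {ω | ENNReal.ofReal (ε / C₁) ≤ mρ ω}) ∪
    {ω | ¬ ∀ i, ∀ t ∈ U, DifferentiableAt ℝ (fun t' => h t' (W i ω)) t}) (fun ω hω => ?_)
    (measure_ne_top _ _)).trans ?_
  · by_contra hcon
    simp only [Set.mem_union, Set.mem_ofPred_eq, not_or, not_lt, not_le, not_not] at hcon hω
    obtain ⟨⟨⟨hc1, hc2⟩, hc3⟩, hc4⟩ := hcon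
    have hTb : T n ω ∈ Metric.ball t₀ (δ k) := by rwa [mem_ball_iff_norm]
    have hrem : ∀ i, ‖h (T n ω) (W i ω) - h t₀ (W i ω)
        - fderiv ℝ (fun t => h t (W i ω)) t₀ (T n ω - t₀)‖ₑ
        ≤ ρ (δ k) (W i ω) * ‖T n ω - t₀‖ₑ := fun i =>
      enorm_sub_le_diffModulus_mul (f := fun t => h t (W i ω))
        (fun t ht => (hc4 i t (hsub k ht).2).continuousAt.continuousWithinAt) hTb
    set R : ℕ → ℝ := fun i => h (T n ω) (W i ω) - h t₀ (W i ω)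
        - fderiv ℝ (fun t => h t (W i ω)) t₀ (T n ω - t₀) with hR
    have hbound : ‖Real.sqrt n * ((n : ℝ)⁻¹ * ∑ i ∈ Finset.range n, R i)‖ₑ
        ≤ mρ ω * ‖Real.sqrt n • (T n ω - t₀)‖ₑ := by
      rw [enorm_mul, enorm_mul, enorm_smul]
      have hsum : ‖∑ i ∈ Finset.range n, R i‖ₑ
          ≤ (∑ i ∈ Finset.range n, ρ (δ k) (W i ω)) * ‖T n ω - t₀‖ₑ := by
        rw [Finset.sum_mul]
        exact (enorm_sum_le _ _).trans (Finset.sum_le_sum fun i _ => hrem i)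
      have hninv : ‖(n : ℝ)⁻¹‖ₑ = (n : ℝ≥0∞)⁻¹ := by
        rw [enorm_inv (by exact_mod_cast hn.ne')]
        congr 1
        rw [← ofReal_norm]
        simp
      rw [hninv]
      calc _ ≤ ‖Real.sqrt n‖ₑ * ((n : ℝ≥0∞)⁻¹ *
            ((∑ i ∈ Finset.range n, ρ (δ k) (W i ω)) * ‖T n ω - t₀‖ₑ)) := by gcongr
        _ = _ := by rw [hmρ]; ring
    have hmtop : mρ ω ≠ ∞ := (hc3.trans ENNReal.ofReal_lt_top).ne
    have hreal : ‖Real.sqrt n * ((n : ℝ)⁻¹ * ∑ i ∈ Finset.range n, R i)‖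
        ≤ (mρ ω).toReal * ‖Real.sqrt n • (T n ω - t₀)‖ := by
      have := ENNReal.toReal_mono (ENNReal.mul_ne_top hmtop (by simp)) hbound
      simpa only [ENNReal.toReal_mul, toReal_enorm] using this
    have hm' : (mρ ω).toReal < ε / C₁ := by
      rwa [← ENNReal.lt_ofReal_iff_toReal_lt hmtop]
    have : (mρ ω).toReal * ‖Real.sqrt n • (T n ω - t₀)‖ ≤ (mρ ω).toReal * C₁ := by
      gcongr
      exact hc1.trans (le_max_left _ _)
    have h5 := (lt_div_iff₀ hC₁).1 hm'
    linarith
  · refine (measureReal_union_le _ _).trans ?_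
    rw [hnull, add_zero]
    refine (measureReal_union_le _ _).trans ?_
    refine (add_le_add (measureReal_union_le _ _) le_rfl).trans ?_
    linarith

/-- First-order expansion of a sample mean of `h` at an asymptotically linear estimator. -/
theorem smallInProb_sampleMean_estimated (hW : ∀ i, Measurable (W i)) (hind : iIndepFun W P)
    (hlaw : ∀ i, P.map (W i) = Q) {T : ℕ → Ω → E} {t₀ : E} {β : 𝒲 → E} (hβm : Measurable β)
    (hβ : MemLp β 2 Q) (hβ0 : ∫ w, β w ∂Q = 0)
    (hT : SmallInProb P (fun (n : ℕ) ω => Real.sqrt n • (T n ω - t₀)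
      - (Real.sqrt n)⁻¹ • ∑ i ∈ Finset.range n, β (W i ω)))
    {h : E → 𝒲 → ℝ} (hmeas : ∀ t, Measurable (h t)) {N U : Set E} (hN : N ∈ 𝓝 t₀) (hU : U ∈ 𝓝 t₀)
    (hdiff : ∀ᵐ w ∂Q, ∀ t ∈ U, DifferentiableAt ℝ (fun t' => h t' w) t)
    (henv : ∫⁻ w, ⨆ t ∈ N, ‖fderiv ℝ (fun t' => h t' w) t‖ₑ ∂Q < ∞) (m : ℝ) :
    SmallInProb P (fun (n : ℕ) ω =>
      Real.sqrt n * ((n : ℝ)⁻¹ * ∑ i ∈ Finset.range n, h (T n ω) (W i ω) - m)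
      - (Real.sqrt n)⁻¹ * ∑ i ∈ Finset.range n, (h t₀ (W i ω) - m
        + (∫ w, fderiv ℝ (fun t => h t w) t₀ ∂Q) (β (W i ω)))) := by
  have hint := integrable_fderiv_of_envelope hmeas
    (hdiff.mono fun w hw => hw t₀ (mem_of_mem_nhds hU)) hN henv
  set D : 𝒲 → E →L[ℝ] ℝ := fun w => fderiv ℝ (fun t => h t w) t₀ with hDdef
  set L := ∫ w, D w ∂Q with hL
  have hTb : BddInProb P (fun n ω => Real.sqrt n • (T n ω - t₀)) := by
    simpa using hT.bdd.add (bddInProb_sum hW hind hlaw hβm hβ hβ0)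
  -- The error has three parts: the Taylor remainder, the sample mean of the derivative minus its
  -- expectation L applied to √n(T - t₀), and L applied to the first-step remainder.
  have h1 := smallInProb_remainder hW hlaw hTb hmeas hN hU hdiff hint.1 henv
  borelize (E →L[ℝ] ℝ)
  have h2 : SmallInProb P (fun (n : ℕ) ω => ((n : ℝ)⁻¹ • ∑ i ∈ Finset.range n, D (W i ω) - L)
      (Real.sqrt n • (T n ω - t₀))) :=
    (smallInProb_sampleMean hW hind hlaw hint).mul_bdd hTb fun n ω =>
      ContinuousLinearMap.le_opNorm _ _
  have h3 : SmallInProb P (fun (n : ℕ) ω => L (Real.sqrt n • (T n ω - t₀)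
      - (Real.sqrt n)⁻¹ • ∑ i ∈ Finset.range n, β (W i ω))) :=
    hT.mul_bdd (bddInProb_const L) fun n ω => by
      rw [mul_comm]
      exact ContinuousLinearMap.le_opNorm _ _
  refine ((h1.add h2).add h3).of_norm_le fun n ω => le_of_eq ?_
  congr 1
  rcases Nat.eq_zero_or_pos n with rfl | hn
  · simp
  have hn' : (0 : ℝ) < n := by exact_mod_cast hn
  have hs : Real.sqrt n ≠ 0 := (Real.sqrt_pos.2 hn').ne'
  have hsq : Real.sqrt n * Real.sqrt n = n := Real.mul_self_sqrt hn'.le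
  simp only [Finset.sum_add_distrib, Finset.sum_sub_distrib, map_sub, map_smul, map_sum,
    _root_.sub_apply, _root_.smul_apply, _root_.sum_apply,
    Finset.sum_const, Finset.card_range, nsmul_eq_mul, smul_eq_mul]
  set a := ∑ i ∈ Finset.range n, h (T n ω) (W i ω)
  set b := ∑ i ∈ Finset.range n, h t₀ (W i ω)
  set c := ∑ i ∈ Finset.range n, (D (W i ω)) (T n ω)
  set e := ∑ i ∈ Finset.range n, (D (W i ω)) t₀
  set g := ∑ i ∈ Finset.range n, L (β (W i ω))
  have hcalc : ((Real.sqrt n)⁻¹ : ℝ) = Real.sqrt n * (n : ℝ)⁻¹ := by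
    rw [← div_eq_mul_inv, Real.sqrt_div_self]
  rw [hcalc]
  field_simp
  ring

end Linearisation

/-! ### Ratios of sample means and asymptotic normality -/

section Ratio

variable {E : Type*} [NormedAddCommGroup E] [NormedSpace ℝ E] [FiniteDimensional ℝ E]
  [SecondCountableTopology E] [MeasurableSpace E] [BorelSpace E]
  {Ω 𝒲 : Type*} [MeasurableSpace Ω] [MeasurableSpace 𝒲] {P : Measure Ω}
  [IsProbabilityMeasure P] {Q : Measure 𝒲} {W : ℕ → Ω → 𝒲}

omit [FiniteDimensional ℝ E] [SecondCountableTopology E] in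
theorem influence_memLp [IsProbabilityMeasure Q] {β : 𝒲 → E} (hβm : Measurable β)
    (hβ : MemLp β 2 Q) (hβ0 : ∫ w, β w ∂Q = 0) [CompleteSpace E]
    {f : 𝒲 → ℝ} (hfm : Measurable f) (hf : MemLp f 2 Q) (L : E →L[ℝ] ℝ) :
    Measurable (fun w => f w - ∫ v, f v ∂Q + L (β w)) ∧
      MemLp (fun w => f w - ∫ v, f v ∂Q + L (β w)) 2 Q ∧
      ∫ w, (f w - ∫ v, f v ∂Q + L (β w)) ∂Q = 0 := by
  have hLp : MemLp (fun w => L (β w)) 2 Q := L.comp_memLp' hβ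
  have hfi := hf.integrable (q := 2) (by norm_num)
  refine ⟨(hfm.sub_const _).add (L.continuous.measurable.comp hβm),
    (hf.sub (memLp_const _)).add hLp, ?_⟩
  have hfc : Integrable (fun w => f w - ∫ v, f v ∂Q) Q := hfi.sub (integrable_const _)
  rw [integral_add hfc (hLp.integrable (by norm_num)),
    integral_sub hfi (integrable_const _),
    L.integral_comp_comm (hβ.integrable (by norm_num)), hβ0]
  simp

/-- A family of functions of a parameter, with the regularity near `t₀` that is needed to expand
its sample means at an estimated parameter. -/
structure SmoothAt (Q : Measure 𝒲) (t₀ : E) (h : E → 𝒲 → ℝ) : Prop where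
  measurable : ∀ t, Measurable (h t)
  memLp : MemLp (h t₀) 2 Q
  diff : ∃ U ∈ 𝓝 t₀, ∀ᵐ w ∂Q, ∀ t ∈ U, DifferentiableAt ℝ (fun t' => h t' w) t
  envelope : ∃ N ∈ 𝓝 t₀, ∫⁻ w, ⨆ t ∈ N, ‖fderiv ℝ (fun t' => h t' w) t‖ₑ ∂Q < ∞

omit [FiniteDimensional ℝ E] [SecondCountableTopology E] [MeasurableSpace E] [BorelSpace E] in
theorem SmoothAt.differentiableAt {t₀ : E} {h : E → 𝒲 → ℝ} (hh : SmoothAt Q t₀ h) :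
    ∀ᵐ w ∂Q, DifferentiableAt ℝ (fun t => h t w) t₀ := by
  obtain ⟨U, hU, hd⟩ := hh.diff
  exact hd.mono fun w hw => hw t₀ (mem_of_mem_nhds hU)

omit [SecondCountableTopology E] [MeasurableSpace E] [BorelSpace E] in
theorem SmoothAt.integrable_fderiv {t₀ : E} {h : E → 𝒲 → ℝ} (hh : SmoothAt Q t₀ h) :
    Integrable (fun w => fderiv ℝ (fun t => h t w) t₀) Q := by
  obtain ⟨N, hN, he⟩ := hh.envelope
  exact integrable_fderiv_of_envelope hh.measurable hh.differentiableAt hN he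

/-- The influence function of a ratio of sample means at an estimated parameter. -/
noncomputable def ratioInfluence (Q : Measure 𝒲) (t₀ : E) (h g : E → 𝒲 → ℝ) (β : 𝒲 → E)
    (w : 𝒲) : ℝ :=
  (∫ v, g t₀ v ∂Q)⁻¹ * (h t₀ w - ∫ v, h t₀ v ∂Q
      + (∫ v, fderiv ℝ (fun t => h t v) t₀ ∂Q) (β w))
    - (∫ v, h t₀ v ∂Q) / (∫ v, g t₀ v ∂Q) * ((∫ v, g t₀ v ∂Q)⁻¹ * (g t₀ w - ∫ v, g t₀ v ∂Q
      + (∫ v, fderiv ℝ (fun t => g t v) t₀ ∂Q) (β w)))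

omit [SecondCountableTopology E] in
theorem ratioInfluence_memLp [IsProbabilityMeasure Q] {t₀ : E} {β : 𝒲 → E} (hβm : Measurable β)
    (hβ : MemLp β 2 Q) (hβ0 : ∫ w, β w ∂Q = 0) {h g : E → 𝒲 → ℝ}
    (hh : SmoothAt Q t₀ h) (hg : SmoothAt Q t₀ g) :
    Measurable (ratioInfluence Q t₀ h g β) ∧ MemLp (ratioInfluence Q t₀ h g β) 2 Q ∧
      ∫ w, ratioInfluence Q t₀ h g β w ∂Q = 0 := by
  have : CompleteSpace E := FiniteDimensional.complete ℝ E
  obtain ⟨h1, h2, h3⟩ := influence_memLp hβm hβ hβ0 (hh.measurable t₀) hh.memLp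
    (∫ v, fderiv ℝ (fun t => h t v) t₀ ∂Q)
  obtain ⟨g1, g2, g3⟩ := influence_memLp hβm hβ hβ0 (hg.measurable t₀) hg.memLp
    (∫ v, fderiv ℝ (fun t => g t v) t₀ ∂Q)
  have h2' := h2.const_mul (∫ v, g t₀ v ∂Q)⁻¹
  have g2' := (g2.const_mul (∫ v, g t₀ v ∂Q)⁻¹).const_mul ((∫ v, h t₀ v ∂Q) / (∫ v, g t₀ v ∂Q))
  refine ⟨(h1.const_mul _).sub ((g1.const_mul _).const_mul _), h2'.sub g2', ?_⟩
  unfold ratioInfluence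
  rw [integral_sub (h2'.integrable (by norm_num)) (g2'.integrable (by norm_num)),
    integral_const_mul, integral_const_mul, integral_const_mul, h3, g3]
  simp

/-- Numerator and denominator are expanded at the same estimated parameter. The delta method
combines the two expansions linearly, so the combination passes inside the sum over the sample and
becomes `ratioInfluence`. -/
theorem smallInProb_ratio_estimated (hW : ∀ i, Measurable (W i)) (hind : iIndepFun W P)
    (hlaw : ∀ i, P.map (W i) = Q) {T : ℕ → Ω → E} {t₀ : E} {β : 𝒲 → E} (hβm : Measurable β)
    (hβ : MemLp β 2 Q) (hβ0 : ∫ w, β w ∂Q = 0)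
    (hT : SmallInProb P (fun (n : ℕ) ω => Real.sqrt n • (T n ω - t₀)
      - (Real.sqrt n)⁻¹ • ∑ i ∈ Finset.range n, β (W i ω)))
    {h g : E → 𝒲 → ℝ} (hh : SmoothAt Q t₀ h) (hg : SmoothAt Q t₀ g) (hg0 : ∫ v, g t₀ v ∂Q ≠ 0) :
    SmallInProb P (fun (n : ℕ) ω =>
      Real.sqrt n * (((n : ℝ)⁻¹ * ∑ i ∈ Finset.range n, h (T n ω) (W i ω))
          / ((n : ℝ)⁻¹ * ∑ i ∈ Finset.range n, g (T n ω) (W i ω))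
          - (∫ v, h t₀ v ∂Q) / (∫ v, g t₀ v ∂Q))
      - (Real.sqrt n)⁻¹ * ∑ i ∈ Finset.range n, ratioInfluence Q t₀ h g β (W i ω)) := by
  have : IsProbabilityMeasure Q := hlaw 0 ▸ Measure.isProbabilityMeasure_map (hW 0).aemeasurable
  have : CompleteSpace E := FiniteDimensional.complete ℝ E
  obtain ⟨h1, h2, h3⟩ := influence_memLp hβm hβ hβ0 (hh.measurable t₀) hh.memLp
    (∫ v, fderiv ℝ (fun t => h t v) t₀ ∂Q)
  obtain ⟨g1, g2, g3⟩ := influence_memLp hβm hβ hβ0 (hg.measurable t₀) hg.memLp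
    (∫ v, fderiv ℝ (fun t => g t v) t₀ ∂Q)
  obtain ⟨U, hU, hUd⟩ := hh.diff
  obtain ⟨N, hN, hNe⟩ := hh.envelope
  obtain ⟨U', hU', hUd'⟩ := hg.diff
  obtain ⟨N', hN', hNe'⟩ := hg.envelope
  have kh := smallInProb_sampleMean_estimated hW hind hlaw hβm hβ hβ0 hT hh.measurable hN hU hUd
    hNe (∫ v, h t₀ v ∂Q)
  have kg := smallInProb_sampleMean_estimated hW hind hlaw hβm hβ hβ0 hT hg.measurable hN' hU' hUd'
    hNe' (∫ v, g t₀ v ∂Q)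
  have bh := bddInProb_sum_real hW hind hlaw h1 h2 h3
  have bg := bddInProb_sum_real hW hind hlaw g1 g2 g3
  set a := ∫ v, h t₀ v ∂Q
  set c := ∫ v, g t₀ v ∂Q
  set u : 𝒲 → ℝ := fun w => h t₀ w - a + (∫ v, fderiv ℝ (fun t => h t v) t₀ ∂Q) (β w)
  set v : 𝒲 → ℝ := fun w => g t₀ w - c + (∫ v, fderiv ℝ (fun t => g t v) t₀ ∂Q) (β w)
  have key := SmallInProb.ratio hg0 kh kg bh bg
  have hinf : ∀ w, ratioInfluence Q t₀ h g β w = c⁻¹ * u w - a / c * (c⁻¹ * v w) := fun w => rfl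
  have hsum : ∀ (n : ℕ) ω, (Real.sqrt n)⁻¹ * ∑ i ∈ Finset.range n,
      ratioInfluence Q t₀ h g β (W i ω)
      = c⁻¹ * ((Real.sqrt n)⁻¹ * ∑ i ∈ Finset.range n, u (W i ω))
        - a / c * (c⁻¹ * ((Real.sqrt n)⁻¹ * ∑ i ∈ Finset.range n, v (W i ω))) := fun n ω => by
    simp only [hinf, Finset.sum_sub_distrib, ← Finset.mul_sum]
    ring
  simpa only [hsum] using key

end Ratio

/-! ### Central limit theorem for asymptotically linear sequences -/

section CLT

variable {Ω 𝒲 : Type*} [MeasurableSpace Ω] [MeasurableSpace 𝒲] {P : Measure Ω}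
  [IsProbabilityMeasure P] {Q : Measure 𝒲} {W : ℕ → Ω → 𝒲}

/-- Slutsky's lemma: the normalised sum satisfies the central limit theorem, and an o_p(1)
perturbation does not change the limit law. -/
theorem tendstoInDistribution_of_asymptotically_linear (hW : ∀ i, Measurable (W i))
    (hind : iIndepFun W P) (hlaw : ∀ i, P.map (W i) = Q) {f : 𝒲 → ℝ} (hfm : Measurable f)
    (hf : MemLp f 2 Q) (hf0 : ∫ w, f w ∂Q = 0) {X : ℕ → Ω → ℝ} (hXm : ∀ n, AEMeasurable (X n) P)
    (hX : SmallInProb P (fun (n : ℕ) ω => X n ω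
      - (Real.sqrt n)⁻¹ * ∑ i ∈ Finset.range n, f (W i ω))) :
    TendstoInDistribution X atTop (id : ℝ → ℝ) (fun _ => P)
      (gaussianReal 0 (∫ w, f w ^ 2 ∂Q).toNNReal) := by
  have hmp : ∀ i, MeasurePreserving (W i) P Q := fun i => ⟨hW i, hlaw i⟩
  have hmean : ∫ ω, f (W 0 ω) ∂P = 0 := by
    rw [← hf0, ← hlaw 0, integral_map (hW 0).aemeasurable hfm.aestronglyMeasurable]
  have hvar : Var[fun ω => f (W 0 ω); P] = ∫ w, f w ^ 2 ∂Q := by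
    rw [variance_of_integral_eq_zero (X := fun ω => f (W 0 ω)) (hfm.comp (hW 0)).aemeasurable
      hmean, ← hlaw 0, integral_map (hW 0).aemeasurable]
    exact (hfm.pow_const 2).aestronglyMeasurable
  have hclt := tendstoInDistribution_inv_sqrt_mul_sum_sub (P := P)
    (P' := gaussianReal 0 (∫ w, f w ^ 2 ∂Q).toNNReal) (X := fun i ω => f (W i ω)) (Y := id)
    ⟨aemeasurable_id, by rw [Measure.map_id, hvar]⟩ (hf.comp_measurePreserving (hmp 0))
    (hind.comp (fun _ => f) fun _ => hfm)
    (fun i => ⟨(hfm.comp (hW i)).aemeasurable, (hfm.comp (hW 0)).aemeasurable, by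
      change P.map (f ∘ W i) = P.map (f ∘ W 0)
      rw [← Measure.map_map hfm (hW i), ← Measure.map_map hfm (hW 0), hlaw, hlaw]⟩)
  rw [hmean] at hclt
  simp only [mul_zero, sub_zero] at hclt
  exact tendstoInDistribution_of_tendstoInMeasure_sub X id hclt
    (tendstoInMeasure_zero_iff_smallInProb.2 hX) hXm

end CLT

/-! ### The robust estimator as a combination of ratios -/

namespace MissingDID

variable {k nb nc nm nd : ℕ}

theorem measurable_ind_comp {α : Type*} [MeasurableSpace α] {f : α → Bool} (hf : Measurable f) :
    Measurable (fun a => ind (f a)) :=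
  (Measurable.of_discrete (f := ind)).comp hf

theorem measurable_decide_eq {α β : Type*} [MeasurableSpace α] [MeasurableSpace β]
    [DiscreteMeasurableSpace β] [DecidableEq β] {f : α → β} (hf : Measurable f) (c : β) :
    Measurable (fun a => decide (f a = c)) :=
  (Measurable.of_discrete (f := fun b : β => decide (b = c))).comp hf

theorem Obs.measurable_dY : Measurable (Obs.dY (k := k)) := by unfold Obs.dY; fun_prop
theorem Obs.measurable_s : Measurable (Obs.s (k := k)) := by unfold Obs.s; fun_prop
theorem Obs.measurable_path : Measurable (Obs.path (k := k)) := by unfold Obs.path; fun_prop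
theorem Obs.measurable_d2 : Measurable (Obs.d2 (k := k)) := by unfold Obs.d2; fun_prop
theorem Obs.measurable_x : Measurable (Obs.x (k := k)) := by unfold Obs.x; fun_prop

namespace Params

theorem continuous_be (c : Path) : Continuous fun θ : Params nb nc nm nd => θ.be c := by
  unfold be; fun_prop
theorem continuous_gc (c : Path) : Continuous fun θ : Params nb nc nm nd => θ.gc c := by
  unfold gc; fun_prop
theorem continuous_gm (e : Bool) : Continuous fun θ : Params nb nc nm nd => θ.gm e := by
  unfold gm; fun_prop
theorem continuous_de (e : Bool) : Continuous fun θ : Params nb nc nm nd => θ.de e := by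
  unfold de; fun_prop

theorem differentiable_be (c : Path) : Differentiable ℝ fun θ : Params nb nc nm nd => θ.be c := by
  unfold be; fun_prop
theorem differentiable_gc (c : Path) : Differentiable ℝ fun θ : Params nb nc nm nd => θ.gc c := by
  unfold gc; fun_prop
theorem differentiable_gm (e : Bool) : Differentiable ℝ fun θ : Params nb nc nm nd => θ.gm e := by
  unfold gm; fun_prop
theorem differentiable_de (e : Bool) : Differentiable ℝ fun θ : Params nb nc nm nd => θ.de e := by
  unfold de; fun_prop

/-- Replace the parameters of the working models that do not enter the estimator for the path `d`
by those of `θ₀`. -/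
def restrict (d : Path) (θ₀ θ : Params nb nc nm nd) : Params nb nc nm nd :=
  (fun c => if c = d ∨ c = baseline then θ.be c else θ₀.be c,
    fun c => if c = d ∨ c = baseline then θ.gc c else θ₀.gc c,
    fun e => if e = d.2 ∨ e = baseline.2 then θ.gm e else θ₀.gm e,
    fun e => if e = d.2 ∨ e = baseline.2 then θ.de e else θ₀.de e)

variable {d : Path} {θ₀ θ : Params nb nc nm nd}

@[simp] theorem restrict_be : (restrict d θ₀ θ).be d = θ.be d := by simp [restrict, be]
@[simp] theorem restrict_be0 : (restrict d θ₀ θ).be baseline = θ.be baseline := by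
  simp [restrict, be]
@[simp] theorem restrict_gc : (restrict d θ₀ θ).gc d = θ.gc d := by simp [restrict, gc]
@[simp] theorem restrict_gc0 : (restrict d θ₀ θ).gc baseline = θ.gc baseline := by
  simp [restrict, gc]
@[simp] theorem restrict_gm : (restrict d θ₀ θ).gm d.2 = θ.gm d.2 := by simp [restrict, gm]
@[simp] theorem restrict_gm0 : (restrict d θ₀ θ).gm false = θ.gm false := by
  simp [restrict, gm]
@[simp] theorem restrict_de : (restrict d θ₀ θ).de d.2 = θ.de d.2 := by simp [restrict, de]
@[simp] theorem restrict_de0 : (restrict d θ₀ θ).de false = θ.de false := by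
  simp [restrict, de]

end Params

theorem num_restrict (M : Models k nb nc nm nd) (d : Path) (j : Fin 4)
    (θ₀ θ : Params nb nc nm nd) (w : Obs k) :
    num M d j (Params.restrict d θ₀ θ) w = num M d j θ w := by
  simp [num]

theorem resid_restrict (M : Models k nb nc nm nd) (d : Path) (j : Fin 4)
    (θ₀ θ : Params nb nc nm nd) (w : Obs k) :
    resid M d j (Params.restrict d θ₀ θ) w = resid M d j θ w := by
  simp [resid]

/-- The signs with which the four weighted means enter the robust estimand. -/
noncomputable def sgn : Fin 4 → ℝ := ![1, -1, 1, -1]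

/-- The averaging operation is an arbitrary functional, so the linearity needed is a hypothesis.
Sample means always satisfy it; expectations do so under integrability of the weighted residuals. -/
theorem robust_eq_sum (M : Models k nb nc nm nd) (d : Path) (E : (Obs k → ℝ) → ℝ)
    (θ : Params nb nc nm nd)
    (hsub : ∀ j l : Fin 4, E (fun w => wt M d E j θ w * resid M d j θ w
      - wt M d E l θ w * resid M d l θ w)
      = E (fun w => num M d j θ w * resid M d j θ w) / E (num M d j θ)
        - E (fun w => num M d l θ w * resid M d l θ w) / E (num M d l θ)) :
    robust M d E θ = ∑ j, sgn j
      * (E (fun w => num M d j θ w * resid M d j θ w) / E (num M d j θ)) := by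
  have h1 := hsub 0 1
  have h2 := hsub 2 3
  simp only [resid, Matrix.cons_val] at h1 h2
  rw [robust]
  simp only [Fin.sum_univ_four, sgn, resid, Matrix.cons_val, sub_mul] at h1 h2 ⊢
  rw [h1, h2]
  ring

theorem estimator_eq_sum {Ω : Type*} (M : Models k nb nc nm nd) (d : Path) (W : ℕ → Ω → Obs k)
    (est : ℕ → Ω → Params nb nc nm nd) (n : ℕ) (ω : Ω) :
    estimator M d W est n ω = ∑ j, sgn j
      * (((n : ℝ)⁻¹ * ∑ i ∈ Finset.range n,
            num M d j (est n ω) (W i ω) * resid M d j (est n ω) (W i ω))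
          / ((n : ℝ)⁻¹ * ∑ i ∈ Finset.range n, num M d j (est n ω) (W i ω))) := by
  rw [estimator, robust_eq_sum]
  · rfl
  · intro j l
    simp only [wt, sampleMean, Finset.sum_sub_distrib, mul_sub, mul_div_assoc, Finset.sum_div,
      div_mul_eq_mul_div]

theorem estimand_eq_sum (M : Models k nb nc nm nd) (d : Path) (Q : Measure (Obs k))
    (θ : Params nb nc nm nd)
    (hint : ∀ j, Integrable (fun w => num M d j θ w * resid M d j θ w) Q) :
    estimand M d Q θ = ∑ j, sgn j
      * ((∫ w, num M d j θ w * resid M d j θ w ∂Q) / ∫ w, num M d j θ w ∂Q) := by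
  rw [estimand, robust_eq_sum]
  · rfl
  · intro j l
    simp only [wt, popMean, div_mul_eq_mul_div]
    rw [integral_sub ((hint j).div_const _) ((hint l).div_const _), integral_div, integral_div]

/-! ### Regularity of the weights in the parameter -/

/-- Pointwise consequences of the regularity of the working models at a covariate value. -/
structure PointRegular (M : Models k nb nc nm nd) (d : Path) (KB : Path → Set (Vec nb))
    (KC : Path → Set (Vec nc)) (KM : Bool → Set (Vec nm)) (KD : Bool → Set (Vec nd))
    (x : Vec k) : Prop where
  mu : ∀ c ∈ ({d, baseline} : Set Path), ∀ a ∈ interior (KB c), DifferentiableAt ℝ (M.mu c x) a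
  piC : ∀ c ∈ ({d, baseline} : Set Path), ∀ a ∈ interior (KC c), DifferentiableAt ℝ (M.piC c x) a
  piM : ∀ e ∈ ({d.2, baseline.2} : Set Bool), ∀ a ∈ interior (KM e),
    DifferentiableAt ℝ (M.piM e x) a
  phi : ∀ e ∈ ({d.2, baseline.2} : Set Bool), ∀ a ∈ interior (KD e),
    DifferentiableAt ℝ (M.phi e x) a
  phi_pos : ∀ e ∈ ({d.2, baseline.2} : Set Bool), ∀ a ∈ interior (KD e), 0 < M.phi e x a
  piC_pos : ∀ a ∈ interior (KC baseline), 0 < M.piC baseline x a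
  piM_pos : ∀ a ∈ interior (KM baseline.2), 0 < M.piM baseline.2 x a

theorem RegularModel.differentiableAt {r : ℕ} {PX : Measure (Vec k)} {f : Vec k → Vec r → ℝ}
    {K : Set (Vec r)} {θs : Vec r} (h : RegularModel PX f K θs) :
    ∀ᵐ x ∂PX, ∀ a ∈ interior K, DifferentiableAt ℝ (f x) a := by
  filter_upwards [h.contDiffOn] with x hx a ha
  exact (hx.differentiableOn (by norm_num)).differentiableAt (isOpen_interior.mem_nhds ha)

variable {M : Models k nb nc nm nd} {d : Path} {Q : Measure (Obs k)} {PX : Measure (Vec k)}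
  {KB : Path → Set (Vec nb)} {KC : Path → Set (Vec nc)} {KM : Bool → Set (Vec nm)}
  {KD : Bool → Set (Vec nd)} {θs : Params nb nc nm nd}

theorem Regularity.ae_pointRegular (hreg : Regularity M d Q PX KB KC KM KD θs) :
    ∀ᵐ x ∂PX, PointRegular M d KB KC KM KD x := by
  have h2 : ∀ {α : Type} {p : α → Vec k → Prop} {a b : α},
      (∀ c ∈ ({a, b} : Set α), ∀ᵐ x ∂PX, p c x) → ∀ᵐ x ∂PX, ∀ c ∈ ({a, b} : Set α), p c x := by
    intro α p a b h
    filter_upwards [h a (by simp), h b (by simp)] with x ha hb c hc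
    rcases hc with rfl | rfl
    exacts [ha, hb]
  filter_upwards [h2 fun c hc => (hreg.mu c hc).differentiableAt,
    h2 fun c hc => (hreg.piC c hc).differentiableAt,
    h2 fun c hc => (hreg.piM c hc).differentiableAt,
    h2 fun c hc => (hreg.phi c hc).differentiableAt, h2 hreg.phi_pos, hreg.piC_pos, hreg.piM_pos]
    with x h1 h2 h3 h4 h5 h6 h7
  exact ⟨h1, h2, h3, h4, fun e he a ha => h5 e he a (interior_subset ha),
    fun a ha => h6 a (interior_subset ha), fun a ha => h7 a (interior_subset ha)⟩

/-- Parameters whose components entering the estimator for the path `d` are interior. -/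
def interiorParams (d : Path) (KB : Path → Set (Vec nb)) (KC : Path → Set (Vec nc))
    (KM : Bool → Set (Vec nm)) (KD : Bool → Set (Vec nd)) : Set (Params nb nc nm nd) :=
  {θ | (∀ c ∈ ({d, baseline} : Set Path), θ.be c ∈ interior (KB c)) ∧
    (∀ c ∈ ({d, baseline} : Set Path), θ.gc c ∈ interior (KC c)) ∧
    (∀ e ∈ ({d.2, baseline.2} : Set Bool), θ.gm e ∈ interior (KM e)) ∧
    (∀ e ∈ ({d.2, baseline.2} : Set Bool), θ.de e ∈ interior (KD e))}

theorem Regularity.interiorParams_mem_nhds (hreg : Regularity M d Q PX KB KC KM KD θs) :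
    interiorParams d KB KC KM KD ∈ 𝓝 θs := by
  have hfin : ∀ {α : Type} [Finite α] {p : α → Params nb nc nm nd → Prop} {s : Set α},
      (∀ c ∈ s, ∀ᶠ θ in 𝓝 θs, p c θ) → ∀ᶠ θ in 𝓝 θs, ∀ c ∈ s, p c θ := by
    intro α _ p s h
    exact eventually_all.2 fun c => eventually_imp_distrib_left.2 (h c)
  refine (hfin fun c hc => ?_).and ((hfin fun c hc => ?_).and
    ((hfin fun e he => ?_).and (hfin fun e he => ?_)))
  · exact (Params.continuous_be c).continuousAt.eventually
      (isOpen_interior.mem_nhds (hreg.mu c hc).mem_interior)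
  · exact (Params.continuous_gc c).continuousAt.eventually
      (isOpen_interior.mem_nhds (hreg.piC c hc).mem_interior)
  · exact (Params.continuous_gm e).continuousAt.eventually
      (isOpen_interior.mem_nhds (hreg.piM e he).mem_interior)
  · exact (Params.continuous_de e).continuousAt.eventually
      (isOpen_interior.mem_nhds (hreg.phi e he).mem_interior)

/-- `num2` as a function of the tuple of its parameters. -/
noncomputable def num2Tuple (M : Models k nb nc nm nd) (d : Path) (w : Obs k)
    (p : Vec nc × Vec nm × Vec nc × Vec nm × Vec nd) : ℝ :=
  num2 M d p.1 p.2.1 p.2.2.1 p.2.2.2.1 p.2.2.2.2 w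

theorem differentiableAt_real_div {E : Type*} [NormedAddCommGroup E] [NormedSpace ℝ E]
    {f g : E → ℝ} {x : E} (hf : DifferentiableAt ℝ f x) (hg : DifferentiableAt ℝ g x)
    (h0 : g x ≠ 0) : DifferentiableAt ℝ (fun y => f y / g y) x := by
  simp only [div_eq_mul_inv]
  exact hf.mul (DifferentiableAt.comp (g := fun y : ℝ => y⁻¹) x (differentiableAt_inv h0) hg)

/-! ### Differentiability of weights and residuals at a fixed observation -/

section Pointwise

variable {w : Obs k} {θ : Params nb nc nm nd} (hw : PointRegular M d KB KC KM KD w.x)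
  (hθ : θ ∈ interiorParams d KB KC KM KD)

include hw hθ

theorem differentiableAt_num1 : DifferentiableAt ℝ (fun a => num1 M d a w) (θ.de d.2) := by
  obtain ⟨-, -, -, h4⟩ := hθ
  have hφ := hw.phi d.2 (by simp) _ (h4 d.2 (by simp))
  have hφ0 := (hw.phi_pos d.2 (by simp) _ (h4 d.2 (by simp))).ne'
  unfold num1
  exact (differentiableAt_real_div (differentiableAt_const _) hφ hφ0).mul_const _

theorem differentiableAt_num2Tuple : DifferentiableAt ℝ (num2Tuple M d w)
    (θ.gc d, θ.gm d.2, θ.gc baseline, θ.gm baseline.2, θ.de baseline.2) := by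
  obtain ⟨-, h2, h3, h4⟩ := hθ
  have hφ := hw.phi baseline.2 (by simp) _ (h4 baseline.2 (by simp))
  have hφ0 := (hw.phi_pos baseline.2 (by simp) _ (h4 baseline.2 (by simp))).ne'
  have hc := hw.piC d (by simp) _ (h2 d (by simp))
  have hc0 := hw.piC baseline (by simp) _ (h2 baseline (by simp))
  have hm := hw.piM d.2 (by simp) _ (h3 d.2 (by simp))
  have hm0 := hw.piM baseline.2 (by simp) _ (h3 baseline.2 (by simp))
  have hc0' := (hw.piC_pos _ (h2 baseline (by simp))).ne'
  have hm0' := (hw.piM_pos _ (h3 baseline.2 (by simp))).ne'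
  set p := (θ.gc d, θ.gm d.2, θ.gc baseline, θ.gm baseline.2, θ.de baseline.2)
  have e1 : DifferentiableAt ℝ (fun q : Vec nc × Vec nm × Vec nc × Vec nm × Vec nd =>
      M.piC d w.x q.1) p := DifferentiableAt.comp (f := fun q => q.1) p hc (by fun_prop)
  have e2 : DifferentiableAt ℝ (fun q : Vec nc × Vec nm × Vec nc × Vec nm × Vec nd =>
      M.piM d.2 w.x q.2.1) p := DifferentiableAt.comp (f := fun q => q.2.1) p hm (by fun_prop)
  have e3 : DifferentiableAt ℝ (fun q : Vec nc × Vec nm × Vec nc × Vec nm × Vec nd =>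
      M.piC baseline w.x q.2.2.1) p :=
    DifferentiableAt.comp (f := fun q => q.2.2.1) p hc0 (by fun_prop)
  have e4 : DifferentiableAt ℝ (fun q : Vec nc × Vec nm × Vec nc × Vec nm × Vec nd =>
      M.piM baseline.2 w.x q.2.2.2.1) p :=
    DifferentiableAt.comp (f := fun q => q.2.2.2.1) p hm0 (by fun_prop)
  have e5 : DifferentiableAt ℝ (fun q : Vec nc × Vec nm × Vec nc × Vec nm × Vec nd =>
      M.phi baseline.2 w.x q.2.2.2.2) p :=
    DifferentiableAt.comp (f := fun q => q.2.2.2.2) p hφ (by fun_prop)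
  unfold num2Tuple num2
  exact ((differentiableAt_real_div (differentiableAt_const _) e5 hφ0).mul
    (differentiableAt_real_div (e1.mul e2) (e3.mul e4) (mul_ne_zero hc0' hm0'))).mul_const _

theorem differentiableAt_num3 : DifferentiableAt ℝ (fun a => num3 M d a w) (θ.gc d) := by
  obtain ⟨-, h2, -, -⟩ := hθ
  unfold num3
  exact (hw.piC d (by simp) _ (h2 d (by simp))).mul_const _

theorem differentiableAt_num4 :
    DifferentiableAt ℝ (fun p : Vec nc × Vec nd => num4 M d p.1 p.2 w) (θ.gc d, θ.de d.2) := by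
  obtain ⟨-, h2, -, h4⟩ := hθ
  have hφ := hw.phi d.2 (by simp) _ (h4 d.2 (by simp))
  have hφ0 := (hw.phi_pos d.2 (by simp) _ (h4 d.2 (by simp))).ne'
  have hc := hw.piC d (by simp) _ (h2 d (by simp))
  have e1 : DifferentiableAt ℝ (fun q : Vec nc × Vec nd => M.piC d w.x q.1) (θ.gc d, θ.de d.2) :=
    DifferentiableAt.comp (f := fun q : Vec nc × Vec nd => q.1) _ hc (by fun_prop)
  have e2 : DifferentiableAt ℝ (fun q : Vec nc × Vec nd => M.phi d.2 w.x q.2)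
      (θ.gc d, θ.de d.2) :=
    DifferentiableAt.comp (f := fun q : Vec nc × Vec nd => q.2) _ hφ (by fun_prop)
  unfold num4
  exact ((differentiableAt_real_div (differentiableAt_const _) e2 hφ0).mul e1).mul_const _

theorem differentiableAt_mu : DifferentiableAt ℝ (M.mu d w.x) (θ.be d) :=
  hw.mu d (by simp) _ (hθ.1 d (by simp))

theorem differentiableAt_mu0 : DifferentiableAt ℝ (M.mu baseline w.x) (θ.be baseline) :=
  hw.mu baseline (by simp) _ (hθ.1 baseline (by simp))

theorem differentiableAt_num (j : Fin 4) :
    DifferentiableAt ℝ (fun θ' => num M d j θ' w) θ := by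
  have d2 := Params.differentiable_gc (nb := nb) (nc := nc) (nm := nm) (nd := nd) d
  have d3 := Params.differentiable_gc (nb := nb) (nc := nc) (nm := nm) (nd := nd) baseline
  have d4 := Params.differentiable_gm (nb := nb) (nc := nc) (nm := nm) (nd := nd) d.2
  have d5 := Params.differentiable_gm (nb := nb) (nc := nc) (nm := nm) (nd := nd) baseline.2
  have d6 := Params.differentiable_de (nb := nb) (nc := nc) (nm := nm) (nd := nd) d.2
  have d7 := Params.differentiable_de (nb := nb) (nc := nc) (nm := nm) (nd := nd) baseline.2
  fin_cases j
  · exact DifferentiableAt.comp (g := fun a => num1 M d a w)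
      (f := fun θ' : Params nb nc nm nd => θ'.de d.2) θ (differentiableAt_num1 hw hθ) d6.differentiableAt
  · exact DifferentiableAt.comp (g := num2Tuple M d w) (f := fun θ' : Params nb nc nm nd =>
      (θ'.gc d, θ'.gm d.2, θ'.gc baseline, θ'.gm baseline.2, θ'.de baseline.2)) θ
      (differentiableAt_num2Tuple hw hθ) (by fun_prop)
  · exact DifferentiableAt.comp (g := fun a => num3 M d a w)
      (f := fun θ' : Params nb nc nm nd => θ'.gc d) θ (differentiableAt_num3 hw hθ) d2.differentiableAt
  · exact DifferentiableAt.comp (g := fun p : Vec nc × Vec nd => num4 M d p.1 p.2 w)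
      (f := fun θ' : Params nb nc nm nd => (θ'.gc d, θ'.de d.2)) θ
      (differentiableAt_num4 hw hθ) (by fun_prop)

theorem differentiableAt_mu_comp :
    DifferentiableAt ℝ (fun θ' : Params nb nc nm nd => M.mu d w.x (θ'.be d)) θ :=
  DifferentiableAt.comp θ (differentiableAt_mu hw hθ) (Params.differentiable_be d).differentiableAt

theorem differentiableAt_mu0_comp :
    DifferentiableAt ℝ (fun θ' : Params nb nc nm nd => M.mu baseline w.x (θ'.be baseline)) θ :=
  DifferentiableAt.comp θ (differentiableAt_mu0 hw hθ)
    (Params.differentiable_be baseline).differentiableAt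

theorem differentiableAt_resid (j : Fin 4) :
    DifferentiableAt ℝ (fun θ' => resid M d j θ' w) θ := by
  have h1 := differentiableAt_mu_comp hw hθ
  have h0 := differentiableAt_mu0_comp hw hθ
  fin_cases j
  · exact (differentiableAt_const _).sub h0
  · exact (differentiableAt_const _).sub h0
  · exact h1.sub h0
  · exact h1.sub h0

end Pointwise

/-- Measurability is needed jointly in parameter and observation because the estimator evaluates the
weights at a random parameter. -/
theorem Regularity.measurable_num (hreg : Regularity M d Q PX KB KC KM KD θs) (j : Fin 4) :
    Measurable (fun z : Params nb nc nm nd × Obs k => num M d j z.1 z.2) := by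
  have mx : Measurable (fun z : Params nb nc nm nd × Obs k => z.2.x) :=
    Obs.measurable_x.comp measurable_snd
  have ms : Measurable (fun z : Params nb nc nm nd × Obs k => ind z.2.s) :=
    measurable_ind_comp (Obs.measurable_s.comp measurable_snd)
  have mp : ∀ c, Measurable (fun z : Params nb nc nm nd × Obs k =>
      ind (decide (z.2.path = c))) := fun c =>
    measurable_ind_comp (measurable_decide_eq (Obs.measurable_path.comp measurable_snd) c)
  have md : ∀ e, Measurable (fun z : Params nb nc nm nd × Obs k =>
      ind (decide (z.2.d2 = e))) := fun e =>
    measurable_ind_comp (measurable_decide_eq (Obs.measurable_d2.comp measurable_snd) e)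
  have mC : ∀ c ∈ ({d, baseline} : Set Path), Measurable (fun z : Params nb nc nm nd × Obs k =>
      M.piC c z.2.x (z.1.gc c)) := fun c hc => (hreg.piC c hc).measurable.comp
    (mx.prodMk ((Params.continuous_gc c).measurable.comp measurable_fst))
  have mM : ∀ e ∈ ({d.2, baseline.2} : Set Bool), Measurable
      (fun z : Params nb nc nm nd × Obs k => M.piM e z.2.x (z.1.gm e)) := fun e he =>
    (hreg.piM e he).measurable.comp
      (mx.prodMk ((Params.continuous_gm e).measurable.comp measurable_fst))
  have mP : ∀ e ∈ ({d.2, baseline.2} : Set Bool), Measurable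
      (fun z : Params nb nc nm nd × Obs k => M.phi e z.2.x (z.1.de e)) := fun e he =>
    (hreg.phi e he).measurable.comp
      (mx.prodMk ((Params.continuous_de e).measurable.comp measurable_fst))
  fin_cases j
  · exact (ms.div (mP d.2 (by simp))).mul (mp d)
  · exact ((ms.div (mP baseline.2 (by simp))).mul (((mC d (by simp)).mul (mM d.2 (by simp))).div
      ((mC baseline (by simp)).mul (mM baseline.2 (by simp))))).mul (mp baseline)
  · exact (mC d (by simp)).mul (md d.2)
  · exact ((ms.div (mP d.2 (by simp))).mul (mC d (by simp))).mul (md d.2)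

theorem Regularity.measurable_resid (hreg : Regularity M d Q PX KB KC KM KD θs) (j : Fin 4) :
    Measurable (fun z : Params nb nc nm nd × Obs k => resid M d j z.1 z.2) := by
  have mx : Measurable (fun z : Params nb nc nm nd × Obs k => z.2.x) :=
    Obs.measurable_x.comp measurable_snd
  have mY : Measurable (fun z : Params nb nc nm nd × Obs k => z.2.dY) :=
    Obs.measurable_dY.comp measurable_snd
  have mB : ∀ c ∈ ({d, baseline} : Set Path), Measurable (fun z : Params nb nc nm nd × Obs k =>
      M.mu c z.2.x (z.1.be c)) := fun c hc => (hreg.mu c hc).measurable.comp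
    (mx.prodMk ((Params.continuous_be c).measurable.comp measurable_fst))
  fin_cases j
  · exact mY.sub (mB baseline (by simp))
  · exact mY.sub (mB baseline (by simp))
  · exact (mB d (by simp)).sub (mB baseline (by simp))
  · exact (mB d (by simp)).sub (mB baseline (by simp))

theorem Regularity.ae_obs (hreg : Regularity M d Q PX KB KC KM KD θs) (hPX : Q.map Obs.x = PX) :
    ∀ᵐ w ∂Q, PointRegular M d KB KC KM KD w.x := by
  have h := hreg.ae_pointRegular
  rw [← hPX] at h
  exact ae_of_ae_map Obs.measurable_x.aemeasurable h

theorem Regularity.smoothAt_num (hreg : Regularity M d Q PX KB KC KM KD θs)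
    (hPX : Q.map Obs.x = PX) (j : Fin 4) : SmoothAt Q θs (num M d j) where
  measurable t := (hreg.measurable_num j).comp (measurable_const.prodMk measurable_id)
  memLp := hreg.memLp_num j
  diff := ⟨_, hreg.interiorParams_mem_nhds, by
    filter_upwards [hreg.ae_obs hPX] with w hw t ht using differentiableAt_num hw ht j⟩
  envelope := hreg.deriv_num j

theorem Regularity.smoothAt_num_mul_resid (hreg : Regularity M d Q PX KB KC KM KD θs)
    (hPX : Q.map Obs.x = PX) (j : Fin 4) :
    SmoothAt Q θs (fun θ w => num M d j θ w * resid M d j θ w) where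
  measurable t := ((hreg.measurable_num j).mul (hreg.measurable_resid j)).comp
    (measurable_const.prodMk measurable_id)
  memLp := hreg.memLp_num_resid j
  diff := ⟨_, hreg.interiorParams_mem_nhds, by
    filter_upwards [hreg.ae_obs hPX] with w hw t ht using
      (differentiableAt_num hw ht j).mul (differentiableAt_resid hw ht j)⟩
  envelope := hreg.deriv_num_resid j

theorem Regularity.measurable_estimator (hreg : Regularity M d Q PX KB KC KM KD θs)
    {Ω : Type*} [MeasurableSpace Ω] {W : ℕ → Ω → Obs k} (hW : ∀ i, Measurable (W i))
    {T : ℕ → Ω → Params nb nc nm nd} (hT : ∀ n, Measurable (T n)) (n : ℕ) :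
    Measurable (estimator M d W T n) := by
  have : estimator M d W T n = fun ω => _ := funext fun ω => estimator_eq_sum M d W T n ω
  rw [this]
  have hn : ∀ j i, Measurable fun ω => num M d j (T n ω) (W i ω) := fun j i =>
    (hreg.measurable_num j).comp ((hT n).prodMk (hW i))
  have hr : ∀ j i, Measurable fun ω => resid M d j (T n ω) (W i ω) := fun j i =>
    (hreg.measurable_resid j).comp ((hT n).prodMk (hW i))
  refine Finset.measurable_fun_sum _ fun j _ => Measurable.const_mul (Measurable.div ?_ ?_) _
  · exact (Finset.measurable_fun_sum _ fun i _ => (hn j i).mul (hr j i)).const_mul _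
  · exact (Finset.measurable_fun_sum _ fun i _ => hn j i).const_mul _

end MissingDID

/-! ### The influence function -/

namespace MissingDID

theorem inner_gradient {F : Type*} [NormedAddCommGroup F] [InnerProductSpace ℝ F] [CompleteSpace F]
    (f : F → ℝ) (a v : F) : ⟪v, gradient f a⟫_ℝ = fderiv ℝ f a v := by
  rw [real_inner_comm, gradient, InnerProductSpace.toDual_symm_apply]

/-- This splits a total derivative into partial ones, the step that turns derivatives in θ into the
separate gradients of the influence function. -/
theorem fderiv_prod_apply {A B : Type*} [NormedAddCommGroup A] [NormedSpace ℝ A]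
    [NormedAddCommGroup B] [NormedSpace ℝ B] {G : A × B → ℝ} {a : A} {b : B}
    (hG : DifferentiableAt ℝ G (a, b)) (u : A) (v : B) :
    fderiv ℝ G (a, b) (u, v)
      = fderiv ℝ (fun x => G (x, b)) a u + fderiv ℝ (fun y => G (a, y)) b v := by
  have h1 : HasFDerivAt (fun x => G (x, b))
      ((fderiv ℝ G (a, b)).comp (ContinuousLinearMap.inl ℝ A B)) a :=
    HasFDerivAt.comp a hG.hasFDerivAt (hasFDerivAt_prodMk_left a b)
  have h2 : HasFDerivAt (fun y => G (a, y))
      ((fderiv ℝ G (a, b)).comp (ContinuousLinearMap.inr ℝ A B)) b :=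
    HasFDerivAt.comp b hG.hasFDerivAt (hasFDerivAt_prodMk_right a b)
  rw [h1.fderiv, h2.fderiv]
  simp [← map_add]

theorem differentiableAt_prod_right {A B : Type*} [NormedAddCommGroup A] [NormedSpace ℝ A]
    [NormedAddCommGroup B] [NormedSpace ℝ B] {G : A × B → ℝ} {a : A} {b : B}
    (hG : DifferentiableAt ℝ G (a, b)) : DifferentiableAt ℝ (fun y => G (a, y)) b :=
  (HasFDerivAt.comp b hG.hasFDerivAt (hasFDerivAt_prodMk_right a b)).differentiableAt

/-- The envelope hypotheses give integrability of derivatives along directions, that is, of scalar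
pairings with the gradients. An orthonormal basis recovers the gradients themselves. -/
theorem integrable_of_inner {α : Type*} [MeasurableSpace α] {μ : Measure α} {r : ℕ}
    {f : α → Vec r} (h : ∀ u, Integrable (fun a => ⟪u, f a⟫_ℝ) μ) : Integrable f μ := by
  have : f = fun a => ∑ i, ⟪EuclideanSpace.basisFun (Fin r) ℝ i, f a⟫_ℝ •
      EuclideanSpace.basisFun (Fin r) ℝ i := by
    funext a
    exact ((EuclideanSpace.basisFun (Fin r) ℝ).sum_repr' (f a)).symm
  rw [this]
  exact integrable_finsetSum _ fun i _ => (h _).smul_const _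

theorem integral_sub_add_sub {α : Type*} [MeasurableSpace α] {μ : Measure α} {f₀ f₁ f₂ f₃ : α → ℝ}
    (h₀ : Integrable f₀ μ) (h₁ : Integrable f₁ μ) (h₂ : Integrable f₂ μ) (h₃ : Integrable f₃ μ) :
    ∫ a, (f₀ a - f₁ a + f₂ a - f₃ a) ∂μ
      = ∫ a, f₀ a ∂μ - ∫ a, f₁ a ∂μ + ∫ a, f₂ a ∂μ - ∫ a, f₃ a ∂μ := by
  rw [integral_sub (f := fun a => f₀ a - f₁ a + f₂ a) ((h₀.sub h₁).add h₂) h₃,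
    integral_add (f := fun a => f₀ a - f₁ a) (h₀.sub h₁) h₂, integral_sub h₀ h₁]

/-- `β_c` as a continuous linear map. -/
noncomputable def Params.beL {nb nc nm nd : ℕ} (c : Path) : Params nb nc nm nd →L[ℝ] Vec nb :=
  (ContinuousLinearMap.proj c).comp (ContinuousLinearMap.fst ℝ _ _)
/-- `γ_{c₁|c₂}` as a continuous linear map. -/
noncomputable def Params.gcL {nb nc nm nd : ℕ} (c : Path) : Params nb nc nm nd →L[ℝ] Vec nc :=
  (ContinuousLinearMap.proj c).comp ((ContinuousLinearMap.fst ℝ _ _).comp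
    (ContinuousLinearMap.snd ℝ _ _))
/-- `γ_e` as a continuous linear map. -/
noncomputable def Params.gmL {nb nc nm nd : ℕ} (e : Bool) : Params nb nc nm nd →L[ℝ] Vec nm :=
  (ContinuousLinearMap.proj e).comp ((ContinuousLinearMap.fst ℝ _ _).comp
    ((ContinuousLinearMap.snd ℝ _ _).comp (ContinuousLinearMap.snd ℝ _ _)))
/-- `δ_e` as a continuous linear map. -/
noncomputable def Params.deL {nb nc nm nd : ℕ} (e : Bool) : Params nb nc nm nd →L[ℝ] Vec nd :=
  (ContinuousLinearMap.proj e).comp ((ContinuousLinearMap.snd ℝ _ _).comp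
    ((ContinuousLinearMap.snd ℝ _ _).comp (ContinuousLinearMap.snd ℝ _ _)))

theorem Params.hasFDerivAt_be {nb nc nm nd : ℕ} (c : Path) (θ : Params nb nc nm nd) :
    HasFDerivAt (fun θ' : Params nb nc nm nd => θ'.be c) (Params.beL c) θ :=
  (Params.beL c).hasFDerivAt
theorem Params.hasFDerivAt_gc {nb nc nm nd : ℕ} (c : Path) (θ : Params nb nc nm nd) :
    HasFDerivAt (fun θ' : Params nb nc nm nd => θ'.gc c) (Params.gcL c) θ :=
  (Params.gcL c).hasFDerivAt
theorem Params.hasFDerivAt_gm {nb nc nm nd : ℕ} (e : Bool) (θ : Params nb nc nm nd) :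
    HasFDerivAt (fun θ' : Params nb nc nm nd => θ'.gm e) (Params.gmL e) θ :=
  (Params.gmL e).hasFDerivAt
theorem Params.hasFDerivAt_de {nb nc nm nd : ℕ} (e : Bool) (θ : Params nb nc nm nd) :
    HasFDerivAt (fun θ' : Params nb nc nm nd => θ'.de e) (Params.deL e) θ :=
  (Params.deL e).hasFDerivAt

variable {k nb nc nm nd : ℕ} {M : Models k nb nc nm nd} {d : Path} {Q : Measure (Obs k)}
  {PX : Measure (Vec k)} {KB : Path → Set (Vec nb)} {KC : Path → Set (Vec nc)}
  {KM : Bool → Set (Vec nm)} {KD : Bool → Set (Vec nd)} {θ : Params nb nc nm nd}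

/-! ### Chain rule in the separate parameter components -/

section Pointwise

variable {w : Obs k} (hw : PointRegular M d KB KC KM KD w.x)
  (hθ : θ ∈ interiorParams d KB KC KM KD)

include hw hθ

theorem fderiv_num1 (v : Params nb nc nm nd) :
    (∫ x, num M d 0 θ x ∂Q)⁻¹ * fderiv ℝ (fun θ' => num M d 0 θ' w) θ v
      = ⟪v.de d.2, dw1 M d Q θ w⟫_ℝ := by
  rw [dw1, inner_smul_right, inner_gradient]
  congr 1
  have h := Params.hasFDerivAt_de d.2 θ
  have h2 := HasFDerivAt.comp (g := fun a => num1 M d a w) θ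
    (differentiableAt_num1 hw hθ).hasFDerivAt h
  exact congrArg (fun L => L v) h2.fderiv

theorem fderiv_num3 (v : Params nb nc nm nd) :
    (∫ x, num M d 2 θ x ∂Q)⁻¹ * fderiv ℝ (fun θ' => num M d 2 θ' w) θ v
      = ⟪v.gc d, dw3 M d Q θ w⟫_ℝ := by
  rw [dw3, inner_smul_right, inner_gradient]
  congr 1
  have h := Params.hasFDerivAt_gc d θ
  have h2 := HasFDerivAt.comp (g := fun a => num3 M d a w) θ
    (differentiableAt_num3 hw hθ).hasFDerivAt h
  exact congrArg (fun L => L v) h2.fderiv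

theorem fderiv_num4 (v : Params nb nc nm nd) :
    (∫ x, num M d 3 θ x ∂Q)⁻¹ * fderiv ℝ (fun θ' => num M d 3 θ' w) θ v
      = ⟪v.gc d, dw4gc M d Q θ w⟫_ℝ + ⟪v.de d.2, dw4de M d Q θ w⟫_ℝ := by
  rw [dw4gc, dw4de, inner_smul_right, inner_gradient, inner_smul_right, inner_gradient, ← mul_add]
  congr 1
  have h := (Params.hasFDerivAt_gc d θ).prodMk (Params.hasFDerivAt_de d.2 θ)
  have hd := differentiableAt_num4 hw hθ
  have h2 := HasFDerivAt.comp (g := fun p : Vec nc × Vec nd => num4 M d p.1 p.2 w) θ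
    hd.hasFDerivAt h
  exact (congrArg (fun L => L v) h2.fderiv).trans (fderiv_prod_apply hd (v.gc d) (v.de d.2))

theorem fderiv_num2 (v : Params nb nc nm nd) :
    (∫ x, num M d 1 θ x ∂Q)⁻¹ * fderiv ℝ (fun θ' => num M d 1 θ' w) θ v
      = ⟪v.gc d, dw2gc M d Q θ w⟫_ℝ + (⟪v.gm d.2, dw2gm M d Q θ w⟫_ℝ
        + (⟪v.gc baseline, dw2gc0 M d Q θ w⟫_ℝ + (⟪v.gm baseline.2, dw2gm0 M d Q θ w⟫_ℝ
        + ⟪v.de baseline.2, dw2de0 M d Q θ w⟫_ℝ))) := by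
  rw [dw2gc, dw2gm, dw2gc0, dw2gm0, dw2de0]
  simp only [inner_smul_right, inner_gradient, ← mul_add]
  congr 1
  have h := (Params.hasFDerivAt_gc d θ).prodMk ((Params.hasFDerivAt_gm d.2 θ).prodMk
    ((Params.hasFDerivAt_gc baseline θ).prodMk ((Params.hasFDerivAt_gm baseline.2 θ).prodMk
      (Params.hasFDerivAt_de baseline.2 θ))))
  have hd := differentiableAt_num2Tuple hw hθ
  have h2 := HasFDerivAt.comp (g := num2Tuple M d w) θ hd.hasFDerivAt h
  have hd2 := differentiableAt_prod_right hd
  have hd3 := differentiableAt_prod_right hd2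
  have hd4 := differentiableAt_prod_right hd3
  -- The partial derivatives are peeled off one tuple entry at a time. When d₂ = d₂' the two
  -- marginal entries hold the same value but remain separate arguments.
  refine (congrArg (fun L => L v) h2.fderiv).trans ((fderiv_prod_apply hd (v.gc d)
    (v.gm d.2, v.gc baseline, v.gm baseline.2, v.de baseline.2)).trans ?_)
  refine congrArg₂ (· + ·) rfl ((fderiv_prod_apply hd2 (v.gm d.2)
    (v.gc baseline, v.gm baseline.2, v.de baseline.2)).trans ?_)
  refine congrArg₂ (· + ·) rfl ((fderiv_prod_apply hd3 (v.gc baseline)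
    (v.gm baseline.2, v.de baseline.2)).trans ?_)
  exact congrArg₂ (· + ·) rfl (fderiv_prod_apply hd4 (v.gm baseline.2) (v.de baseline.2))

/-- When `d₂ = d₂'`, the marginal treatment model cancels from the second weight. -/
theorem dw2gm_add_dw2gm0 (hd2 : d.2 = false) (u : Vec nm) :
    ⟪u, dw2gm M d Q θ w⟫_ℝ + ⟪u, dw2gm0 M d Q θ w⟫_ℝ = 0 := by
  obtain ⟨d₁, d₂⟩ := d
  simp only at hd2
  subst hd2
  rw [dw2gm, dw2gm0, inner_smul_right, inner_gradient, inner_smul_right, inner_gradient, ← mul_add]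
  refine mul_eq_zero_of_right _ ?_
  have hθ' := hθ
  obtain ⟨-, h2, h3, h4⟩ := hθ'
  set G : Vec nm × Vec nm → ℝ := fun p => num2 M (d₁, false) (θ.gc (d₁, false)) p.1
    (θ.gc baseline) p.2 (θ.de baseline.2) w with hG
  have hGd : DifferentiableAt ℝ G (θ.gm false, θ.gm false) := by
    have hd := differentiableAt_num2Tuple hw hθ
    exact DifferentiableAt.comp (g := num2Tuple M (d₁, false) w)
      (f := fun p : Vec nm × Vec nm => (θ.gc (d₁, false), p.1, θ.gc baseline, p.2, θ.de baseline.2))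
      (θ.gm false, θ.gm false) hd (by fun_prop)
  -- On the diagonal the positive marginal model cancels from the odds. Hence G is locally constant
  -- there, and its derivative along (u, u), the sum of the two partial derivatives, is zero.
  have hconst : (fun b => G (b, b)) =ᶠ[𝓝 (θ.gm false)] fun _ => ind w.s / M.phi false w.x
      (θ.de false) * (M.piC (d₁, false) w.x (θ.gc (d₁, false)) / M.piC baseline w.x (θ.gc baseline))
      * ind (decide (w.path = baseline)) := by
    filter_upwards [isOpen_interior.mem_nhds (h3 false (by simp))] with b hb
    have := (hw.piM_pos b hb).ne'
    simp only [hG, num2]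
    rw [mul_div_mul_right _ _ this]
  have hzero : fderiv ℝ (fun b => G (b, b)) (θ.gm false) = 0 := by
    rw [hconst.fderiv_eq]
    exact fderiv_const_apply _
  have hdiag := (hasFDerivAt_id (𝕜 := ℝ) (θ.gm false)).prodMk (hasFDerivAt_id (θ.gm false))
  have hcomp := (HasFDerivAt.comp (g := G) (f := fun b => (b, b)) (θ.gm false) hGd.hasFDerivAt hdiag).fderiv
  have hsum := fderiv_prod_apply hGd u u
  have : fderiv ℝ G (θ.gm false, θ.gm false) (u, u) = 0 := by
    have := congrArg (fun L => L u) (hcomp.symm.trans hzero)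
    exact this
  rw [this] at hsum
  exact hsum.symm

theorem fderiv_mu (v : Params nb nc nm nd) :
    fderiv ℝ (fun θ' : Params nb nc nm nd => M.mu d w.x (θ'.be d)) θ v
      = ⟪v.be d, gradient (M.mu d w.x) (θ.be d)⟫_ℝ := by
  rw [inner_gradient]
  have h := Params.hasFDerivAt_be d θ
  have h2 := HasFDerivAt.comp (g := M.mu d w.x) θ (differentiableAt_mu hw hθ).hasFDerivAt h
  exact congrArg (fun L => L v) h2.fderiv

theorem fderiv_mu0 (v : Params nb nc nm nd) :
    fderiv ℝ (fun θ' : Params nb nc nm nd => M.mu baseline w.x (θ'.be baseline)) θ v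
      = ⟪v.be baseline, gradient (M.mu baseline w.x) (θ.be baseline)⟫_ℝ := by
  rw [inner_gradient]
  have h := Params.hasFDerivAt_be baseline θ
  have h2 := HasFDerivAt.comp (g := M.mu baseline w.x) θ (differentiableAt_mu0 hw hθ).hasFDerivAt h
  exact congrArg (fun L => L v) h2.fderiv

theorem fderiv_resid_zero (v : Params nb nc nm nd) :
    fderiv ℝ (fun θ' => resid M d 0 θ' w) θ v
      = -⟪v.be baseline, gradient (M.mu baseline w.x) (θ.be baseline)⟫_ℝ := by
  rw [← fderiv_mu0 hw hθ]
  exact congrArg (fun L => L v) (fderiv_const_sub (𝕜 := ℝ) w.dY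
    (f := fun θ' : Params nb nc nm nd => M.mu baseline w.x (θ'.be baseline)) (x := θ))

theorem fderiv_resid_two (v : Params nb nc nm nd) :
    fderiv ℝ (fun θ' => resid M d 2 θ' w) θ v
      = ⟪v.be d, gradient (M.mu d w.x) (θ.be d)⟫_ℝ
        - ⟪v.be baseline, gradient (M.mu baseline w.x) (θ.be baseline)⟫_ℝ := by
  rw [← fderiv_mu0 hw hθ, ← fderiv_mu hw hθ]
  exact congrArg (fun L => L v)
    (fderiv_fun_sub (differentiableAt_mu_comp hw hθ) (differentiableAt_mu0_comp hw hθ))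

end Pointwise

/-- Contribution of the `j`-th ratio to the derivative of the estimand in the direction `v`. -/
noncomputable def slope (M : Models k nb nc nm nd) (d : Path) (Q : Measure (Obs k))
    (θ : Params nb nc nm nd) (j : Fin 4) (v : Params nb nc nm nd) (w : Obs k) : ℝ :=
  (∫ x, num M d j θ x ∂Q)⁻¹ *
    (fderiv ℝ (fun θ' => num M d j θ' w * resid M d j θ' w) θ v
      - (∫ x, wt M d (popMean Q) j θ x * resid M d j θ x ∂Q)
        * fderiv ℝ (fun θ' => num M d j θ' w) θ v)

/-- The product rule gives ḟ_j Z_j + f_j Ż_j, and the derivative of the denominator subtracts E[w_j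
Z_j] ḟ_j. The two terms in ḟ_j combine into the centred residual. -/
theorem slope_eq {w : Obs k} (hw : PointRegular M d KB KC KM KD w.x)
    (hθ : θ ∈ interiorParams d KB KC KM KD) (j : Fin 4) (v : Params nb nc nm nd) :
    slope M d Q θ j v w = cresid M d Q θ j w *
      ((∫ x, num M d j θ x ∂Q)⁻¹ * fderiv ℝ (fun θ' => num M d j θ' w) θ v)
      + wt M d (popMean Q) j θ w * fderiv ℝ (fun θ' => resid M d j θ' w) θ v := by
  rw [slope, fderiv_fun_mul (differentiableAt_num hw hθ j) (differentiableAt_resid hw hθ j)]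
  simp only [add_apply, smul_apply, smul_eq_mul, cresid, wt, popMean]
  ring

theorem integrable_slope (hreg : Regularity M d Q PX KB KC KM KD θ)
    (hPX : Q.map Obs.x = PX) (j : Fin 4) (v : Params nb nc nm nd) :
    Integrable (slope M d Q θ j v) Q :=
  (((hreg.smoothAt_num_mul_resid hPX j).integrable_fderiv.apply_continuousLinearMap v).sub
    (((hreg.smoothAt_num hPX j).integrable_fderiv.apply_continuousLinearMap v).const_mul _)).const_mul
    _

section Directions

/-- The parameter with only component `β_c` nonzero. -/
noncomputable def onlyBe (c : Path) (u : Vec nb) : Params nb nc nm nd := (Pi.single c u, 0, 0, 0)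
/-- The parameter with only component `γ_{c₁|c₂}` nonzero. -/
noncomputable def onlyGc (c : Path) (u : Vec nc) : Params nb nc nm nd := (0, Pi.single c u, 0, 0)
/-- The parameter with only component `γ_e` nonzero. -/
noncomputable def onlyGm (e : Bool) (u : Vec nm) : Params nb nc nm nd := (0, 0, Pi.single e u, 0)
/-- The parameter with only component `δ_e` nonzero. -/
noncomputable def onlyDe (e : Bool) (u : Vec nd) : Params nb nc nm nd := (0, 0, 0, Pi.single e u)

end Directions

theorem slope_expansion {w : Obs k} (hw : PointRegular M d KB KC KM KD w.x)
    (hθ : θ ∈ interiorParams d KB KC KM KD) (v : Params nb nc nm nd) :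
    slope M d Q θ 0 v w = cresid M d Q θ 0 w * ⟪v.de d.2, dw1 M d Q θ w⟫_ℝ
      - wt M d (popMean Q) 0 θ w
        * ⟪v.be baseline, gradient (M.mu baseline w.x) (θ.be baseline)⟫_ℝ ∧
    slope M d Q θ 1 v w = cresid M d Q θ 1 w * (⟪v.gc d, dw2gc M d Q θ w⟫_ℝ
        + (⟪v.gm d.2, dw2gm M d Q θ w⟫_ℝ
        + (⟪v.gc baseline, dw2gc0 M d Q θ w⟫_ℝ + (⟪v.gm baseline.2, dw2gm0 M d Q θ w⟫_ℝ
        + ⟪v.de baseline.2, dw2de0 M d Q θ w⟫_ℝ))))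
      - wt M d (popMean Q) 1 θ w
        * ⟪v.be baseline, gradient (M.mu baseline w.x) (θ.be baseline)⟫_ℝ ∧
    slope M d Q θ 2 v w = cresid M d Q θ 2 w * ⟪v.gc d, dw3 M d Q θ w⟫_ℝ
      + wt M d (popMean Q) 2 θ w * (⟪v.be d, gradient (M.mu d w.x) (θ.be d)⟫_ℝ
        - ⟪v.be baseline, gradient (M.mu baseline w.x) (θ.be baseline)⟫_ℝ) ∧
    slope M d Q θ 3 v w = cresid M d Q θ 3 w * (⟪v.gc d, dw4gc M d Q θ w⟫_ℝ
        + ⟪v.de d.2, dw4de M d Q θ w⟫_ℝ)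
      + wt M d (popMean Q) 3 θ w * (⟪v.be d, gradient (M.mu d w.x) (θ.be d)⟫_ℝ
        - ⟪v.be baseline, gradient (M.mu baseline w.x) (θ.be baseline)⟫_ℝ) := by
  have r1 : fderiv ℝ (fun θ' => resid M d 1 θ' w) θ v
      = fderiv ℝ (fun θ' => resid M d 0 θ' w) θ v := rfl
  have r3 : fderiv ℝ (fun θ' => resid M d 3 θ' w) θ v
      = fderiv ℝ (fun θ' => resid M d 2 θ' w) θ v := rfl
  refine ⟨?_, ?_, ?_, ?_⟩
  · rw [slope_eq hw hθ, fderiv_num1 hw hθ, fderiv_resid_zero hw hθ]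
    ring
  · rw [slope_eq hw hθ, fderiv_num2 hw hθ, r1, fderiv_resid_zero hw hθ]
    ring
  · rw [slope_eq hw hθ, fderiv_num3 hw hθ, fderiv_resid_two hw hθ]
  · rw [slope_eq hw hθ, fderiv_num4 hw hθ, r3, fderiv_resid_two hw hθ]

/-- The pairing of a direction with the integrands of the gradient terms of the influence
function, apart from the marginal treatment models. -/
theorem slope_total {w : Obs k} (hw : PointRegular M d KB KC KM KD w.x)
    (hθ : θ ∈ interiorParams d KB KC KM KD) (v : Params nb nc nm nd) :
    slope M d Q θ 0 v w - slope M d Q θ 1 v w + slope M d Q θ 2 v w - slope M d Q θ 3 v w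
      = ⟪v.be d, PsiBe M d Q θ w⟫_ℝ - ⟪v.be baseline, PsiBe0 M d Q θ w⟫_ℝ
        - ⟪v.gc d, PsiGc M d Q θ w⟫_ℝ
        - (⟪v.gm d.2, PsiGm M d Q θ w⟫_ℝ + ⟪v.gm baseline.2, PsiGm0 M d Q θ w⟫_ℝ)
        - ⟪v.gc baseline, PsiGc0 M d Q θ w⟫_ℝ
        + ⟪v.de d.2, PsiDe M d Q θ w⟫_ℝ - ⟪v.de baseline.2, PsiDe0 M d Q θ w⟫_ℝ := by
  obtain ⟨h0, h1, h2, h3⟩ := slope_expansion (Q := Q) hw hθ v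
  rw [h0, h1, h2, h3, PsiBe, PsiBe0, PsiGc, PsiGm, PsiGm0, PsiGc0, PsiDe, PsiDe0]
  simp only [inner_smul_right, inner_sub_right, inner_add_right]
  ring

/-! ### Integrability of the gradients and assembly of the influence function -/

section Integrability

variable (hreg : Regularity M d Q PX KB KC KM KD θ) (hPX : Q.map Obs.x = PX)
  (hd : d ≠ baseline)

include hreg hPX

theorem integrable_slope_total (v : Params nb nc nm nd) :
    Integrable (fun w => slope M d Q θ 0 v w - slope M d Q θ 1 v w + slope M d Q θ 2 v w
      - slope M d Q θ 3 v w) Q :=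
  (((integrable_slope hreg hPX 0 v).sub (integrable_slope hreg hPX 1 v)).add
    (integrable_slope hreg hPX 2 v)).sub (integrable_slope hreg hPX 3 v)

omit hPX in
theorem Regularity.mem_interiorParams : θ ∈ interiorParams d KB KC KM KD :=
  mem_of_mem_nhds hreg.interiorParams_mem_nhds

/-- Integrability is read off from slopes in directions with a single nonzero component. As δ_{d₂}
and δ_{d₂'} may be the same component, the total slope would mix their gradients. The second ratio
alone carries δ_{d₂'}, while the first and fourth alone carry δ_{d₂}. -/
theorem integrable_PsiDe0 : Integrable (PsiDe0 M d Q θ) Q := by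
  refine integrable_of_inner fun u => (integrable_slope hreg hPX 1 (onlyDe false u)).congr ?_
  filter_upwards [hreg.ae_obs hPX] with w hw
  rw [(slope_expansion hw (hreg.mem_interiorParams) _).2.1]
  simp [onlyDe, Params.be, Params.gc, Params.gm, Params.de, PsiDe0, inner_smul_right]

theorem integrable_PsiDe : Integrable (PsiDe M d Q θ) Q := by
  refine integrable_of_inner fun u => ((integrable_slope hreg hPX 0 (onlyDe d.2 u)).sub
    (integrable_slope hreg hPX 3 (onlyDe d.2 u))).congr ?_
  filter_upwards [hreg.ae_obs hPX] with w hw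
  rw [Pi.sub_apply, (slope_expansion hw (hreg.mem_interiorParams) _).1,
    (slope_expansion hw (hreg.mem_interiorParams) _).2.2.2]
  simp [onlyDe, Params.be, Params.gc, Params.de, PsiDe, inner_smul_right, inner_sub_right]

include hd

/-- Since d ≠ d', β_d and β_{d'} are distinct components of θ, so a direction in one of them
isolates its gradient in the total slope. The same reasoning applies to γ_{d₁|d₂} and γ_{d₁'|d₂'}.
-/
theorem integrable_PsiBe : Integrable (PsiBe M d Q θ) Q := by
  refine integrable_of_inner fun u => (integrable_slope_total hreg hPX (onlyBe d u)).congr ?_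
  filter_upwards [hreg.ae_obs hPX] with w hw
  rw [slope_total hw (hreg.mem_interiorParams)]
  simp [onlyBe, Params.be, Params.gc, Params.gm, Params.de, hd.symm]

theorem integrable_PsiBe0 : Integrable (PsiBe0 M d Q θ) Q := by
  refine integrable_of_inner fun u =>
    (integrable_slope_total hreg hPX (onlyBe baseline u)).neg.congr ?_
  filter_upwards [hreg.ae_obs hPX] with w hw
  rw [Pi.neg_apply, slope_total hw (hreg.mem_interiorParams)]
  simp [onlyBe, Params.be, Params.gc, Params.gm, Params.de, hd]

theorem integrable_PsiGc : Integrable (PsiGc M d Q θ) Q := by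
  refine integrable_of_inner fun u =>
    (integrable_slope_total hreg hPX (onlyGc d u)).neg.congr ?_
  filter_upwards [hreg.ae_obs hPX] with w hw
  rw [Pi.neg_apply, slope_total hw (hreg.mem_interiorParams)]
  simp [onlyGc, Params.be, Params.gc, Params.gm, Params.de, hd.symm]

theorem integrable_PsiGc0 : Integrable (PsiGc0 M d Q θ) Q := by
  refine integrable_of_inner fun u =>
    (integrable_slope_total hreg hPX (onlyGc baseline u)).neg.congr ?_
  filter_upwards [hreg.ae_obs hPX] with w hw
  rw [Pi.neg_apply, slope_total hw (hreg.mem_interiorParams)]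
  simp [onlyGc, Params.be, Params.gc, Params.gm, Params.de, hd]

omit hd in
-- For d₂ = 1 the two marginal parameters are distinct and each gradient is integrable. For d₂ = 0
-- they are one parameter, so the envelope in θ controls only the sum of the two gradients; that sum
-- vanishes because the marginal model cancels from f₂.
theorem integrable_PsiGm_pairing (v : Params nb nc nm nd) :
    Integrable (fun w => ⟪v.gm d.2, PsiGm M d Q θ w⟫_ℝ
      + ⟪v.gm baseline.2, PsiGm0 M d Q θ w⟫_ℝ) Q ∧
    ∫ w, (⟪v.gm d.2, PsiGm M d Q θ w⟫_ℝ + ⟪v.gm baseline.2, PsiGm0 M d Q θ w⟫_ℝ) ∂Q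
      = ⟪v.gm d.2, ∫ w, PsiGm M d Q θ w ∂Q⟫_ℝ + ⟪v.gm baseline.2, ∫ w, PsiGm0 M d Q θ w ∂Q⟫_ℝ := by
  rcases Bool.eq_false_or_eq_true d.2 with hd2 | hd2
  · have hG : Integrable (PsiGm M d Q θ) Q := by
      refine integrable_of_inner fun u =>
        (integrable_slope_total hreg hPX (onlyGm true u)).neg.congr ?_
      filter_upwards [hreg.ae_obs hPX] with w hw
      rw [Pi.neg_apply, slope_total hw (hreg.mem_interiorParams)]
      simp [onlyGm, Params.be, Params.gc, Params.gm, Params.de, hd2]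
    have hG0 : Integrable (PsiGm0 M d Q θ) Q := by
      refine integrable_of_inner fun u =>
        (integrable_slope_total hreg hPX (onlyGm false u)).neg.congr ?_
      filter_upwards [hreg.ae_obs hPX] with w hw
      rw [Pi.neg_apply, slope_total hw (hreg.mem_interiorParams)]
      simp [onlyGm, Params.be, Params.gc, Params.gm, Params.de, hd2]
    refine ⟨(hG.const_inner _).add (hG0.const_inner _), ?_⟩
    rw [integral_add (hG.const_inner _) (hG0.const_inner _), integral_inner hG, integral_inner hG0]
  · have hneg : ∀ᵐ w ∂Q, PsiGm0 M d Q θ w = - PsiGm M d Q θ w := by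
      filter_upwards [hreg.ae_obs hPX] with w hw
      refine ext_inner_left ℝ fun u => ?_
      have := dw2gm_add_dw2gm0 (Q := Q) hw (hreg.mem_interiorParams) hd2 u
      rw [PsiGm, PsiGm0, inner_neg_right, inner_smul_right, inner_smul_right]
      linear_combination cresid M d Q θ 1 w * this
    have hz : (fun w => ⟪v.gm d.2, PsiGm M d Q θ w⟫_ℝ + ⟪v.gm baseline.2, PsiGm0 M d Q θ w⟫_ℝ)
        =ᵐ[Q] fun _ => 0 := by
      filter_upwards [hneg] with w hw
      rw [hw, hd2, inner_neg_right, add_neg_cancel]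
    refine ⟨(integrable_zero _ _ _).congr hz.symm, ?_⟩
    -- The separate integrals need not converge here. They are still opposite to each other, since
    -- the Bochner integral commutes with negation even at its default value 0.
    rw [integral_congr_ae hz, integral_congr_ae hneg, integral_neg, hd2, inner_neg_right]
    simp

/-- The total derivative of the estimand is the gradient part of the influence function. -/
theorem integral_slope_total (v : Params nb nc nm nd) :
    ∫ w, (slope M d Q θ 0 v w - slope M d Q θ 1 v w + slope M d Q θ 2 v w - slope M d Q θ 3 v w) ∂Q
      = ⟪v.be d, ∫ w, PsiBe M d Q θ w ∂Q⟫_ℝ - ⟪v.be baseline, ∫ w, PsiBe0 M d Q θ w ∂Q⟫_ℝ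
        - ⟪v.gc d, ∫ w, PsiGc M d Q θ w ∂Q⟫_ℝ
        - (⟪v.gm d.2, ∫ w, PsiGm M d Q θ w ∂Q⟫_ℝ + ⟪v.gm baseline.2, ∫ w, PsiGm0 M d Q θ w ∂Q⟫_ℝ)
        - ⟪v.gc baseline, ∫ w, PsiGc0 M d Q θ w ∂Q⟫_ℝ
        + ⟪v.de d.2, ∫ w, PsiDe M d Q θ w ∂Q⟫_ℝ
        - ⟪v.de baseline.2, ∫ w, PsiDe0 M d Q θ w ∂Q⟫_ℝ := by
  have i1 := integrable_PsiBe hreg hPX hd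
  have i2 := integrable_PsiBe0 hreg hPX hd
  have i3 := integrable_PsiGc hreg hPX hd
  have i4 := integrable_PsiGc0 hreg hPX hd
  have i5 := integrable_PsiDe hreg hPX
  have i6 := integrable_PsiDe0 hreg hPX
  obtain ⟨i7, e7⟩ := integrable_PsiGm_pairing hreg hPX v
  have j1 := i1.const_inner (𝕜 := ℝ) (v.be d)
  have j2 := i2.const_inner (𝕜 := ℝ) (v.be baseline)
  have j3 := i3.const_inner (𝕜 := ℝ) (v.gc d)
  have j4 := i4.const_inner (𝕜 := ℝ) (v.gc baseline)
  have j5 := i5.const_inner (𝕜 := ℝ) (v.de d.2)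
  have j6 := i6.const_inner (𝕜 := ℝ) (v.de baseline.2)
  rw [← e7, ← integral_inner i1, ← integral_inner i2, ← integral_inner i3, ← integral_inner i4,
    ← integral_inner i5, ← integral_inner i6]
  refine (integral_congr_ae ?_).trans (integral_sub_add_sub (f₀ := fun w =>
    ⟪v.be d, PsiBe M d Q θ w⟫_ℝ - ⟪v.be baseline, PsiBe0 M d Q θ w⟫_ℝ
      - ⟪v.gc d, PsiGc M d Q θ w⟫_ℝ - (⟪v.gm d.2, PsiGm M d Q θ w⟫_ℝ
        + ⟪v.gm baseline.2, PsiGm0 M d Q θ w⟫_ℝ)) (((j1.sub j2).sub j3).sub i7) j4 j5 j6) |>.trans ?_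
  · filter_upwards [hreg.ae_obs hPX] with w hw
    exact slope_total hw (hreg.mem_interiorParams) v
  · rw [integral_sub (f := fun w => ⟪v.be d, PsiBe M d Q θ w⟫_ℝ
      - ⟪v.be baseline, PsiBe0 M d Q θ w⟫_ℝ - ⟪v.gc d, PsiGc M d Q θ w⟫_ℝ)
      ((j1.sub j2).sub j3) i7, integral_sub (f := fun w => ⟪v.be d, PsiBe M d Q θ w⟫_ℝ
      - ⟪v.be baseline, PsiBe0 M d Q θ w⟫_ℝ) (j1.sub j2) j3, integral_sub j1 j2]

/-- The influence function is the signed sum of the influence functions of the four ratios. -/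
theorem xi_eq_sum_ratioInfluence (b β : Obs k → Params nb nc nm nd)
    (hβ : ∀ w, β w = Params.restrict d 0 (b w)) (w : Obs k) :
    xi M d Q θ b w = ∑ j, sgn j * ratioInfluence Q θ
      (fun θ w => num M d j θ w * resid M d j θ w) (num M d j) β w := by
  have hr : ∀ j, ∫ x, wt M d (popMean Q) j θ x * resid M d j θ x ∂Q
      = (∫ x, num M d j θ x * resid M d j θ x ∂Q) / ∫ x, num M d j θ x ∂Q := fun j => by
    simp only [wt, popMean, div_mul_eq_mul_div]
    exact integral_div _ _
  have hj : ∀ j, ratioInfluence Q θ (fun θ w => num M d j θ w * resid M d j θ w) (num M d j) β w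
      = wt M d (popMean Q) j θ w * cresid M d Q θ j w
        + ∫ x, slope M d Q θ j (β w) x ∂Q := by
    intro j
    have hi1 := (hreg.smoothAt_num_mul_resid hPX j).integrable_fderiv
    have hi2 := (hreg.smoothAt_num hPX j).integrable_fderiv
    have hc := hreg.num_ne_zero j
    have hs : ∫ x, slope M d Q θ j (β w) x ∂Q = (∫ x, num M d j θ x ∂Q)⁻¹ *
        ((∫ x, fderiv ℝ (fun θ' => num M d j θ' x * resid M d j θ' x) θ ∂Q) (β w)
          - (∫ x, wt M d (popMean Q) j θ x * resid M d j θ x ∂Q)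
            * (∫ x, fderiv ℝ (fun θ' => num M d j θ' x) θ ∂Q) (β w)) := by
      unfold slope
      rw [integral_const_mul, integral_sub (hi1.apply_continuousLinearMap _)
        ((hi2.apply_continuousLinearMap _).const_mul _), integral_const_mul,
        ContinuousLinearMap.integral_apply hi1, ContinuousLinearMap.integral_apply hi2]
    -- With a and c the means of numerator and denominator, (h - a) - (a/c)(g - c) = h - (a/c)g: the
    -- constants cancel and what remains is f_j times the centred residual.
    rw [hs, ratioInfluence, cresid, hr, wt, popMean]
    field_simp
    ring
  have htot := integral_slope_total hreg hPX hd (β w)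
  rw [integral_sub_add_sub (integrable_slope hreg hPX 0 (β w)) (integrable_slope hreg hPX 1 (β w))
    (integrable_slope hreg hPX 2 (β w)) (integrable_slope hreg hPX 3 (β w))] at htot
  -- The gradients pair only with components that enter the estimator, and there β agrees with b.
  simp only [hβ, Params.restrict_be, Params.restrict_be0, Params.restrict_gc,
    Params.restrict_gc0, Params.restrict_gm, Params.restrict_gm0, Params.restrict_de,
    Params.restrict_de0] at htot
  simp only [Fin.sum_univ_four, hj, sgn, Matrix.cons_val, xi, psi, hβ]
  linear_combination -htot

end Integrability

end MissingDID

/-! ### Asymptotically linear estimators in product spaces -/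

section AsympLinear

variable {Ω 𝒲 : Type*} [MeasurableSpace Ω] [MeasurableSpace 𝒲]

/-- Asymptotic linearity of the estimators `T n` of `t₀` with influence function `β`. -/
structure AsympLinear {E : Type*} [NormedAddCommGroup E] [NormedSpace ℝ E] [MeasurableSpace E]
    (P : Measure Ω) (W : ℕ → Ω → 𝒲) (Q : Measure 𝒲) (T : ℕ → Ω → E) (t₀ : E) (β : 𝒲 → E) :
    Prop where
  measurable_est : ∀ n, Measurable (T n)
  measurable_inf : Measurable β
  memLp : MemLp β 2 Q
  integral_eq_zero : ∫ w, β w ∂Q = 0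
  expansion : SmallInProb P (fun (n : ℕ) ω => Real.sqrt n • (T n ω - t₀)
    - (Real.sqrt n)⁻¹ • ∑ i ∈ Finset.range n, β (W i ω))

variable {P : Measure Ω} [IsProbabilityMeasure P] {W : ℕ → Ω → 𝒲} {Q : Measure 𝒲}
  [IsProbabilityMeasure Q]
  {E F : Type*} [NormedAddCommGroup E] [NormedSpace ℝ E] [MeasurableSpace E] [BorelSpace E]
  [SecondCountableTopology E]
  [CompleteSpace E] [NormedAddCommGroup F] [NormedSpace ℝ F] [MeasurableSpace F] [BorelSpace F]
  [SecondCountableTopology F] [CompleteSpace F]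

omit [BorelSpace E] [SecondCountableTopology E] [CompleteSpace E] [IsProbabilityMeasure P]
  [IsProbabilityMeasure Q] in
theorem asympLinear_const (t₀ : E) : AsympLinear P W Q (fun _ _ => t₀) t₀ (fun _ => 0) where
  measurable_est _ := measurable_const
  measurable_inf := measurable_const
  memLp := MemLp.zero'
  integral_eq_zero := by simp
  expansion := by simpa using smallInProb_zero

omit [SecondCountableTopology E] [SecondCountableTopology F] in
theorem AsympLinear.clm (L : E →L[ℝ] F) {T : ℕ → Ω → E} {t₀ : E} {β : 𝒲 → E}
    (h : AsympLinear P W Q T t₀ β) :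
    AsympLinear P W Q (fun n ω => L (T n ω)) (L t₀) (fun w => L (β w)) where
  measurable_est n := L.continuous.measurable.comp (h.measurable_est n)
  measurable_inf := L.continuous.measurable.comp h.measurable_inf
  memLp := L.comp_memLp' h.memLp
  integral_eq_zero := by
    rw [L.integral_comp_comm (h.memLp.integrable (by norm_num)), h.integral_eq_zero, map_zero]
  expansion := by
    refine h.expansion.mul_bdd (bddInProb_const L) fun n ω => ?_
    rw [mul_comm]
    refine le_trans (le_of_eq ?_) (L.le_opNorm _)
    simp [map_sub, map_sum]

omit [CompleteSpace E] in
theorem AsympLinear.add {T T' : ℕ → Ω → E} {t₀ t₀' : E} {β β' : 𝒲 → E}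
    (h : AsympLinear P W Q T t₀ β) (h' : AsympLinear P W Q T' t₀' β') :
    AsympLinear P W Q (fun n ω => T n ω + T' n ω) (t₀ + t₀') (fun w => β w + β' w) where
  measurable_est n := (h.measurable_est n).add (h'.measurable_est n)
  measurable_inf := h.measurable_inf.add h'.measurable_inf
  memLp := h.memLp.add h'.memLp
  integral_eq_zero := by
    rw [integral_add (h.memLp.integrable (by norm_num)) (h'.memLp.integrable (by norm_num)),
      h.integral_eq_zero, h'.integral_eq_zero, add_zero]
  expansion := by
    refine (h.expansion.add h'.expansion).of_norm_le fun n ω => le_of_eq ?_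
    congr 1
    rw [Finset.sum_add_distrib]
    module

omit [CompleteSpace E] in
theorem AsympLinear.sum {ι : Type*} (s : Finset ι) {T : ι → ℕ → Ω → E} {t₀ : ι → E}
    {β : ι → 𝒲 → E} (h : ∀ i, AsympLinear P W Q (T i) (t₀ i) (β i)) :
    AsympLinear P W Q (fun n ω => ∑ i ∈ s, T i n ω) (∑ i ∈ s, t₀ i)
      (fun w => ∑ i ∈ s, β i w) := by
  classical
  induction s using Finset.induction_on with
  | empty => simpa using asympLinear_const (0 : E)
  | insert a s ha ih =>
    simp only [Finset.sum_insert ha]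
    exact (h a).add ih

/-- A pair is the sum of the images of its entries under the two coordinate inclusions, so closure
under linear maps and sums suffices. Finite families work the same way. -/
theorem AsympLinear.prodMk {T : ℕ → Ω → E} {t₀ : E} {β : 𝒲 → E} {T' : ℕ → Ω → F} {t₀' : F}
    {β' : 𝒲 → F} (h : AsympLinear P W Q T t₀ β) (h' : AsympLinear P W Q T' t₀' β') :
    AsympLinear P W Q (fun n ω => (T n ω, T' n ω)) (t₀, t₀') (fun w => (β w, β' w)) := by
  simpa using (h.clm (ContinuousLinearMap.inl ℝ E F)).add (h'.clm (ContinuousLinearMap.inr ℝ E F))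

theorem AsympLinear.pi {ι : Type} [Fintype ι] [DecidableEq ι] {T : ℕ → Ω → ι → E} {t₀ : ι → E}
    {β : 𝒲 → ι → E}
    (h : ∀ i, AsympLinear P W Q (fun n ω => T n ω i) (t₀ i) (fun w => β w i)) :
    AsympLinear P W Q T t₀ β := by
  have key := AsympLinear.sum Finset.univ fun i =>
    (h i).clm (ContinuousLinearMap.single ℝ (fun _ : ι => E) i)
  simp only [ContinuousLinearMap.single_apply, Finset.univ_sum_single] at key
  exact key

end AsympLinear

namespace MissingDID

variable {k nb nc nm nd : ℕ} {M : Models k nb nc nm nd} {d : Path} {Q : Measure (Obs k)}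
  {PX : Measure (Vec k)} {KB : Path → Set (Vec nb)} {KC : Path → Set (Vec nc)}
  {KM : Bool → Set (Vec nm)} {KD : Bool → Set (Vec nd)} {θs : Params nb nc nm nd}
  {Ω : Type*} [MeasurableSpace Ω] {P : Measure Ω} [IsProbabilityMeasure P] {W : ℕ → Ω → Obs k}

theorem AsymptoticallyLinear.asympLinear {r : ℕ} {est : ℕ → Ω → Vec r} {t : Vec r}
    {b : Obs k → Vec r} (h : AsymptoticallyLinear P W Q est t b) : AsympLinear P W Q est t b :=
  ⟨h.measurable_est, h.measurable_b, h.memLp_b, h.integral_b,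
    tendstoInMeasure_zero_iff_smallInProb.1 h.expansion⟩

theorem asympLinear_ite {r : ℕ} {p : Prop} [Decidable p] {est : ℕ → Ω → Vec r} {t : Vec r}
    {b : Obs k → Vec r} (h : p → AsymptoticallyLinear P W Q est t b) :
    AsympLinear P W Q (fun n ω => if p then est n ω else t) t
      (fun w => if p then b w else 0) := by
  by_cases hp : p
  · simpa [hp] using (h hp).asympLinear
  · simpa [hp] using asympLinear_const t

/-- Components that do not enter the estimator carry no assumption, not even measurability. Freezing
them at their pseudo-true values gives zero influence there and an asymptotically linear estimate of
the whole parameter. -/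
theorem asympLinear_restrict [IsProbabilityMeasure Q] {est : ℕ → Ω → Params nb nc nm nd}
    {b : Obs k → Params nb nc nm nd}
    (hbe : ∀ c ∈ ({d, baseline} : Set Path),
      AsymptoticallyLinear P W Q (fun n ω => (est n ω).be c) (θs.be c) (fun w => (b w).be c))
    (hgc : ∀ c ∈ ({d, baseline} : Set Path),
      AsymptoticallyLinear P W Q (fun n ω => (est n ω).gc c) (θs.gc c) (fun w => (b w).gc c))
    (hgm : ∀ e ∈ ({d.2, baseline.2} : Set Bool),
      AsymptoticallyLinear P W Q (fun n ω => (est n ω).gm e) (θs.gm e) (fun w => (b w).gm e))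
    (hde : ∀ e ∈ ({d.2, baseline.2} : Set Bool),
      AsymptoticallyLinear P W Q (fun n ω => (est n ω).de e) (θs.de e) (fun w => (b w).de e)) :
    AsympLinear P W Q (fun n ω => Params.restrict d θs (est n ω)) θs
      (fun w => Params.restrict d 0 (b w)) :=
  (AsympLinear.pi fun c => asympLinear_ite (hbe c)).prodMk
    ((AsympLinear.pi fun c => asympLinear_ite (hgc c)).prodMk
      ((AsympLinear.pi fun e => asympLinear_ite (hgm e)).prodMk
        (AsympLinear.pi fun e => asympLinear_ite (hde e))))

omit [MeasurableSpace Ω] in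
theorem estimator_restrict (est : ℕ → Ω → Params nb nc nm nd) :
    estimator M d W est = estimator M d W (fun n ω => Params.restrict d θs (est n ω)) := by
  funext n ω
  simp only [estimator_eq_sum, num_restrict, resid_restrict]

/-! ### Expansion of the two-step estimator -/

section Main

variable [IsProbabilityMeasure Q] (hreg : Regularity M d Q PX KB KC KM KD θs)
  (hPX : Q.map Obs.x = PX) (hd : d ≠ baseline) {T : ℕ → Ω → Params nb nc nm nd}
  {β b : Obs k → Params nb nc nm nd} (hT : AsympLinear P W Q T θs β)
  (hβ : ∀ w, β w = Params.restrict d 0 (b w))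

include hreg hPX hd hT hβ

omit [IsProbabilityMeasure P] in
theorem xi_memLp : Measurable (xi M d Q θs b) ∧ MemLp (xi M d Q θs b) 2 Q ∧
    ∫ w, xi M d Q θs b w ∂Q = 0 := by
  have hr := fun j => ratioInfluence_memLp hT.measurable_inf hT.memLp hT.integral_eq_zero
    (hreg.smoothAt_num_mul_resid hPX j) (hreg.smoothAt_num hPX j)
  have hxi := xi_eq_sum_ratioInfluence hreg hPX hd b β hβ
  have hxi' : xi M d Q θs b = _ := funext hxi
  have hm := fun j => (hr j).2.1.const_mul (sgn j)
  rw [hxi']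
  refine ⟨Finset.measurable_fun_sum _ fun j _ => (hr j).1.const_mul _,
    memLp_finsetSum _ fun j _ => hm j, ?_⟩
  rw [integral_finsetSum _ fun j _ => (hm j).integrable (by norm_num)]
  refine Finset.sum_eq_zero fun j _ => ?_
  rw [integral_const_mul, (hr j).2.2, mul_zero]

theorem estimator_expansion (hW : ∀ i, Measurable (W i)) (hind : iIndepFun W P)
    (hlaw : ∀ i, P.map (W i) = Q) :
    SmallInProb P (fun (n : ℕ) ω => Real.sqrt n * (estimator M d W T n ω - estimand M d Q θs)
      - (Real.sqrt n)⁻¹ * ∑ i ∈ Finset.range n, xi M d Q θs b (W i ω)) := by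
  have key := SmallInProb.finset_sum Finset.univ fun j _ =>
    (smallInProb_ratio_estimated hW hind hlaw hT.measurable_inf hT.memLp hT.integral_eq_zero
      hT.expansion (hreg.smoothAt_num_mul_resid hPX j) (hreg.smoothAt_num hPX j)
      (hreg.num_ne_zero j)).const_mul (sgn j)
  refine key.of_norm_le fun n ω => le_of_eq ?_
  rw [estimator_eq_sum, estimand_eq_sum _ _ _ _ fun j =>
    (hreg.memLp_num_resid j).integrable (by norm_num)]
  simp only [xi_eq_sum_ratioInfluence hreg hPX hd b β hβ]
  rw [Finset.sum_comm, ← Finset.sum_sub_distrib, Finset.mul_sum, Finset.mul_sum,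
    ← Finset.sum_sub_distrib]
  congr 1
  refine Finset.sum_congr rfl fun j _ => ?_
  rw [← Finset.mul_sum]
  ring

end Main

end MissingDID

/-! ### Conditional expectations given an event, and conditional independence -/

section Conditioning

variable {Ω : Type*} {m m₀ : MeasurableSpace Ω} {P : Measure Ω} [IsFiniteMeasure P] {B : Set Ω}

/-- The normalising factor (P B)⁻¹ is never zero because P is finite, so the null sets agree even
when B is null. -/
theorem ae_cond_eq_ae_restrict : ae (cond P B) = ae (P.restrict B) := by
  rw [ProbabilityTheory.cond, Measure.ae_ennreal_smul_measure_eq]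
  exact ENNReal.inv_ne_zero.2 (measure_ne_top P B)

theorem integrable_cond_iff_integrableOn (hB : P B ≠ 0) {f : Ω → ℝ} :
    Integrable f (cond P B) ↔ IntegrableOn f B P :=
  integrable_smul_measure (ENNReal.inv_ne_zero.2 (measure_ne_top P B)) (ENNReal.inv_ne_top.2 hB)

omit [IsFiniteMeasure P] in
theorem integral_cond_eq (f : Ω → ℝ) : ∫ ω, f ω ∂(cond P B) = (P.real B)⁻¹ * ∫ ω in B, f ω ∂P := by
  rw [ProbabilityTheory.cond, integral_smul_measure, smul_eq_mul, ENNReal.toReal_inv, measureReal_def]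

/-- Conditioning on an event and on `m` inside a set integral, with `m`-measurable factor. -/
theorem setIntegral_mul_condExp_cond (hm : m ≤ m₀) {Y h : Ω → ℝ} (hY : Integrable Y P)
    (hh : StronglyMeasurable[m] h) (hint : IntegrableOn (fun ω => h ω * Y ω) B P) :
    IntegrableOn (fun ω => h ω * condExp m (cond P B) Y ω) B P ∧
      ∫ ω in B, h ω * condExp m (cond P B) Y ω ∂P = ∫ ω in B, h ω * Y ω ∂P := by
  -- A null B is allowed: every integral over it is zero.
  by_cases hB : P B = 0
  · have h0 : P.restrict B = 0 := Measure.restrict_eq_zero.2 hB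
    simp [IntegrableOn, h0]
  have := cond_isProbabilityMeasure hB
  have hpull : condExp m (cond P B) (fun ω => h ω * Y ω)
      =ᵐ[cond P B] fun ω => h ω * condExp m (cond P B) Y ω :=
    condExp_mul_of_stronglyMeasurable_left hh ((integrable_cond_iff_integrableOn hB).2 hint)
      ((integrable_cond_iff_integrableOn hB).2 hY.integrableOn)
  refine ⟨(integrable_cond_iff_integrableOn hB).1 (integrable_condExp.congr hpull), ?_⟩
  have h1 := (integral_congr_ae hpull).symm.trans (integral_condExp hm)
  rw [integral_cond_eq, integral_cond_eq] at h1
  exact mul_left_cancel₀ (inv_ne_zero ((measureReal_ne_zero_iff (measure_ne_top _ _)).2 hB)) h1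

/-- The conditional probability of an event as a weight. -/
theorem integral_condProb_mul (hm : m ≤ m₀) (hB : MeasurableSet B) {h : Ω → ℝ}
    (hh : StronglyMeasurable[m] h) (hint : IntegrableOn h B P) :
    Integrable (fun ω => condExp m P (B.indicator fun _ => (1 : ℝ)) ω * h ω) P ∧
      ∫ ω, condExp m P (B.indicator fun _ => (1 : ℝ)) ω * h ω ∂P = ∫ ω in B, h ω ∂P := by
  have heq : (fun ω => h ω * B.indicator (fun _ => (1 : ℝ)) ω) = B.indicator h := by
    funext ω
    by_cases hω : ω ∈ B <;> simp [hω]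
  have hpull : condExp m P (fun ω => h ω * B.indicator (fun _ => (1 : ℝ)) ω)
      =ᵐ[P] fun ω => h ω * condExp m P (B.indicator fun _ => (1 : ℝ)) ω :=
    condExp_mul_of_stronglyMeasurable_left hh
      (by change Integrable (fun ω => h ω * B.indicator (fun _ => (1 : ℝ)) ω) P
          rw [heq]; exact (integrable_indicator_iff hB).2 hint)
      ((integrable_const _).indicator hB)
  have h2 := integrable_condExp.congr hpull
  have h3 := (integral_congr_ae hpull).symm.trans (integral_condExp hm)
  rw [heq, integral_indicator hB] at h3
  exact ⟨h2.congr (Eventually.of_forall fun ω => mul_comm _ _), by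
    rw [← h3]; exact integral_congr_ae (Eventually.of_forall fun ω => mul_comm _ _)⟩

/-- `m`-measurable functions that agree a.s. on an event of positive conditional probability
given `m` agree a.s. -/
theorem ae_eq_of_ae_eq_restrict_of_condProb_pos (hm : m ≤ m₀) (hB : MeasurableSet B)
    (hpos : ∀ᵐ ω ∂P, 0 < condExp m P (B.indicator fun _ => (1 : ℝ)) ω) {f g : Ω → ℝ}
    (hf : StronglyMeasurable[m] f) (hg : StronglyMeasurable[m] g) (h : f =ᵐ[P.restrict B] g) :
    f =ᵐ[P] g := by
  set s : Set Ω := {ω | f ω = g ω}ᶜ with hs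
  have hsm : MeasurableSet[m] s := (hf.measurableSet_eq_fun hg).compl
  have hsm' : MeasurableSet s := hm _ hsm
  have hnull : P (s ∩ B) = 0 := by
    have := ae_iff.1 h
    rwa [show {a | ¬f a = g a} = s from rfl, Measure.restrict_apply hsm'] at this
  -- The integral of the conditional probability of B over s is P(s ∩ B) = 0, and a strictly
  -- positive integrand then forces s to be null.
  have hint : ∫ ω in s, condExp m P (B.indicator fun _ => (1 : ℝ)) ω ∂P = 0 := by
    rw [setIntegral_condExp hm ((integrable_const _).indicator hB) hsm,
      setIntegral_indicator hB, setIntegral_measure_zero _ hnull]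
  have hz := (setIntegral_eq_zero_iff_of_nonneg_ae
    (ae_restrict_of_ae (hpos.mono fun ω hω => hω.le)) integrable_condExp.integrableOn).1 hint
  have hfalse : ∀ᵐ ω ∂(P.restrict s), False := by
    filter_upwards [hz, ae_restrict_of_ae hpos] with ω h1 h2
    exact h2.ne' h1
  have hs0 : P s = 0 := by
    have := ae_iff.1 hfalse
    simpa using this
  exact ae_iff.2 hs0

end Conditioning

section CondIndep

variable {Ω α β γ : Type*} {m₀ : MeasurableSpace Ω} [StandardBorelSpace Ω] {P : Measure Ω}
  [IsFiniteMeasure P] [MeasurableSpace α] [MeasurableSpace β] [MeasurableSpace γ]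

/-- Under conditional independence of `f` and `V` given `U`, conditioning `f` on `(V, U)` is the
same as conditioning it on `U`. -/
theorem condExp_prodMk_of_condIndepFun {f : Ω → γ} {V : Ω → α} {U : Ω → β} (hf : Measurable f)
    (hV : Measurable V) (hU : Measurable U)
    (hci : CondIndepFun (MeasurableSpace.comap U inferInstance) hU.comap_le f V P) {A : Set γ}
    (hA : MeasurableSet A) :
    condExp (MeasurableSpace.comap U inferInstance) P ((f ⁻¹' A).indicator fun _ => (1 : ℝ))
      =ᵐ[P] condExp (MeasurableSpace.comap (fun ω => (V ω, U ω)) inferInstance) P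
        ((f ⁻¹' A).indicator fun _ => (1 : ℝ)) := by
  set r := condExp (MeasurableSpace.comap U inferInstance) P ((f ⁻¹' A).indicator fun _ => (1 : ℝ)) with hr
  have hVU : Measurable fun ω => (V ω, U ω) := hV.prodMk hU
  have hS : MeasurableSet (f ⁻¹' A) := hf hA
  have hSi : Integrable ((f ⁻¹' A).indicator fun _ => (1 : ℝ)) P := (integrable_const _).indicator hS
  have hri : Integrable r P := integrable_condExp
  -- It suffices to test on rectangles, a π-system generating the product σ-algebra; complements and
  -- disjoint unions follow by additivity.
  have hmain : ∀ t : Set (α × β), MeasurableSet t →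
      ∫ ω in (fun ω => (V ω, U ω)) ⁻¹' t, r ω ∂P
        = ∫ ω in (fun ω => (V ω, U ω)) ⁻¹' t, (f ⁻¹' A).indicator (fun _ => (1 : ℝ)) ω ∂P := by
    intro t ht
    induction t, ht using MeasurableSpace.induction_on_inter generateFrom_prod.symm
      isPiSystem_prod with
    | empty => simp
    | basic t ht =>
      obtain ⟨a, ha, b, hb, rfl⟩ := ht
      have hVa : MeasurableSet (V ⁻¹' a) := hV ha
      have hpre : (fun ω => (V ω, U ω)) ⁻¹' (a ×ˢ b) = U ⁻¹' b ∩ V ⁻¹' a := by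
        ext ω
        simp [and_comm]
      have hUb : MeasurableSet[MeasurableSpace.comap U inferInstance] (U ⁻¹' b) := ⟨b, hb, rfl⟩
      have hri' : Integrable (fun ω => r ω * (V ⁻¹' a).indicator (fun _ => (1 : ℝ)) ω) P := by
        refine (hri.indicator hVa).congr (Eventually.of_forall fun ω => ?_)
        by_cases hω : ω ∈ V ⁻¹' a <;> simp [hω]
      -- Pulling the U-measurable r out of the conditional expectation given U leaves the product of
      -- the two conditional probabilities, which conditional independence identifies with that of
      -- the intersection.
      have hpull : condExp (MeasurableSpace.comap U inferInstance) P (fun ω => r ω * (V ⁻¹' a).indicator (fun _ => (1 : ℝ)) ω)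
          =ᵐ[P] fun ω => r ω * condExp (MeasurableSpace.comap U inferInstance) P ((V ⁻¹' a).indicator fun _ => (1 : ℝ)) ω :=
        condExp_mul_of_stronglyMeasurable_left stronglyMeasurable_condExp hri'
          ((integrable_const _).indicator hVa)
      have hind := (condIndepFun_iff_condExp_inter_preimage_eq_mul hf hV).1 hci A a hA ha
      have hae := hpull.trans hind.symm
      calc ∫ ω in (fun ω => (V ω, U ω)) ⁻¹' (a ×ˢ b), r ω ∂P
          = ∫ ω in U ⁻¹' b, r ω * (V ⁻¹' a).indicator (fun _ => (1 : ℝ)) ω ∂P := by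
            rw [hpre, ← setIntegral_indicator hVa]
            refine integral_congr_ae (Eventually.of_forall fun ω => ?_)
            by_cases hω : ω ∈ V ⁻¹' a <;> simp [hω]
        _ = ∫ ω in U ⁻¹' b, (condExp (MeasurableSpace.comap U inferInstance) P
              (fun ω => r ω * (V ⁻¹' a).indicator (fun _ => (1 : ℝ)) ω)) ω ∂P :=
            (setIntegral_condExp hU.comap_le hri' hUb).symm
        _ = ∫ ω in U ⁻¹' b, (condExp (MeasurableSpace.comap U inferInstance) P
              ((f ⁻¹' A ∩ V ⁻¹' a).indicator fun _ => (1 : ℝ))) ω ∂P :=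
            integral_congr_ae (ae_restrict_of_ae hae)
        _ = ∫ ω in U ⁻¹' b, (f ⁻¹' A ∩ V ⁻¹' a).indicator (fun _ => (1 : ℝ)) ω ∂P :=
            setIntegral_condExp hU.comap_le ((integrable_const _).indicator (hS.inter hVa)) hUb
        _ = _ := by
            rw [hpre, ← setIntegral_indicator hVa]
            refine integral_congr_ae (Eventually.of_forall fun ω => ?_)
            by_cases hω : ω ∈ V ⁻¹' a <;> by_cases hω' : ω ∈ f ⁻¹' A <;> simp_all
    | compl t ht ih =>
      rw [Set.preimage_compl]
      have h1 := integral_add_compl (hVU ht) hri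
      have h2 := integral_add_compl (hVU ht) hSi
      have h3 : ∫ ω, r ω ∂P = ∫ ω, (f ⁻¹' A).indicator (fun _ => (1 : ℝ)) ω ∂P :=
        integral_condExp hU.comap_le
      linarith
    | iUnion s hsd hsm ih =>
      rw [Set.preimage_iUnion]
      have hd : Pairwise (Function.onFun Disjoint fun i => (fun ω => (V ω, U ω)) ⁻¹' s i) :=
        hsd.mono fun _ _ h => h.preimage _
      rw [integral_iUnion (fun i => hVU (hsm i)) hd hri.integrableOn,
        integral_iUnion (fun i => hVU (hsm i)) hd hSi.integrableOn]
      exact tsum_congr ih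
  refine ae_eq_condExp_of_forall_setIntegral_eq hVU.comap_le hSi (fun s _ _ => hri.integrableOn)
    (fun s hs _ => ?_) ?_
  · obtain ⟨t, ht, rfl⟩ := hs
    exact hmain t ht
  · have hle : MeasurableSpace.comap U inferInstance
        ≤ MeasurableSpace.comap (fun ω => (V ω, U ω)) inferInstance := by
      rintro _ ⟨t, ht, rfl⟩
      exact ⟨Prod.snd ⁻¹' t, measurable_snd ht, rfl⟩
    exact (stronglyMeasurable_condExp.mono hle).aestronglyMeasurable

end CondIndep

/-! ### Identification -/

namespace MissingDID

namespace Population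

variable {Ω₀ : Type*} [MeasurableSpace Ω₀] {k : ℕ} (pop : Population Ω₀ k)

theorem measurable_D : Measurable pop.D := pop.measurable_D1.prodMk pop.measurable_D2

theorem measurable_outcome {Y : Path → Ω₀ → ℝ} (hY : ∀ c, Measurable (Y c)) :
    Measurable fun ω => Y (pop.D ω) ω :=
  (measurable_from_prod_countable_right (f := fun z : Path × Ω₀ => Y z.1 z.2) hY).comp
    (pop.measurable_D.prodMk measurable_id)

theorem measurable_dY : Measurable pop.dY :=
  (pop.measurable_outcome pop.measurable_Y2).sub (pop.measurable_outcome pop.measurable_Y0)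

theorem measurable_obs : Measurable pop.obs := by
  refine (pop.measurable_outcome pop.measurable_Y0).prodMk
    ((pop.measurable_outcome pop.measurable_Y2).prodMk (pop.measurable_S.prodMk
      (Measurable.prodMk ?_ (pop.measurable_D2.prodMk pop.measurable_X))))
  exact (Measurable.of_discrete (f := fun a : Bool × Bool => a.1 && a.2)).comp
    (pop.measurable_S.prodMk pop.measurable_D1)

theorem sigX_le : pop.sigX ≤ ‹MeasurableSpace Ω₀› := pop.measurable_X.comap_le

/-- The σ-algebra generated by `(D₁, ΔY, D₂, X)`. -/
abbrev sigFull : MeasurableSpace Ω₀ :=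
  MeasurableSpace.comap (fun ω => ((pop.D1 ω, pop.dY ω), (pop.D2 ω, pop.X ω))) inferInstance

theorem measurable_full :
    Measurable fun ω => ((pop.D1 ω, pop.dY ω), (pop.D2 ω, pop.X ω)) :=
  (pop.measurable_D1.prodMk pop.measurable_dY).prodMk (pop.measurable_D2.prodMk pop.measurable_X)

theorem sigFull_le : pop.sigFull ≤ ‹MeasurableSpace Ω₀› := pop.measurable_full.comap_le

theorem sigX_le_sigFull : pop.sigX ≤ pop.sigFull := by
  rintro _ ⟨t, ht, rfl⟩
  exact ⟨(fun z => z.2.2) ⁻¹' t, (measurable_snd.comp measurable_snd) ht, rfl⟩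

/-- The event `D = c`. -/
def evD (c : Path) : Set Ω₀ := {ω | pop.D ω = c}

/-- The event `D₂ = e`. -/
def evD2 (e : Bool) : Set Ω₀ := {ω | pop.D2 ω = e}

theorem measurableSet_evD_sigFull (c : Path) : MeasurableSet[pop.sigFull] (pop.evD c) :=
  ⟨{z | (z.1.1, z.2.1) = c}, (Measurable.prodMk (by fun_prop) (by fun_prop) :
    Measurable fun z : (Bool × ℝ) × (Bool × Vec k) => (z.1.1, z.2.1)) (measurableSet_singleton c),
    rfl⟩

theorem measurableSet_evD2_sigFull (e : Bool) : MeasurableSet[pop.sigFull] (pop.evD2 e) :=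
  ⟨{z | z.2.1 = e}, (by fun_prop :
    Measurable fun z : (Bool × ℝ) × (Bool × Vec k) => z.2.1) (measurableSet_singleton e), rfl⟩

theorem measurableSet_evD (c : Path) : MeasurableSet (pop.evD c) :=
  pop.sigFull_le _ (pop.measurableSet_evD_sigFull c)

theorem measurableSet_evD2 (e : Bool) : MeasurableSet (pop.evD2 e) :=
  pop.sigFull_le _ (pop.measurableSet_evD2_sigFull e)

theorem evD_subset_evD2 (c : Path) : pop.evD c ⊆ pop.evD2 c.2 := fun _ hω =>
  congrArg Prod.snd hω

theorem stronglyMeasurable_dY_sigFull : StronglyMeasurable[pop.sigFull] pop.dY :=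
  ((by fun_prop : Measurable fun z : (Bool × ℝ) × (Bool × Vec k) => z.1.2).comp
    (comap_measurable _)).stronglyMeasurable

theorem stronglyMeasurable_comp_X {f : Vec k → ℝ} (hf : Measurable f) :
    StronglyMeasurable[pop.sigX] fun ω => f (pop.X ω) :=
  (hf.comp (comap_measurable pop.X)).stronglyMeasurable

variable (P : Measure Ω₀)

theorem p_eq (c : Path) :
    pop.p P c = condExp pop.sigX P ((pop.evD c).indicator fun _ => (1 : ℝ)) := by
  unfold p
  congr 1
  funext ω
  by_cases h : pop.D ω = c <;> simp [ind, evD, h]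

theorem givenD_eq (c : Path) : pop.givenD P c = ProbabilityTheory.cond P (pop.evD c) := rfl

theorem givenD2_eq (e : Bool) : pop.givenD2 P e = ProbabilityTheory.cond P (pop.evD2 e) := rfl

/-- The trend `𝔼[Y₂(0,0) - Y₀(0,0) | X]` of the untreated outcome. -/
noncomputable def trend : Ω₀ → ℝ :=
  condExp pop.sigX P (fun ω => pop.Y2 baseline ω - pop.Y0 baseline ω)

variable {pop P} [IsProbabilityMeasure P]

/-- Tower property under D₂ = d₂: against functions of X, the conditional propensity score may
replace the indicator of D₁ = d₁. -/
theorem setIntegral_pC {d : Path} {h : Ω₀ → ℝ} (hh : StronglyMeasurable[pop.sigX] h)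
    (hint : IntegrableOn h (pop.evD d) P) :
    ∫ ω in pop.evD2 d.2, h ω * pop.pC P d ω ∂P = ∫ ω in pop.evD d, h ω ∂P := by
  set B : Set Ω₀ := {ω | pop.D1 ω = d.1} with hB
  have hBm : MeasurableSet B := pop.measurable_D1 (measurableSet_singleton d.1)
  have hind : (fun ω => ind (decide (pop.D1 ω = d.1))) = B.indicator fun _ => (1 : ℝ) := by
    funext ω
    by_cases h : pop.D1 ω = d.1 <;> simp [ind, hB, h]
  have hinter : pop.evD2 d.2 ∩ B = pop.evD d := by
    ext ω
    simp [evD, evD2, hB, D, Prod.ext_iff, and_comm]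
  have hprod : (fun ω => h ω * B.indicator (fun _ => (1 : ℝ)) ω) = B.indicator h := by
    funext ω
    by_cases hω : ω ∈ B <;> simp [hω]
  have hYi : Integrable (B.indicator fun _ => (1 : ℝ)) P := (integrable_const _).indicator hBm
  have key := setIntegral_mul_condExp_cond (B := pop.evD2 d.2) pop.sigX_le hYi hh (by
    rw [hprod, IntegrableOn, integrable_indicator_iff hBm, IntegrableOn,
      Measure.restrict_restrict hBm, Set.inter_comm, hinter]
    exact hint)
  rw [pC, hind, givenD2_eq, key.2, hprod, setIntegral_indicator hBm, hinter]

/-- Replacing `ΔY` by a version of its conditional mean given `D = c` and `X`. -/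
theorem setIntegral_mul_dY_sub {c : Path} (hY : Integrable pop.dY P) {v μ h : Ω₀ → ℝ}
    (hv : StronglyMeasurable[pop.sigX] v) (hvi : Integrable v P)
    (hμ : pop.m P c =ᵐ[P.restrict (pop.evD c)] μ) (hh : StronglyMeasurable[pop.sigX] h)
    (hint : IntegrableOn (fun ω => h ω * (pop.dY ω - v ω)) (pop.evD c) P) :
    IntegrableOn (fun ω => h ω * (μ ω - v ω)) (pop.evD c) P ∧
      ∫ ω in pop.evD c, h ω * (μ ω - v ω) ∂P = ∫ ω in pop.evD c, h ω * (pop.dY ω - v ω) ∂P := by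
  by_cases hB : P (pop.evD c) = 0
  · have h0 : P.restrict (pop.evD c) = 0 := Measure.restrict_eq_zero.2 hB
    simp [IntegrableOn, h0]
  have := cond_isProbabilityMeasure hB
  have hYc : Integrable pop.dY (ProbabilityTheory.cond P (pop.evD c)) :=
    (integrable_cond_iff_integrableOn hB).2 hY.integrableOn
  have hvc : Integrable v (ProbabilityTheory.cond P (pop.evD c)) :=
    (integrable_cond_iff_integrableOn hB).2 hvi.integrableOn
  -- The conditional mean is taken of the difference because only h(ΔY - v) is known to be
  -- integrable, not hΔY and hv separately.
  have hce : condExp pop.sigX (ProbabilityTheory.cond P (pop.evD c))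
      (fun ω => pop.dY ω - v ω) =ᵐ[P.restrict (pop.evD c)] fun ω => μ ω - v ω := by
    rw [EventuallyEq, ← ae_cond_eq_ae_restrict] at hμ ⊢
    have h1 := condExp_sub hYc hvc pop.sigX
    rw [condExp_of_stronglyMeasurable pop.sigX_le hv hvc] at h1
    filter_upwards [h1, hμ] with ω h1 h2
    rw [← h2]
    exact h1
  obtain ⟨k1, k2⟩ := setIntegral_mul_condExp_cond (B := pop.evD c) pop.sigX_le (hY.sub hvi) hh hint
  have hcongr : (fun ω => h ω * condExp pop.sigX (ProbabilityTheory.cond P (pop.evD c))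
      (pop.dY - v) ω) =ᵐ[P.restrict (pop.evD c)] fun ω => h ω * (μ ω - v ω) := by
    filter_upwards [hce] with ω hω
    exact congrArg (h ω * ·) hω
  exact ⟨Integrable.congr k1 hcongr, (integral_congr_ae hcongr).symm.trans k2⟩

section Missing

variable [StandardBorelSpace Ω₀]

omit [StandardBorelSpace Ω₀] in
-- Conditioning on X under the law given D₂ = e agrees, on that event, with conditioning on (D₂, X)
-- under P. This links q to the σ-algebra in which missingness at random is stated.
theorem q_ae_eq (e : Bool) : pop.q P e =ᵐ[P.restrict (pop.evD2 e)]
    condExp pop.sigD2X P (fun ω => ind (pop.S ω)) := by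
  by_cases hC : P (pop.evD2 e) = 0
  · have h0 : P.restrict (pop.evD2 e) = 0 := Measure.restrict_eq_zero.2 hC
    simp [h0, EventuallyEq]
  have := cond_isProbabilityMeasure hC
  have hSm : Measurable fun ω => ind (pop.S ω) := measurable_ind_comp pop.measurable_S
  have hSi : Integrable (fun ω => ind (pop.S ω)) P :=
    Integrable.of_bound (C := 1) hSm.aestronglyMeasurable
      (Eventually.of_forall fun ω => by cases pop.S ω <;> simp [ind])
  set r := condExp pop.sigD2X P (fun ω => ind (pop.S ω)) with hr
  have hri : Integrable r P := integrable_condExp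
  -- By the Doob-Dynkin lemma r is a function of (D₂, X). Freezing the first argument at e makes it
  -- a function of X alone without changing it on D₂ = e.
  obtain ⟨ρ, hρ, hrρ⟩ := (stronglyMeasurable_condExp :
    StronglyMeasurable[pop.sigD2X] r).exists_eq_measurable_comp
  set g : Ω₀ → ℝ := fun ω => ρ (e, pop.X ω) with hg
  have hgr : ∀ ω ∈ pop.evD2 e, g ω = r ω := fun ω hω => by
    have hω' : pop.D2 ω = e := hω
    rw [show r = _ from hrρ, hg, ← hω']
    rfl
  have hgm : StronglyMeasurable[pop.sigX] g :=
    pop.stronglyMeasurable_comp_X (hρ.measurable.comp (measurable_const.prodMk measurable_id))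
  have hgi : Integrable g (ProbabilityTheory.cond P (pop.evD2 e)) :=
    (integrable_cond_iff_integrableOn hC).2
      (hri.integrableOn.congr_fun (fun ω hω => (hgr ω hω).symm) (pop.measurableSet_evD2 e))
  have key := ae_eq_condExp_of_forall_setIntegral_eq pop.sigX_le
    ((integrable_cond_iff_integrableOn hC).2 hSi.integrableOn)
    (fun s _ _ => hgi.integrableOn) (fun s hs _ => ?_) hgm.aestronglyMeasurable
  · have k2 : g =ᵐ[P.restrict (pop.evD2 e)] pop.q P e := by
      rw [EventuallyEq, ← ae_cond_eq_ae_restrict]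
      exact key
    filter_upwards [k2, ae_restrict_mem (pop.measurableSet_evD2 e)] with ω h1 h2
    rw [← h1, hgr ω h2]
  · have hs' := pop.sigX_le _ hs
    rw [← integral_indicator hs', ← integral_indicator hs', integral_cond_eq, integral_cond_eq]
    congr 1
    rw [setIntegral_indicator hs', setIntegral_indicator hs']
    have hCs : MeasurableSet[pop.sigD2X] (pop.evD2 e ∩ s) := by
      obtain ⟨t, ht, rfl⟩ := hs
      exact ⟨{z | z.1 = e} ∩ Prod.snd ⁻¹' t, (measurable_fst (measurableSet_singleton e)).inter
        (measurable_snd ht), rfl⟩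
    rw [setIntegral_congr_fun (g := r) (pop.sigD2X_le _ hCs) fun ω hω => hgr ω hω.1]
    exact setIntegral_condExp pop.sigD2X_le hSi hCs

/-- Under missingness at random, the observation indicator can be replaced by its conditional
probability `q`. -/
theorem setIntegral_observed (hMAR : MissingAssumptions pop P) {e : Bool} {B : Set Ω₀}
    (hB : MeasurableSet[pop.sigFull] B) (hBe : B ⊆ pop.evD2 e) {g : Ω₀ → ℝ}
    (hg : StronglyMeasurable[pop.sigFull] g)
    (hint : IntegrableOn (fun ω => ind (pop.S ω) * g ω) B P) :
    IntegrableOn (fun ω => pop.q P e ω * g ω) B P ∧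
      ∫ ω in B, ind (pop.S ω) * g ω ∂P = ∫ ω in B, pop.q P e ω * g ω ∂P := by
  have hB' := pop.sigFull_le _ hB
  have hSeq : (fun ω => ind (pop.S ω)) = (pop.S ⁻¹' {true}).indicator fun _ => (1 : ℝ) := by
    funext ω
    cases h : pop.S ω <;> simp [ind, h]
  have hSi : Integrable (fun ω => ind (pop.S ω)) P := by
    rw [hSeq]
    exact (integrable_const _).indicator (pop.measurable_S (measurableSet_singleton _))
  -- Missingness at random lets the conditioning be enlarged to (D₁, ΔY, D₂, X), in which g and the
  -- indicator of B are measurable and can be pulled out.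
  have hfull : condExp pop.sigD2X P (fun ω => ind (pop.S ω)) =ᵐ[P]
      condExp pop.sigFull P (fun ω => ind (pop.S ω)) := by
    rw [hSeq]
    exact condExp_prodMk_of_condIndepFun pop.measurable_S
      (pop.measurable_D1.prodMk pop.measurable_dY) (pop.measurable_D2.prodMk pop.measurable_X)
      hMAR.missing_at_random (measurableSet_singleton true)
  have hprod : (fun ω => B.indicator g ω * ind (pop.S ω))
      = B.indicator fun ω => ind (pop.S ω) * g ω := by
    funext ω
    by_cases hω : ω ∈ B <;> simp [hω, mul_comm]
  have hpull : condExp pop.sigFull P (fun ω => B.indicator g ω * ind (pop.S ω))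
      =ᵐ[P] fun ω => B.indicator g ω * condExp pop.sigFull P (fun ω => ind (pop.S ω)) ω :=
    condExp_mul_of_stronglyMeasurable_left (hg.indicator hB)
      (by
        change Integrable (fun ω => B.indicator g ω * ind (pop.S ω)) P
        rw [hprod]
        exact (integrable_indicator_iff hB').2 hint) hSi
  have hq : ∀ᵐ ω ∂P, ω ∈ B → pop.q P e ω = condExp pop.sigD2X P (fun ω => ind (pop.S ω)) ω := by
    filter_upwards [(ae_restrict_iff' (pop.measurableSet_evD2 e)).1 (q_ae_eq (P := P) e)] with ω h hω
    exact h (hBe hω)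
  have hall : condExp pop.sigFull P (fun ω => B.indicator g ω * ind (pop.S ω))
      =ᵐ[P] B.indicator fun ω => pop.q P e ω * g ω := by
    filter_upwards [hpull, hfull, hq] with ω h1 h2 h3
    rw [h1, ← h2]
    by_cases hω : ω ∈ B
    · simp [hω, h3 hω, mul_comm]
    · simp [hω]
  refine ⟨(integrable_indicator_iff hB').1 (integrable_condExp.congr hall), ?_⟩
  rw [← integral_indicator hB', ← integral_indicator hB', ← hprod,
    ← integral_condExp pop.sigFull_le, integral_congr_ae hall]

end Missing

section DID

variable (hDID : DIDAssumptions pop P)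

include hDID

omit [IsProbabilityMeasure P] hDID in
theorem integrable_outcome {Y : Path → Ω₀ → ℝ} (hYm : ∀ c, Measurable (Y c))
    (hY : ∀ c, Integrable (Y c) P) : Integrable (fun ω => Y (pop.D ω) ω) P := by
  refine Integrable.mono' (g := fun ω => ∑ c, |Y c ω|)
    (integrable_finsetSum _ fun c _ => (hY c).abs)
    (pop.measurable_outcome hYm).aestronglyMeasurable (Eventually.of_forall fun ω => ?_)
  exact Finset.single_le_sum (f := fun c => |Y c ω|) (fun c _ => abs_nonneg _)
    (Finset.mem_univ (pop.D ω))

omit [IsProbabilityMeasure P] in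
theorem integrable_dY : Integrable pop.dY P :=
  (integrable_outcome pop.measurable_Y2 hDID.integrable_Y2).sub
    (integrable_outcome pop.measurable_Y0 hDID.integrable_Y0)

omit [IsProbabilityMeasure P] in
-- Under D = (0,0) the observed change is the untreated change, so parallel trends for that path
-- applies directly.
theorem m_baseline_ae_eq [IsFiniteMeasure P] :
    pop.m P baseline =ᵐ[P.restrict (pop.evD baseline)] pop.trend P := by
  rw [EventuallyEq, ← ae_cond_eq_ae_restrict]
  have h1 : pop.dY =ᵐ[pop.givenD P baseline]
      fun ω => pop.Y2 baseline ω - pop.Y0 baseline ω := by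
    rw [givenD_eq, EventuallyEq, ae_cond_eq_ae_restrict]
    filter_upwards [ae_restrict_mem (pop.measurableSet_evD baseline)] with ω hω
    rw [dY, show pop.D ω = baseline from hω]
  exact (condExp_congr_ae h1).trans (hDID.parallel_trends baseline)

/-- Given D = d, no anticipation replaces the mean of Y₀(d) by that of Y₀(0,0), and parallel trends
gives the trend the mean of Y₂(0,0) - Y₀(0,0). The Y₀(0,0) terms cancel. -/
theorem patt_eq (d : Path) : pop.patt P d
    = (P.real (pop.evD d))⁻¹ * ∫ ω in pop.evD d, (pop.dY ω - pop.trend P ω) ∂P := by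
  by_cases hB : P (pop.evD d) = 0
  · have h0 : P.restrict (pop.evD d) = 0 := Measure.restrict_eq_zero.2 hB
    rw [patt, givenD_eq, integral_cond_eq, h0]
    simp
  have := cond_isProbabilityMeasure hB
  have hi : ∀ {f : Ω₀ → ℝ}, Integrable f P → Integrable f (pop.givenD P d) := fun hf =>
    (integrable_cond_iff_integrableOn hB).2 hf.integrableOn
  have iY0 := hi (hDID.integrable_Y0 d)
  have iY2 := hi (hDID.integrable_Y2 d)
  have iZ0 := hi (hDID.integrable_Y0 baseline)
  have iZ2 := hi (hDID.integrable_Y2 baseline)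
  have idY := hi (integrable_dY hDID)
  have itr : Integrable (pop.trend P) (pop.givenD P d) := hi integrable_condExp
  have e1 : ∫ ω, pop.Y0 d ω ∂(pop.givenD P d) = ∫ ω, pop.Y0 baseline ω ∂(pop.givenD P d) := by
    have h := integral_congr_ae (hDID.no_anticipation d)
    rwa [givenD_eq, integral_condExp pop.sigX_le, integral_condExp pop.sigX_le] at h
  have e2 : ∫ ω, (pop.Y2 baseline ω - pop.Y0 baseline ω) ∂(pop.givenD P d)
      = ∫ ω, pop.trend P ω ∂(pop.givenD P d) := by
    have h := integral_congr_ae (hDID.parallel_trends d)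
    rwa [givenD_eq, integral_condExp pop.sigX_le] at h
  have e3 : ∫ ω, pop.dY ω ∂(pop.givenD P d)
      = ∫ ω, (pop.Y2 d ω - pop.Y0 d ω) ∂(pop.givenD P d) := by
    refine integral_congr_ae ?_
    rw [givenD_eq, EventuallyEq, ae_cond_eq_ae_restrict]
    filter_upwards [ae_restrict_mem (pop.measurableSet_evD d)] with ω hω
    rw [dY, show pop.D ω = d from hω]
  rw [← integral_cond_eq, ← givenD_eq, patt, integral_sub iY2 iZ2, integral_sub idY itr, e3, ← e2,
    integral_sub iY2 iY0, integral_sub iZ2 iZ0, e1]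
  ring

end DID

end Population

end MissingDID

/-! ### Population moments of the four weights -/

namespace MissingDID

theorem RegularModel.measurable_left {k r : ℕ} {PX : Measure (Vec k)} {f : Vec k → Vec r → ℝ}
    {K : Set (Vec r)} {t : Vec r} (h : RegularModel PX f K t) : Measurable fun x => f x t :=
  h.measurable.comp (measurable_id.prodMk measurable_const)

theorem RegularModel.integrable {k r : ℕ} {PX : Measure (Vec k)} {f : Vec k → Vec r → ℝ}
    {K : Set (Vec r)} {t : Vec r} (h : RegularModel PX f K t) : Integrable (fun x => f x t) PX :=
  ⟨h.measurable_left.aestronglyMeasurable, (lintegral_mono fun x =>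
    le_iSup₂ (f := fun θ (_ : θ ∈ K) => ‖f x θ‖ₑ) t (interior_subset h.mem_interior)).trans_lt
      h.envelope⟩

namespace Population

section Estimand

variable {Ω₀ : Type*} [MeasurableSpace Ω₀] {k nb nc nm nd : ℕ} (pop : Population Ω₀ k)
  (P : Measure Ω₀) (M : Models k nb nc nm nd) (d : Path) (θ : Params nb nc nm nd)

/-- The ratio of the observation probability to its working model. -/
noncomputable def obsRatio (e : Bool) (ω : Ω₀) : ℝ := pop.q P e ω / M.phi e (pop.X ω) (θ.de e)

/-- The ratio `π_d / π_{d'}` of the propensity score models. -/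
noncomputable def oddsModel (ω : Ω₀) : ℝ :=
  (M.piC d (pop.X ω) (θ.gc d) * M.piM d.2 (pop.X ω) (θ.gm d.2))
    / (M.piC baseline (pop.X ω) (θ.gc baseline)
      * M.piM baseline.2 (pop.X ω) (θ.gm baseline.2))

/-- The outcome model at the covariates. -/
def muModel (c : Path) (ω : Ω₀) : ℝ := M.mu c (pop.X ω) (θ.be c)

variable {pop P M d θ} [IsProbabilityMeasure P] {KB : Path → Set (Vec nb)}
  {KC : Path → Set (Vec nc)} {KM : Bool → Set (Vec nm)} {KD : Bool → Set (Vec nd)}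
  (hreg : Regularity M d (pop.law P) (pop.lawX P) KB KC KM KD θ)

include hreg

omit [IsProbabilityMeasure P] in
theorem stronglyMeasurable_muModel {c : Path} (hc : c ∈ ({d, baseline} : Set Path)) :
    StronglyMeasurable[pop.sigX] (pop.muModel M θ c) :=
  pop.stronglyMeasurable_comp_X (hreg.mu c hc).measurable_left

omit [IsProbabilityMeasure P] in
theorem integrable_muModel {c : Path} (hc : c ∈ ({d, baseline} : Set Path)) :
    Integrable (pop.muModel M θ c) P :=
  (hreg.mu c hc).integrable.comp_measurable pop.measurable_X

omit [IsProbabilityMeasure P] in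
theorem stronglyMeasurable_oddsModel : StronglyMeasurable[pop.sigX] (pop.oddsModel M d θ) :=
  pop.stronglyMeasurable_comp_X
    (((hreg.piC d (by simp)).measurable_left.mul (hreg.piM d.2 (by simp)).measurable_left).div
      ((hreg.piC baseline (by simp)).measurable_left.mul
        (hreg.piM baseline.2 (by simp)).measurable_left))

omit [IsProbabilityMeasure P] in
theorem stronglyMeasurable_inv_phi {e : Bool} (he : e ∈ ({d.2, baseline.2} : Set Bool)) :
    StronglyMeasurable[pop.sigX] fun ω => (M.phi e (pop.X ω) (θ.de e))⁻¹ :=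
  pop.stronglyMeasurable_comp_X (hreg.phi e he).measurable_left.inv

omit [IsProbabilityMeasure P] in
theorem stronglyMeasurable_obsRatio {e : Bool} (he : e ∈ ({d.2, baseline.2} : Set Bool)) :
    StronglyMeasurable[pop.sigX] (pop.obsRatio P M θ e) := by
  have : pop.obsRatio P M θ e = fun ω => pop.q P e ω * (M.phi e (pop.X ω) (θ.de e))⁻¹ := by
    funext ω
    rw [obsRatio, div_eq_mul_inv]
  rw [this]
  exact (stronglyMeasurable_condExp : StronglyMeasurable[pop.sigX] (pop.q P e)).mul
    (stronglyMeasurable_inv_phi hreg he)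

omit [IsProbabilityMeasure P] in
theorem obsRatio_ae_eq_one (hM : MissingCorrect pop P M d θ) [IsFiniteMeasure P] {e : Bool}
    (he : e ∈ ({d.2, baseline.2} : Set Bool)) {B : Set Ω₀} (hB : B ⊆ pop.evD2 e) :
    ∀ᵐ ω ∂P.restrict B, pop.obsRatio P M θ e ω = 1 := by
  have h1 := hM e he
  rw [givenD2_eq, EventuallyEq, ae_cond_eq_ae_restrict] at h1
  have h2 := ae_restrict_of_ae (s := B) (ae_of_ae_map pop.measurable_X.aemeasurable
    (hreg.phi_pos e he))
  filter_upwards [ae_restrict_of_ae_restrict_of_subset hB h1, h2] with ω h1 h2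
  rw [obsRatio, ← h1]
  exact div_self (h2 _ (interior_subset (hreg.phi e he).mem_interior)).ne'

omit [IsProbabilityMeasure P] hreg in
theorem oddsModel_ae_eq (hC : PropensityCorrect pop P M d θ) :
    pop.oddsModel M d θ =ᵐ[P] fun ω => pop.p P d ω / pop.p P baseline ω := by
  filter_upwards [hC d (by simp), hC baseline (by simp)] with ω h1 h2
  rw [oddsModel, ← h1, ← h2]

section Terms

variable [StandardBorelSpace Ω₀] (hMAR : MissingAssumptions pop P)

omit hreg in
include hMAR in
-- The common form of the weights containing S: a quantity S·g supported in an event within D₂ = e,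
-- whose expectation is that of q_e·g.
theorem integral_law_observed {F : Obs k → ℝ} (hF : Integrable F (pop.law P)) {e : Bool}
    {B : Set Ω₀} (hB : MeasurableSet[pop.sigFull] B) (hBe : B ⊆ pop.evD2 e) {g : Ω₀ → ℝ}
    (hg : StronglyMeasurable[pop.sigFull] g)
    (hFB : ∀ ω, F (pop.obs ω) = B.indicator (fun ω => ind (pop.S ω) * g ω) ω) :
    IntegrableOn (fun ω => pop.q P e ω * g ω) B P ∧
      ∫ w, F w ∂pop.law P = ∫ ω in B, pop.q P e ω * g ω ∂P := by
  have hB' := pop.sigFull_le _ hB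
  have hFi : Integrable (fun ω => F (pop.obs ω)) P := hF.comp_measurable pop.measurable_obs
  rw [funext hFB, integrable_indicator_iff hB'] at hFi
  have key := setIntegral_observed hMAR hB hBe hg hFi
  refine ⟨key.1, ?_⟩
  rw [law, integral_map pop.measurable_obs.aemeasurable hF.aestronglyMeasurable, funext hFB,
    integral_indicator hB', key.2]

variable {ζ : Obs k → ℝ} (hζ : StronglyMeasurable[pop.sigFull] fun ω => ζ (pop.obs ω))

include hMAR hζ

/-- The free factor ζ is taken to be 1 for the denominator of the ratio and the residual for its
numerator. -/
theorem integral_num_zero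
    (hint : Integrable (fun w => num M d 0 θ w * ζ w) (pop.law P)) :
    IntegrableOn (fun ω => pop.obsRatio P M θ d.2 ω * ζ (pop.obs ω)) (pop.evD d) P ∧
      ∫ w, num M d 0 θ w * ζ w ∂pop.law P
        = ∫ ω in pop.evD d, pop.obsRatio P M θ d.2 ω * ζ (pop.obs ω) ∂P := by
  have key := integral_law_observed hMAR hint (pop.measurableSet_evD_sigFull d)
    (pop.evD_subset_evD2 d)
    (((stronglyMeasurable_inv_phi hreg (e := d.2) (by simp)).mono pop.sigX_le_sigFull).mul hζ) fun ω => by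
      change num1 M d (θ.de d.2) (pop.obs ω) * ζ (pop.obs ω) = _
      cases hS : pop.S ω
      · simp [num1, obs, Obs.s, ind, hS, Set.indicator]
      · by_cases h : pop.D ω = d
        · have h' : (pop.D1 ω, pop.D2 ω) = d := h
          simp [num1, obs, Obs.s, Obs.path, Obs.x, ind, hS, evD, h, h']
        · have h' : ¬ (pop.D1 ω, pop.D2 ω) = d := h
          simp [num1, obs, Obs.s, Obs.path, Obs.x, ind, hS, evD, h, h']
  have e : (fun ω => pop.q P d.2 ω * ((M.phi d.2 (pop.X ω) (θ.de d.2))⁻¹ * ζ (pop.obs ω)))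
      = fun ω => pop.obsRatio P M θ d.2 ω * ζ (pop.obs ω) := by
    funext ω
    rw [obsRatio]
    ring
  simpa only [Pi.mul_apply, e] using key

theorem integral_num_one
    (hint : Integrable (fun w => num M d 1 θ w * ζ w) (pop.law P)) :
    IntegrableOn (fun ω => pop.obsRatio P M θ baseline.2 ω * pop.oddsModel M d θ ω
        * ζ (pop.obs ω)) (pop.evD baseline) P ∧
      ∫ w, num M d 1 θ w * ζ w ∂pop.law P
        = ∫ ω in pop.evD baseline, pop.obsRatio P M θ baseline.2 ω * pop.oddsModel M d θ ω
            * ζ (pop.obs ω) ∂P := by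
  have key := integral_law_observed hMAR hint (pop.measurableSet_evD_sigFull baseline)
    (pop.evD_subset_evD2 baseline)
    ((((stronglyMeasurable_inv_phi hreg (e := baseline.2) (by simp)).mul
      (stronglyMeasurable_oddsModel hreg)).mono pop.sigX_le_sigFull).mul hζ) fun ω => by
      change num2 M d (θ.gc d) (θ.gm d.2) (θ.gc baseline) (θ.gm baseline.2) (θ.de baseline.2)
        (pop.obs ω) * ζ (pop.obs ω) = _
      -- A unit with S = 0 and D₂ = 0 records the path (0,0) whatever its D₁. The factor S removes
      -- it, and for S = 1 the recorded path is the true one.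
      cases hS : pop.S ω
      · simp [num2, obs, Obs.s, ind, hS, Set.indicator]
      · by_cases h : pop.D ω = baseline
        · have h' : (pop.D1 ω, pop.D2 ω) = baseline := h
          simp only [num2, oddsModel, obs, Obs.s, Obs.path, Obs.x, ind, hS, evD, h', Bool.true_and,
            decide_true, if_true, mul_one, Set.indicator, Set.mem_ofPred_eq, h, Pi.mul_apply,
            one_div, one_mul]
        · have h' : ¬ (pop.D1 ω, pop.D2 ω) = baseline := h
          simp [num2, obs, Obs.s, Obs.path, Obs.x, ind, hS, evD, h, h']
  have e : (fun ω => pop.q P baseline.2 ω * ((M.phi baseline.2 (pop.X ω) (θ.de baseline.2))⁻¹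
        * pop.oddsModel M d θ ω * ζ (pop.obs ω)))
      = fun ω => pop.obsRatio P M θ baseline.2 ω * pop.oddsModel M d θ ω * ζ (pop.obs ω) := by
    funext ω
    rw [obsRatio]
    ring
  simpa only [Pi.mul_apply, e] using key

omit hMAR hζ [StandardBorelSpace Ω₀] [IsProbabilityMeasure P] hreg in
theorem integral_num_two
    (hint : Integrable (fun w => num M d 2 θ w * ζ w) (pop.law P)) :
    ∫ w, num M d 2 θ w * ζ w ∂pop.law P
        = ∫ ω in pop.evD2 d.2, M.piC d (pop.X ω) (θ.gc d) * ζ (pop.obs ω) ∂P := by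
  rw [law, integral_map pop.measurable_obs.aemeasurable hint.aestronglyMeasurable,
    ← integral_indicator (pop.measurableSet_evD2 d.2)]
  congr 1
  funext ω
  change num3 M d (θ.gc d) (pop.obs ω) * ζ (pop.obs ω) = _
  by_cases h : pop.D2 ω = d.2 <;> simp [num3, obs, Obs.d2, Obs.x, ind, evD2, h]

theorem integral_num_three
    (hint : Integrable (fun w => num M d 3 θ w * ζ w) (pop.law P)) :
    ∫ w, num M d 3 θ w * ζ w ∂pop.law P
        = ∫ ω in pop.evD2 d.2, pop.obsRatio P M θ d.2 ω
            * (M.piC d (pop.X ω) (θ.gc d) * ζ (pop.obs ω)) ∂P := by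
  have key := integral_law_observed hMAR hint (pop.measurableSet_evD2_sigFull d.2) subset_rfl
    ((((stronglyMeasurable_inv_phi hreg (e := d.2) (by simp)).mul
      (pop.stronglyMeasurable_comp_X (hreg.piC d (by simp)).measurable_left)).mono
        pop.sigX_le_sigFull).mul hζ) fun ω => by
      change num4 M d (θ.gc d) (θ.de d.2) (pop.obs ω) * ζ (pop.obs ω) = _
      cases hS : pop.S ω
      · simp [num4, obs, Obs.s, ind, hS, Set.indicator]
      · by_cases h : pop.D2 ω = d.2 <;>
          simp [num4, obs, Obs.s, Obs.d2, Obs.x, ind, hS, evD2, h]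
  have e : (fun ω => pop.q P d.2 ω * ((M.phi d.2 (pop.X ω) (θ.de d.2))⁻¹
        * M.piC d (pop.X ω) (θ.gc d) * ζ (pop.obs ω)))
      = fun ω => pop.obsRatio P M θ d.2 ω * (M.piC d (pop.X ω) (θ.gc d) * ζ (pop.obs ω)) := by
    funext ω
    rw [obsRatio]
    ring
  simpa only [Pi.mul_apply, e] using key.2

end Terms

end Estimand

end Population

end MissingDID

/-! ### Multiple robustness of the estimand -/

namespace MissingDID

namespace Population

section Identification

variable {Ω₀ : Type*} [MeasurableSpace Ω₀] [StandardBorelSpace Ω₀] {k nb nc nm nd : ℕ}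
  {pop : Population Ω₀ k} {P : Measure Ω₀} [IsProbabilityMeasure P] {M : Models k nb nc nm nd}
  {d : Path} {θ : Params nb nc nm nd} {KB : Path → Set (Vec nb)}
  {KC : Path → Set (Vec nc)} {KM : Bool → Set (Vec nm)} {KD : Bool → Set (Vec nd)}

omit [StandardBorelSpace Ω₀] in
theorem integral_evD_eq_integral_pC {g : Ω₀ → ℝ} (hg : StronglyMeasurable[pop.sigX] g)
    (hint : IntegrableOn g (pop.evD d) P) (hC : CondPropensityCorrect pop P M d θ) :
    ∫ ω in pop.evD2 d.2, g ω * M.piC d (pop.X ω) (θ.gc d) ∂P = ∫ ω in pop.evD d, g ω ∂P := by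
  rw [← setIntegral_pC hg hint]
  refine integral_congr_ae ?_
  rw [CondPropensityCorrect, givenD2_eq, EventuallyEq, ae_cond_eq_ae_restrict] at hC
  filter_upwards [hC] with ω h
  rw [h]

omit [StandardBorelSpace Ω₀] in
theorem OutcomeCorrect.m_ae_eq (hO : OutcomeCorrect pop P M d θ) {c : Path}
    (hc : c ∈ ({d, baseline} : Set Path)) :
    pop.m P c =ᵐ[P.restrict (pop.evD c)] pop.muModel M θ c := by
  have h := hO c hc
  rw [givenD_eq, EventuallyEq, ae_cond_eq_ae_restrict] at h
  exact EventuallyEq.symm h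

omit [StandardBorelSpace Ω₀] in
-- The model is known to be correct only under D = d', whereas τ averages over D = d. Both sides are
-- functions of X, and p_{d'}(X) > 0 makes their equality hold almost surely.
theorem muModel_baseline_ae_eq_trend (hDID : DIDAssumptions pop P)
    (hreg : Regularity M d (pop.law P) (pop.lawX P) KB KC KM KD θ)
    (hO : OutcomeCorrect pop P M d θ) : pop.muModel M θ baseline =ᵐ[P] pop.trend P := by
  refine ae_eq_of_ae_eq_restrict_of_condProb_pos pop.sigX_le (pop.measurableSet_evD baseline) ?_
    (stronglyMeasurable_muModel hreg (by simp)) stronglyMeasurable_condExp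
    ((OutcomeCorrect.m_ae_eq hO (by simp)).symm.trans (m_baseline_ae_eq hDID))
  rw [← p_eq]
  exact hDID.overlap_baseline

omit [StandardBorelSpace Ω₀] in
/-- Reweighting by the odds `p_d / p_{d'}` transports integrals from `D = d'` to `D = d`. -/
theorem setIntegral_odds (hDID : DIDAssumptions pop P) {h : Ω₀ → ℝ}
    (hh : StronglyMeasurable[pop.sigX] h) (hi : IntegrableOn h (pop.evD d) P)
    (hint : IntegrableOn (fun ω => pop.p P d ω / pop.p P baseline ω * h ω) (pop.evD baseline) P) :
    ∫ ω in pop.evD baseline, pop.p P d ω / pop.p P baseline ω * h ω ∂P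
      = ∫ ω in pop.evD d, h ω ∂P := by
  have hp : ∀ c, StronglyMeasurable[pop.sigX] (pop.p P c) := fun c => stronglyMeasurable_condExp
  -- Restriction to D = d' is the weight p_{d'}(X) on functions of X. It cancels the denominator of
  -- the odds, which is positive, and leaves the weight p_d(X) of D = d.
  have k1 := (integral_condProb_mul pop.sigX_le (pop.measurableSet_evD baseline)
      (((hp d).div (hp baseline)).mul hh) hint).2
  have k2 := (integral_condProb_mul pop.sigX_le (pop.measurableSet_evD d) hh hi).2
  rw [← p_eq] at k1 k2
  refine k1.symm.trans (Eq.trans (integral_congr_ae ?_) k2)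
  filter_upwards [hDID.overlap_baseline] with ω hω
  simp only [Pi.mul_apply, Pi.div_apply]
  field_simp

variable (hDID : DIDAssumptions pop P) (hMAR : MissingAssumptions pop P)
  (hreg : Regularity M d (pop.law P) (pop.lawX P) KB KC KM KD θ)

include hreg

omit [StandardBorelSpace Ω₀] [IsProbabilityMeasure P] in
theorem stronglyMeasurable_resid_obs (j : Fin 4) :
    StronglyMeasurable[pop.sigFull] fun ω => resid M d j θ (pop.obs ω) := by
  have hμ : ∀ c ∈ ({d, baseline} : Set Path), StronglyMeasurable[pop.sigFull]
      (pop.muModel M θ c) := fun c hc =>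
    (stronglyMeasurable_muModel hreg hc).mono pop.sigX_le_sigFull
  have h0 := pop.stronglyMeasurable_dY_sigFull.sub (hμ baseline (by simp))
  have h1 := (hμ d (by simp)).sub (hμ baseline (by simp))
  fin_cases j
  exacts [h0, h0, h1, h1]

omit [StandardBorelSpace Ω₀] in
theorem integrable_num_mul_resid (j : Fin 4) :
    Integrable (fun w => num M d j θ w * resid M d j θ w) (pop.law P) := by
  have : IsProbabilityMeasure (pop.law P) :=
    Measure.isProbabilityMeasure_map pop.measurable_obs.aemeasurable
  exact (hreg.memLp_num_resid j).integrable (by norm_num)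

omit [StandardBorelSpace Ω₀] in
theorem integrable_num_mul_one (j : Fin 4) :
    Integrable (fun w => num M d j θ w * 1) (pop.law P) := by
  have : IsProbabilityMeasure (pop.law P) :=
    Measure.isProbabilityMeasure_map pop.measurable_obs.aemeasurable
  simpa only [mul_one] using (hreg.memLp_num j).integrable (by norm_num)

include hMAR

theorem first_term : (IntegrableOn (pop.obsRatio P M θ d.2) (pop.evD d) P ∧
      ∫ w, num M d 0 θ w ∂pop.law P = ∫ ω in pop.evD d, pop.obsRatio P M θ d.2 ω ∂P) ∧
    (IntegrableOn (fun ω => pop.obsRatio P M θ d.2 ω * (pop.dY ω - pop.muModel M θ baseline ω))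
        (pop.evD d) P ∧
      ∫ w, num M d 0 θ w * resid M d 0 θ w ∂pop.law P = ∫ ω in pop.evD d,
        pop.obsRatio P M θ d.2 ω * (pop.dY ω - pop.muModel M θ baseline ω) ∂P) := by
  have h1 := integral_num_zero hreg hMAR stronglyMeasurable_const (integrable_num_mul_one hreg 0)
  simp only [mul_one] at h1
  exact ⟨h1, integral_num_zero hreg hMAR (stronglyMeasurable_resid_obs hreg 0)
    (integrable_num_mul_resid hreg 0)⟩

theorem second_term : (IntegrableOn (fun ω => pop.obsRatio P M θ baseline.2 ω
        * pop.oddsModel M d θ ω) (pop.evD baseline) P ∧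
      ∫ w, num M d 1 θ w ∂pop.law P = ∫ ω in pop.evD baseline,
        pop.obsRatio P M θ baseline.2 ω * pop.oddsModel M d θ ω ∂P) ∧
    (IntegrableOn (fun ω => pop.obsRatio P M θ baseline.2 ω * pop.oddsModel M d θ ω
        * (pop.dY ω - pop.muModel M θ baseline ω)) (pop.evD baseline) P ∧
      ∫ w, num M d 1 θ w * resid M d 1 θ w ∂pop.law P = ∫ ω in pop.evD baseline,
        pop.obsRatio P M θ baseline.2 ω * pop.oddsModel M d θ ω
          * (pop.dY ω - pop.muModel M θ baseline ω) ∂P) := by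
  have h1 := integral_num_one hreg hMAR stronglyMeasurable_const (integrable_num_mul_one hreg 1)
  simp only [mul_one] at h1
  exact ⟨h1, integral_num_one hreg hMAR (stronglyMeasurable_resid_obs hreg 1)
    (integrable_num_mul_resid hreg 1)⟩

omit hMAR [StandardBorelSpace Ω₀] in
theorem third_term :
    ∫ w, num M d 2 θ w ∂pop.law P
        = ∫ ω in pop.evD2 d.2, M.piC d (pop.X ω) (θ.gc d) ∂P ∧
      ∫ w, num M d 2 θ w * resid M d 2 θ w ∂pop.law P
        = ∫ ω in pop.evD2 d.2, M.piC d (pop.X ω) (θ.gc d)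
            * (pop.muModel M θ d ω - pop.muModel M θ baseline ω) ∂P := by
  have h1 := integral_num_two (integrable_num_mul_one hreg 2)
  simp only [mul_one] at h1
  exact ⟨h1, integral_num_two (integrable_num_mul_resid hreg 2)⟩

theorem fourth_term :
    ∫ w, num M d 3 θ w ∂pop.law P = ∫ ω in pop.evD2 d.2,
        pop.obsRatio P M θ d.2 ω * M.piC d (pop.X ω) (θ.gc d) ∂P ∧
      ∫ w, num M d 3 θ w * resid M d 3 θ w ∂pop.law P
        = ∫ ω in pop.evD2 d.2, pop.obsRatio P M θ d.2 ω * (M.piC d (pop.X ω) (θ.gc d)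
            * (pop.muModel M θ d ω - pop.muModel M θ baseline ω)) ∂P := by
  have h1 := integral_num_three hreg hMAR stronglyMeasurable_const (integrable_num_mul_one hreg 3)
  simp only [mul_one] at h1
  exact ⟨h1, integral_num_three hreg hMAR (stronglyMeasurable_resid_obs hreg 3)
    (integrable_num_mul_resid hreg 3)⟩

omit hMAR [StandardBorelSpace Ω₀] in
theorem estimand_eq_ratios : estimand M d (pop.law P) θ
    = (∫ w, num M d 0 θ w * resid M d 0 θ w ∂pop.law P) / (∫ w, num M d 0 θ w ∂pop.law P)
      - (∫ w, num M d 1 θ w * resid M d 1 θ w ∂pop.law P) / (∫ w, num M d 1 θ w ∂pop.law P)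
      + (∫ w, num M d 2 θ w * resid M d 2 θ w ∂pop.law P) / (∫ w, num M d 2 θ w ∂pop.law P)
      - (∫ w, num M d 3 θ w * resid M d 3 θ w ∂pop.law P) / (∫ w, num M d 3 θ w ∂pop.law P) := by
  rw [estimand_eq_sum _ _ _ _ (integrable_num_mul_resid hreg), Fin.sum_univ_four]
  simp [sgn]
  ring

include hDID

/-- With a correct outcome model the reweighted residual under `D = d'` has mean zero. -/
theorem integral_second_eq_zero (hO : OutcomeCorrect pop P M d θ) :
    ∫ w, num M d 1 θ w * resid M d 1 θ w ∂pop.law P = 0 := by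
  obtain ⟨-, hi, he⟩ := second_term hMAR hreg
  refine he.trans ((setIntegral_mul_dY_sub (integrable_dY hDID)
    (stronglyMeasurable_muModel hreg (by simp)) (integrable_muModel hreg (by simp))
    (OutcomeCorrect.m_ae_eq hO (by simp)) ((stronglyMeasurable_obsRatio hreg (by simp)).mul
      (stronglyMeasurable_oddsModel hreg)) hi).2.symm.trans ?_)
  simp

/-- With correct propensity score and missingness models the reweighted residual under `D = d'`
has the mean of the error of the outcome model under `D = d`. -/
theorem integral_second_of_propensity (hM : MissingCorrect pop P M d θ)
    (hC : PropensityCorrect pop P M d θ) :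
    ∫ w, num M d 1 θ w ∂pop.law P = P.real (pop.evD d) ∧
      ∫ w, num M d 1 θ w * resid M d 1 θ w ∂pop.law P
        = ∫ ω in pop.evD d, (pop.trend P ω - pop.muModel M θ baseline ω) ∂P := by
  obtain ⟨⟨hi1, he1⟩, hi, he⟩ := second_term hMAR hreg
  have hκ := obsRatio_ae_eq_one hreg hM (e := baseline.2) (by simp) (pop.evD_subset_evD2 baseline)
  have hR := ae_restrict_of_ae (s := pop.evD baseline) (oddsModel_ae_eq hC)
  have htr : StronglyMeasurable[pop.sigX] (pop.trend P) := stronglyMeasurable_condExp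
  have hμ := stronglyMeasurable_muModel (c := baseline) hreg (by simp)
  have hμi := integrable_muModel (c := baseline) hreg (by simp)
  -- Under D = d' the conditional mean of ΔY is the trend by parallel trends, so no outcome model
  -- has to be correct here.
  obtain ⟨hi', he'⟩ := setIntegral_mul_dY_sub (integrable_dY hDID) hμ hμi (m_baseline_ae_eq hDID)
    ((stronglyMeasurable_obsRatio hreg (by simp)).mul (stronglyMeasurable_oddsModel hreg)) hi
  have hw : ∀ g : Ω₀ → ℝ, (fun ω => pop.obsRatio P M θ baseline.2 ω * pop.oddsModel M d θ ω * g ω)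
      =ᵐ[P.restrict (pop.evD baseline)]
      fun ω => pop.p P d ω / pop.p P baseline ω * g ω := fun g => by
    filter_upwards [hκ, hR] with ω h1 h2
    rw [h1, h2, one_mul]
  constructor
  · have e1 := hw fun _ => 1
    have := setIntegral_odds hDID (d := d) (h := fun _ => 1) stronglyMeasurable_const
      (integrable_const _).integrableOn (Integrable.congr (by simp only [mul_one]; exact hi1) e1)
    rw [he1, ← (by simpa using this : _ = P.real (pop.evD d))]
    exact integral_congr_ae (by simpa only [mul_one] using e1)
  · rw [he]
    refine he'.symm.trans ((integral_congr_ae (hw _)).trans ?_)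
    exact setIntegral_odds hDID (htr.sub hμ) (integrable_condExp.sub hμi).integrableOn
      (Integrable.congr hi' (hw _))

/-- Identification by double robustness with a correct model of missingness. -/
theorem estimand_eq_patt_of_missing (hM : MissingCorrect pop P M d θ)
    (h : PropensityCorrect pop P M d θ ∨ OutcomeCorrect pop P M d θ) :
    estimand M d (pop.law P) θ = pop.patt P d := by
  have hκ := obsRatio_ae_eq_one hreg hM (e := d.2) (by simp) (pop.evD_subset_evD2 d)
  have hκ2 := obsRatio_ae_eq_one hreg hM (e := d.2) (by simp) subset_rfl
  obtain ⟨⟨-, b0⟩, -, a0⟩ := first_term hMAR hreg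
  obtain ⟨b2, a2⟩ := third_term hreg
  obtain ⟨b3, a3⟩ := fourth_term hMAR hreg
  have hb0 : ∫ w, num M d 0 θ w ∂pop.law P = P.real (pop.evD d) := by
    rw [b0, integral_congr_ae hκ]
    simp
  have ha0 : ∫ w, num M d 0 θ w * resid M d 0 θ w ∂pop.law P
      = ∫ ω in pop.evD d, (pop.dY ω - pop.muModel M θ baseline ω) ∂P := by
    rw [a0]
    refine integral_congr_ae ?_
    filter_upwards [hκ] with ω h1
    rw [h1, one_mul]
  -- With κ = 1 the observation factor drops out of the fourth weight, so the third and fourth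
  -- ratios coincide and cancel.
  have hb3 : ∫ w, num M d 3 θ w ∂pop.law P = ∫ w, num M d 2 θ w ∂pop.law P := by
    rw [b2, b3]
    refine integral_congr_ae ?_
    filter_upwards [hκ2] with ω h1
    rw [h1, one_mul]
  have ha3 : ∫ w, num M d 3 θ w * resid M d 3 θ w ∂pop.law P
      = ∫ w, num M d 2 θ w * resid M d 2 θ w ∂pop.law P := by
    rw [a2, a3]
    refine integral_congr_ae ?_
    filter_upwards [hκ2] with ω h1
    rw [h1, one_mul]
  have hμi := (integrable_muModel (c := baseline) hreg (by simp)).integrableOn (s := pop.evD d)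
  have hYi := (integrable_dY hDID).integrableOn (s := pop.evD d)
  have hti : IntegrableOn (pop.trend P) (pop.evD d) P := integrable_condExp.integrableOn
  rw [estimand_eq_ratios hreg, hb3, ha3, hb0, ha0, patt_eq hDID, add_sub_cancel_right]
  rcases h with hC | hO
  -- Both remaining ratios are means over D = d and contain the same error of μ_{d'}, which
  -- disappears from their difference.
  · obtain ⟨b1, a1⟩ := integral_second_of_propensity hDID hMAR hreg hM hC
    rw [a1, b1, integral_sub hYi hμi, integral_sub hti hμi, integral_sub hYi hti]
    ring
  · rw [integral_second_eq_zero hDID hMAR hreg hO, zero_div, sub_zero, div_eq_inv_mul]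
    congr 1
    refine integral_congr_ae ?_
    filter_upwards [ae_restrict_of_ae (muModel_baseline_ae_eq_trend hDID hreg hO)] with ω h1
    rw [h1]

/-- Identification with correct models of the outcome and of the conditional propensity score. -/
theorem estimand_eq_patt_of_outcome (hO : OutcomeCorrect pop P M d θ)
    (hC : CondPropensityCorrect pop P M d θ) :
    estimand M d (pop.law P) θ = pop.patt P d := by
  obtain ⟨⟨bi0, b0⟩, ai0, a0⟩ := first_term hMAR hreg
  obtain ⟨b2, a2⟩ := third_term hreg
  obtain ⟨b3, a3⟩ := fourth_term hMAR hreg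
  have hμ0 := stronglyMeasurable_muModel (c := baseline) hreg (by simp)
  have hμd := stronglyMeasurable_muModel (c := d) hreg (by simp)
  have hμ0i := integrable_muModel (c := baseline) hreg (by simp)
  have hμdi := integrable_muModel (c := d) hreg (by simp)
  have hYi := integrable_dY hDID
  have hm := OutcomeCorrect.m_ae_eq hO (c := d) (by simp)
  have hκ := stronglyMeasurable_obsRatio (P := P) hreg (e := d.2) (by simp)
  obtain ⟨k1, k2⟩ := setIntegral_mul_dY_sub hYi hμ0 hμ0i hm hκ ai0
  have l2 := (setIntegral_mul_dY_sub hYi hμ0 hμ0i hm (h := fun _ => 1) stronglyMeasurable_const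
    (by
      simp only [one_mul]
      exact (hYi.sub hμ0i).integrableOn)).2
  simp only [one_mul] at l2
  -- Here κ is an arbitrary function of X. The weight π_{d₁|d₂} turns the κ-weighted integrals over
  -- D₂ = d₂ into integrals over D = d, and μ_d is the conditional mean of ΔY there, so the fourth
  -- ratio equals the first.
  have hb3 : ∫ w, num M d 3 θ w ∂pop.law P = ∫ w, num M d 0 θ w ∂pop.law P := by
    rw [b0, b3]
    exact integral_evD_eq_integral_pC hκ bi0 hC
  have ha3 : ∫ w, num M d 3 θ w * resid M d 3 θ w ∂pop.law P
      = ∫ w, num M d 0 θ w * resid M d 0 θ w ∂pop.law P := by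
    rw [a0, a3, ← k2]
    refine Eq.trans ?_ (integral_evD_eq_integral_pC (hκ.mul (hμd.sub hμ0)) k1 hC)
    congr 1
    funext ω
    ring
  -- The third ratio carries no κ and is the one that survives: the mean of ΔY minus the trend over
  -- D = d.
  have hb2 : ∫ w, num M d 2 θ w ∂pop.law P = P.real (pop.evD d) := by
    have := integral_evD_eq_integral_pC (g := fun _ => 1) stronglyMeasurable_const
      (integrable_const _).integrableOn hC
    rw [b2]
    simpa using this
  have ha2 : ∫ w, num M d 2 θ w * resid M d 2 θ w ∂pop.law P
      = ∫ ω in pop.evD d, (pop.dY ω - pop.trend P ω) ∂P := by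
    have h1 := integral_evD_eq_integral_pC (hμd.sub hμ0) (hμdi.sub hμ0i).integrableOn hC
    have h2 : ∫ ω in pop.evD d, (pop.dY ω - pop.muModel M θ baseline ω) ∂P
        = ∫ ω in pop.evD d, (pop.dY ω - pop.trend P ω) ∂P := by
      refine integral_congr_ae ?_
      filter_upwards [ae_restrict_of_ae (muModel_baseline_ae_eq_trend hDID hreg hO)] with ω h1
      rw [h1]
    rw [a2, ← h2, ← l2]
    refine Eq.trans ?_ h1
    congr 1
    funext ω
    exact mul_comm _ _
  rw [estimand_eq_ratios hreg, hb3, ha3, hb2, ha2, integral_second_eq_zero hDID hMAR hreg hO,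
    patt_eq hDID]
  ring

end Identification

end Population

end MissingDID

/-! ### The main theorem -/

theorem theorem3 {k nb nc nm nd : ℕ}
    -- the population
    {Ω₀ : Type*} [MeasurableSpace Ω₀] [StandardBorelSpace Ω₀] (P₀ : Measure Ω₀)
    [IsProbabilityMeasure P₀] (pop : MissingDID.Population Ω₀ k)
    (hDID : MissingDID.DIDAssumptions pop P₀) (hMAR : MissingDID.MissingAssumptions pop P₀)
    -- the treatment path of interest
    (d : MissingDID.Path) (hd : d ≠ MissingDID.baseline)
    -- an i.i.d. sample of observed records
    {Ω : Type*} [MeasurableSpace Ω] (P : Measure Ω) [IsProbabilityMeasure P]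
    (W : ℕ → Ω → MissingDID.Obs k) (hWmeas : ∀ i, Measurable (W i)) (hWindep : iIndepFun W P)
    (hWlaw : ∀ i, P.map (W i) = pop.law P₀)
    -- working models, parameter spaces and pseudo-true values
    (M : MissingDID.Models k nb nc nm nd)
    (KB : MissingDID.Path → Set (MissingDID.Vec nb))
    (KC : MissingDID.Path → Set (MissingDID.Vec nc))
    (KM : Bool → Set (MissingDID.Vec nm)) (KD : Bool → Set (MissingDID.Vec nd))
    (θs : MissingDID.Params nb nc nm nd)
    (hreg : MissingDID.Regularity M d (pop.law P₀) (pop.lawX P₀) KB KC KM KD θs)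
    -- asymptotically linear first-step estimators
    (est : ℕ → Ω → MissingDID.Params nb nc nm nd)
    (b : MissingDID.Obs k → MissingDID.Params nb nc nm nd)
    (hbe : ∀ c ∈ ({d, MissingDID.baseline} : Set MissingDID.Path),
      MissingDID.AsymptoticallyLinear P W (pop.law P₀) (fun n ω => (est n ω).be c) (θs.be c)
        (fun w => (b w).be c))
    (hgc : ∀ c ∈ ({d, MissingDID.baseline} : Set MissingDID.Path),
      MissingDID.AsymptoticallyLinear P W (pop.law P₀) (fun n ω => (est n ω).gc c) (θs.gc c)
        (fun w => (b w).gc c))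
    (hgm : ∀ e ∈ ({d.2, MissingDID.baseline.2} : Set Bool),
      MissingDID.AsymptoticallyLinear P W (pop.law P₀) (fun n ω => (est n ω).gm e) (θs.gm e)
        (fun w => (b w).gm e))
    (hde : ∀ e ∈ ({d.2, MissingDID.baseline.2} : Set Bool),
      MissingDID.AsymptoticallyLinear P W (pop.law P₀) (fun n ω => (est n ω).de e) (θs.de e)
        (fun w => (b w).de e))
    -- at least two of the three working models are correct
    (hcorrect :
      (MissingDID.OutcomeCorrect pop P₀ M d θs ∧ MissingDID.PropensityCorrect pop P₀ M d θs ∧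
        MissingDID.CondPropensityCorrect pop P₀ M d θs) ∨
      (MissingDID.MissingCorrect pop P₀ M d θs ∧ MissingDID.PropensityCorrect pop P₀ M d θs) ∨
      (MissingDID.MissingCorrect pop P₀ M d θs ∧ MissingDID.OutcomeCorrect pop P₀ M d θs)) :
    -- the robust estimand is the target parameter
    MissingDID.estimand M d (pop.law P₀) θs = pop.patt P₀ d ∧
    -- the influence function is centred with finite variance
    MemLp (MissingDID.xi M d (pop.law P₀) θs b) 2 (pop.law P₀) ∧
    ∫ w, MissingDID.xi M d (pop.law P₀) θs b w ∂(pop.law P₀) = 0 ∧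
    -- root-n consistency
    TendstoInMeasure P (MissingDID.estimator M d W est) atTop (fun _ => pop.patt P₀ d) ∧
    (∀ ε : ℝ, 0 < ε → ∃ C : ℝ, ∀ᶠ n : ℕ in atTop,
      P.real {ω | C < |Real.sqrt n * (MissingDID.estimator M d W est n ω - pop.patt P₀ d)|} ≤ ε) ∧
    -- asymptotic linearity
    TendstoInMeasure P
      (fun (n : ℕ) ω =>
        Real.sqrt n
            * (MissingDID.estimator M d W est n ω - MissingDID.estimand M d (pop.law P₀) θs)
          - (Real.sqrt n)⁻¹
            * ∑ i ∈ Finset.range n, MissingDID.xi M d (pop.law P₀) θs b (W i ω))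
      atTop (fun _ => 0) ∧
    -- asymptotic normality
    TendstoInDistribution
      (fun (n : ℕ) ω =>
        Real.sqrt n
          * (MissingDID.estimator M d W est n ω - MissingDID.estimand M d (pop.law P₀) θs))
      atTop (id : ℝ → ℝ) (fun _ => P)
      (gaussianReal 0
        (∫ w, MissingDID.xi M d (pop.law P₀) θs b w ^ 2 ∂(pop.law P₀)).toNNReal) := by
  have hobs := pop.measurable_obs
  have : IsProbabilityMeasure (pop.law P₀) :=
    Measure.isProbabilityMeasure_map hobs.aemeasurable
  have hPX : (pop.law P₀).map MissingDID.Obs.x = pop.lawX P₀ :=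
    Measure.map_map MissingDID.Obs.measurable_x hobs
  have hτ : MissingDID.estimand M d (pop.law P₀) θs = pop.patt P₀ d := by
    rcases hcorrect with ⟨hO, -, hC⟩ | ⟨hM, hC⟩ | ⟨hM, hO⟩
    · exact MissingDID.Population.estimand_eq_patt_of_outcome hDID hMAR hreg hO hC
    · exact MissingDID.Population.estimand_eq_patt_of_missing hDID hMAR hreg hM (Or.inl hC)
    · exact MissingDID.Population.estimand_eq_patt_of_missing hDID hMAR hreg hM (Or.inr hO)
  -- The asymptotics are derived for the estimates with irrelevant components frozen, which produce
  -- the same value of the estimator.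
  have hT := MissingDID.asympLinear_restrict hbe hgc hgm hde
  obtain ⟨hξm, hξ, hξ0⟩ := MissingDID.xi_memLp hreg hPX hd hT (b := b) fun _ => rfl
  have hexp := MissingDID.estimator_expansion hreg hPX hd hT (b := b) (fun _ => rfl)
    hWmeas hWindep hWlaw
  have hmeas := hreg.measurable_estimator hWmeas hT.measurable_est
  rw [← MissingDID.estimator_restrict] at hexp hmeas
  have hbdd : BddInProb P fun (n : ℕ) ω => Real.sqrt n
      * (MissingDID.estimator M d W est n ω - pop.patt P₀ d) := by
    have h := hexp.bdd.add (bddInProb_sum_real hWmeas hWindep hWlaw hξm hξ hξ0)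
    simpa only [sub_add_cancel, hτ] using h
  exact ⟨hτ, hξ, hξ0, tendstoInMeasure_iff_smallInProb.2 (BddInProb.small_of_sqrt hbdd), hbdd,
    tendstoInMeasure_zero_iff_smallInProb.2 hexp,
    tendstoInDistribution_of_asymptotically_linear hWmeas hWindep hWlaw hξm hξ hξ0
      (fun n => (((hmeas n).sub_const _).const_mul _).aemeasurable) hexp⟩
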